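/- **Setting.** Let $(M,\mathcal B,m)$ be a measure space, $\mathsf H=L^2(M,m)$ (complex), $\varphi:M\to[1,\infty)$ measurable, and for $s\in\mathbb R$ let $L^2_{\varphi^s}=\{u:\varphi^s u\in L^2(M,m)\}$ with norm $\|u\|_{\varphi^s}=\|\varphi^su\|$, so that $L^2_\varphi\hookrightarrow L^2\hookrightarrow L^2_{\varphi^{-1}}$. For a self-adjoint operator $T$ write $(-T+z)^{-1}$, $z\in\varrho(T)$, for its resolvent, $\sigma_p(T)$ for its set of eigenvalues, $\sigma_{ess}(T)$ for its spectrum without the isolated eigenvalues of finite multiplicity. For a Banach space $X$, $X^*$ is its dual, the pairing being conjugate-linear in the $X^*$-variable; reflexive spaces are identified with their biduals. Let $A$ be self-adjoint in $\mathsf H$, $R_z=(-A+z)^{-1}$, and let $\mathsf H_A$ be $\mathrm{dom}(A)$ with the graph norm. For $k=1,2$ let $\mathfrak h_k$ be a Hilbert space, $\mathfrak b_k$ a reflexive Banach space, $\mathfrak h_k\hookrightarrow\mathfrak b_k$ a dense continuous embedding (hence $\mathfrak b_k^*\hookrightarrow\mathfrak h_k^*$), and $\tau_k:\mathsf H_A\to\mathfrak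 h_k$ bounded, with $\ker\tau_2$ dense in $\mathsf H$ and $\mathrm{ran}\,\tau_2$ dense in $\mathfrak h_2$. Put $G^k_z=(\tau_kR_{\bar z})^*:\mathfrak h_k^*\to\mathsf H$, $\tau=\tau_1\oplus\tau_2$, $G_z=(\tau R_{\bar z})^*$, so that $G_z(\phi_1\oplus\phi_2)=G^1_z\phi_1+G^2_z\phi_2$. Let $\tau$ (same symbol) have a $\mathfrak b_1\oplus\mathfrak b_2$-valued linear extension, defined on a subspace of $\mathsf H$ containing $\mathrm{dom}(A)$ and $\mathrm{ran}(G_z|\mathfrak b_1^*\oplus\mathfrak b_2^*)$ for all $z\in\varrho(A)$, such that $\tau G_z\in\mathscr B(\mathfrak b_1^*\oplus\mathfrak b_2^*,\mathfrak b_1\oplus\mathfrak b_2)$ and $(\tau G_z)^*=\tau G_{\bar z}$. Let $\mathfrak b_{2,2}$ be a reflexive Banach space, $B_0\in\mathscr B(\mathfrak b_2^*,\mathfrak b_{2,2}^*)$, $B_1\in\mathscr B(\mathfrak b_1,\mathfrak b_1^*)$, $B_2\in\mathscr B(\mathfrak b_2,\mathfrak b_{2,2}^*)$, with $B_1=B_1^*$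 and $B_0B_2^*=B_2B_0^*$; put $\mathsf B=(B_0,B_1,B_2)$. Let $$M_z=(1\oplus B_0)-(B_1\oplus B_2)\tau G_z,\qquad M^{B_1}_z=1-B_1\tau_1G^1_z,$$ let $Z_{\mathsf B}$ (resp. $Z_{B_1}$) be the set of $z\in\varrho(A)$ such that $M_w$ (resp. $M^{B_1}_w$) has a bounded inverse for $w=z,\bar z$, and assume that $Z_{\mathsf B}$ and $Z_{B_1}$ are not empty. Let $A_{\mathsf B}$ and $A_{B_1}$ be the operators with resolvents $$R^{\mathsf B}_z=R_z+G_zM_z^{-1}(B_1\oplus B_2)G_{\bar z}^*\ (z\in Z_{\mathsf B}),\qquad R^{B_1}_z=R_z+G^1_z(M^{B_1}_z)^{-1}B_1(G^{1}_{\bar z})^*\ (z\in Z_{B_1});$$ they are well defined and self-adjoint. $R^{\mathsf B}_z$ and $R^{B_1}_z$ also denote their resolvents at all points of $\varrho(A_{\mathsf B})$, resp. $\varrho(A_{B_1})$. Put $G^{B_1}_z=(\tau_2R^{B_1}_{\bar z})^*$, $z\in\varrho(A_{B_1})$, an operator from $\mathfrak b_2^*$ to $\mathsf H$. **Hypotheses.**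 (H1) $A_{B_1}$ is bounded from above and there is a positive $\lambda_1\ge\sup\sigma(A_{B_1})$ such that $R^{B_1}_z\in\mathscr B(L^2_\varphi)$ for every $z\in\varrho(A_{B_1})$ with $\mathrm{Re}\,z>\lambda_1$. (H2) There is a (possibly empty) closed set $e(A_{B_1})\subset\mathbb R$ of zero Lebesgue measure such that for all $\lambda\in\mathbb R\setminus e(A_{B_1})$ the limits $R^{B_1,\pm}_\lambda=\lim_{\epsilon\searrow0}R^{B_1}_{\lambda\pm i\epsilon}$ exist in $\mathscr B(L^2_\varphi,L^2_{\varphi^{-1}})$, and the maps $z\mapsto R^{B_1,\pm}_z$, where $R^{B_1,\pm}_z=R^{B_1}_z$ for $z\in\varrho(A_{B_1})$, are continuous from $(\mathbb R\setminus e(A_{B_1}))\cup\mathbb C_\pm$ to $\mathscr B(L^2_\varphi,L^2_{\varphi^{-1}})$. (H3) For every compact $K\subset\mathbb R\setminus e(A_{B_1})$ there is $c_K>0$ such that for all $\lambda\in K$ and all $u\in L^2_{\varphi^2}$ with $(R^{B_1,+}_\lambda-R^{B_1,-}_\lambda)u=0$ one has $R^{B_1,\pm}_\lambda u\in L^2$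 and $\|R^{B_1,\pm}_\lambda u\|\le c_K\|u\|_{\varphi^2}$. (H4) $A_{\mathsf B}$ is bounded from above; the embedding $\mathfrak h_2\hookrightarrow\mathfrak b_2$ is compact; and there are a positive $\lambda_2>\sup\sigma(A_{B_1})$ and $\eta>0$ such that, for every $z\in\varrho(A_{B_1})$ with $\mathrm{Re}\,z>\lambda_2$, $G^{B_1}_z$ extends to an operator in $\mathscr B(\mathfrak h_2^*,L^2_{\varphi^{2+\eta}})$. **Theorem (limiting absorption principle).** Assume (H1)–(H4) and put $e(A_{\mathsf B})=e(A_{B_1})\cup\sigma_p(A_{\mathsf B})$. Then $e(A_{\mathsf B})$ is closed and of zero Lebesgue measure; for all $\lambda\in\mathbb R\setminus e(A_{\mathsf B})$ the limits $$R^{\mathsf B,\pm}_\lambda=\lim_{\epsilon\searrow0}R^{\mathsf B}_{\lambda\pm i\epsilon}$$ exist in $\mathscr B(L^2_\varphi,L^2_{\varphi^{-1}})$; the maps $z\mapsto R^{\mathsf B,\pm}_z$, where $R^{\mathsf B,\pm}_z=R^{\mathsf B}_z$ for $z\in\varrho(A_{\mathsf B})$, are continuous from $(\mathbb R\setminus e(A_{\mathsf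 B}))\cup\mathbb C_\pm$ to $\mathscr B(L^2_\varphi,L^2_{\varphi^{-1}})$; the set $e(A_{\mathsf B})\setminus e(A_{B_1})$ is discrete in the open set $\mathbb R\setminus e(A_{B_1})$, i.e. it has no accumulation point there; and $\sigma_{ess}(A_{\mathsf B})=\sigma_{ess}(A_{B_1})$. -/

import Mathlib

open Filter Topology MeasureTheory
open scoped ENNReal InnerProductSpace ComplexConjugate

noncomputable section

namespace KreinLAP

section Operators

variable {H : Type*} [NormedAddCommGroup H] [InnerProductSpace ℂ H]

/-- `R` is the bounded inverse `(-T + z)⁻¹` of `-T + z : dom T → H`. -/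
def IsResolventAt (T : H →ₗ.[ℂ] H) (z : ℂ) (R : H →L[ℂ] H) : Prop :=
  (∀ f : H, (R f, z • R f - f) ∈ T.graph) ∧ ∀ x : T.domain, R (z • (x : H) - T x) = x

/-- The resolvent set `ϱ(T)`. -/
def resolventSet (T : H →ₗ.[ℂ] H) : Set ℂ := {z | ∃ R : H →L[ℂ] H, IsResolventAt T z R}

open Classical in
/-- The resolvent `R_z = (-T + z)⁻¹` for `z ∈ ϱ(T)` (and `0` otherwise). -/
def res (T : H →ₗ.[ℂ] H) (z : ℂ) : H →L[ℂ] H :=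
  if hz : ∃ R : H →L[ℂ] H, IsResolventAt T z R then hz.choose else 0

theorem isResolventAt_res {T : H →ₗ.[ℂ] H} {z : ℂ} (hz : z ∈ resolventSet T) :
    IsResolventAt T z (res T z) := by
  have h : ∃ R : H →L[ℂ] H, IsResolventAt T z R := hz
  rw [res, dif_pos h]
  exact h.choose_spec

open Classical in
/-- The resolvent as a bounded operator `H → H_T`, where `H_T` is the domain of `T` with the graph
norm, realized as the graph of `T` (a subspace of `H × H`). -/
def resGraph (T : H →ₗ.[ℂ] H) (z : ℂ) : H →L[ℂ] T.graph :=
  if hz : z ∈ resolventSet T then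
    ((res T z).prod (z • res T z - ContinuousLinearMap.id ℂ H)).codRestrict T.graph
      (fun f => (isResolventAt_res hz).1 f)
  else 0

/-- The spectrum of a self-adjoint operator, as a set of real numbers. -/
def spec (T : H →ₗ.[ℂ] H) : Set ℝ := {x | (x : ℂ) ∉ resolventSet T}

/-- `ker (T - x)`. -/
def eigenspace (T : H →ₗ.[ℂ] H) (x : ℝ) : Submodule ℂ H where
  carrier := {u | (u, (x : ℂ) • u) ∈ T.graph}
  add_mem' := by
    intro u v hu hv
    have h := T.graph.add_mem hu hv
    simpa [smul_add] using h
  zero_mem' := by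
    have h := T.graph.zero_mem
    change ((0 : H), (x : ℂ) • (0 : H)) ∈ T.graph
    rw [smul_zero]
    exact h
  smul_mem' := by
    intro c u hu
    have h := T.graph.smul_mem c hu
    rw [Prod.smul_mk, smul_comm] at h
    exact h

/-- The point spectrum `σ_p(T)`: the set of eigenvalues. -/
def pointSpec (T : H →ₗ.[ℂ] H) : Set ℝ := {x | ∃ u ∈ eigenspace T x, u ≠ 0}

/-- The discrete spectrum: isolated points of the spectrum that are eigenvalues of finite
multiplicity. -/
def discSpec (T : H →ₗ.[ℂ] H) : Set ℝ :=
  {x | x ∈ pointSpec T ∧ FiniteDimensional ℂ (eigenspace T x) ∧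
    ∃ ε > 0, ∀ y ∈ spec T, |y - x| < ε → y = x}

/-- The essential spectrum `σ_ess(T) = σ(T) \ σ_disc(T)`. -/
def essSpec (T : H →ₗ.[ℂ] H) : Set ℝ := spec T \ discSpec T

/-- `T` is bounded from above: `⟨u, T u⟩ ≤ c ‖u‖²` on the domain of `T`. -/
def BddAboveOp (T : H →ₗ.[ℂ] H) : Prop :=
  ∃ c : ℝ, ∀ x : T.domain, (⟪(x : H), T x⟫_ℂ).re ≤ c * ‖(x : H)‖ ^ 2

/-- The operator whose resolvent at every `z ∈ Z` is `R z`: its graph consists of the `(u, v)` with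
`R z (z u - v) = u` for all `z ∈ Z`. -/
def opOfResolvent (Z : Set ℂ) (R : ℂ → H →L[ℂ] H) : H →ₗ.[ℂ] H :=
  Submodule.toLinearPMap
    { carrier := {p : H × H | ∀ z ∈ Z, R z (z • p.1 - p.2) = p.1}
      add_mem' := by
        intro p q hp hq z hz
        have h : z • (p + q).1 - (p + q).2 = (z • p.1 - p.2) + (z • q.1 - q.2) := by
          simp only [Prod.fst_add, Prod.snd_add, smul_add]; abel
        rw [h, map_add, hp z hz, hq z hz, Prod.fst_add]
      zero_mem' := by intro z _; simp
      smul_mem' := by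
        intro c p hp z hz
        have h : z • (c • p).1 - (c • p).2 = c • (z • p.1 - p.2) := by
          simp only [Prod.smul_fst, Prod.smul_snd, smul_sub, smul_comm z c]
        rw [h, map_smul, hp z hz, Prod.smul_fst] }

end Operators

section Duality

/-- The dual `X*` of a complex Banach space, in the convention in which the pairing
`⟨ψ, x⟩_{X*,X}` is conjugate-linear in `ψ` and linear in `x`: `ψ ∈ X*` is represented by the
conjugate-linear functional `x ↦ conj ⟨ψ, x⟩ = ⟨x, ψ⟩_{X,X*}`, so that `X*` is a complex Banach
space in a way that is compatible with embeddings `X ↪ X° ↪ X*` through a Hilbert space `X°`. -/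
abbrev Dual' (X : Type*) [NormedAddCommGroup X] [NormedSpace ℂ X] := X →L⋆[ℂ] ℂ

variable {X Y : Type*} [NormedAddCommGroup X] [NormedSpace ℂ X]
  [NormedAddCommGroup Y] [NormedSpace ℂ Y]

/-- The dual `L* : Y* → X*` of a bounded operator `L : X → Y`. -/
def dualMap (L : X →L[ℂ] Y) : Dual' Y →L[ℂ] Dual' X := ContinuousLinearMap.precomp ℂ L

/-- Reflexivity: every element of `X**` is evaluation at a point of `X`. -/
def Reflexive' (X : Type*) [NormedAddCommGroup X] [NormedSpace ℂ X] : Prop :=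
  ∀ F : Dual' (Dual' X), ∃ x : X, ∀ ψ : Dual' X, F ψ = conj (ψ x)

variable {H : Type*} [NormedAddCommGroup H] [InnerProductSpace ℂ H] [CompleteSpace H]

/-- The Riesz identification `H* ≅ H`. -/
def riesz : Dual' H →L[ℂ] H :=
  LinearMap.mkContinuous
    { toFun := fun F => (InnerProductSpace.toDual ℂ H).symm ((starL ℂ (A := ℂ)).toContinuousLinearMap.comp F)
      map_add' := by
        intro F G
        rw [← map_add]; congr 1; ext x; simp
      map_smul' := by
        intro c F
        rw [RingHom.id_apply, ← starRingEnd_self_apply c, ← map_smulₛₗ]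
        congr 1; ext x; simp }
    1 (by
      intro F
      simp only [LinearMap.coe_mk, AddHom.coe_mk, one_mul, LinearIsometryEquiv.norm_map]
      refine ContinuousLinearMap.opNorm_le_bound _ (norm_nonneg _) (fun x => ?_)
      simpa using F.le_opNorm x)

theorem inner_riesz (F : Dual' H) (u : H) : ⟪u, riesz F⟫_ℂ = F u := by
  rw [← inner_conj_symm]
  change conj ⟪(InnerProductSpace.toDual ℂ H).symm _, u⟫_ℂ = _
  rw [InnerProductSpace.toDual_symm_apply]
  simp

/-- The adjoint `L* : X* → H` of `L : H → X`: `⟨u, L* ψ⟩ = ⟨L u, ψ⟩_{X,X*}`. -/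
def dualToHilbert (L : H →L[ℂ] X) : Dual' X →L[ℂ] H := riesz ∘L dualMap L

end Duality

/-- The data from which the perturbed operators are built. -/
structure PerturbationData (H h₁ h₂ b₁ b₂ b₂₂ : Type*)
    [NormedAddCommGroup H] [InnerProductSpace ℂ H] [CompleteSpace H]
    [NormedAddCommGroup h₁] [InnerProductSpace ℂ h₁] [CompleteSpace h₁]
    [NormedAddCommGroup h₂] [InnerProductSpace ℂ h₂] [CompleteSpace h₂]
    [NormedAddCommGroup b₁] [NormedSpace ℂ b₁] [CompleteSpace b₁]
    [NormedAddCommGroup b₂] [NormedSpace ℂ b₂] [CompleteSpace b₂]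
    [NormedAddCommGroup b₂₂] [NormedSpace ℂ b₂₂] [CompleteSpace b₂₂] where
  /-- the unperturbed self-adjoint operator -/
  A : H →ₗ.[ℂ] H
  selfAdjoint : IsSelfAdjoint A
  /-- the bounded trace-like maps `τ_k : H_A → h_k`, where `H_A` is `dom A` with the graph norm -/
  τ₁ : A.graph →L[ℂ] h₁
  τ₂ : A.graph →L[ℂ] h₂
  dense_ker_τ₂ : Dense {u : H | ∃ x : A.graph, (x : H × H).1 = u ∧ τ₂ x = 0}
  denseRange_τ₂ : DenseRange τ₂
  reflexive_b₁ : Reflexive' b₁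
  reflexive_b₂ : Reflexive' b₂
  reflexive_b₂₂ : Reflexive' b₂₂
  /-- the dense continuous embeddings `h_k ↪ b_k` -/
  ι₁ : h₁ →L[ℂ] b₁
  ι₂ : h₂ →L[ℂ] b₂
  injective_ι₁ : Function.Injective ι₁
  injective_ι₂ : Function.Injective ι₂
  denseRange_ι₁ : DenseRange ι₁
  denseRange_ι₂ : DenseRange ι₂
  /-- the `b₁ ⊕ b₂`-valued extension of `τ = τ₁ ⊕ τ₂` -/
  τext : H →ₗ.[ℂ] (b₁ × b₂)
  τext_extends : ∀ x : A.graph, ((x : H × H).1, (ι₁ (τ₁ x), ι₂ (τ₂ x))) ∈ τext.graph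
  /-- for `z ∈ ϱ(A)`, the extension is defined on the range of `G_z = (τ R_{z̄})*` restricted to
  `b₁* ⊕ b₂*`, and `τ G_z` is bounded from `b₁* ⊕ b₂*` to `b₁ ⊕ b₂` -/
  τext_bounded : ∀ z ∈ resolventSet A,
    ∃ T : (Dual' b₁ × Dual' b₂) →L[ℂ] (b₁ × b₂), ∀ ψ : Dual' b₁ × Dual' b₂,
      (dualToHilbert (τ₁ ∘L resGraph A (conj z)) (dualMap ι₁ ψ.1) +
        dualToHilbert (τ₂ ∘L resGraph A (conj z)) (dualMap ι₂ ψ.2), T ψ) ∈ τext.graph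
  /-- the extension respects duality, `(τ G_z)* = τ G_{z̄}` -/
  τext_symm : ∀ z ∈ resolventSet A, ∀ (ψ χ : Dual' b₁ × Dual' b₂) (x y : b₁ × b₂),
    (dualToHilbert (τ₁ ∘L resGraph A (conj z)) (dualMap ι₁ ψ.1) +
      dualToHilbert (τ₂ ∘L resGraph A (conj z)) (dualMap ι₂ ψ.2), x) ∈ τext.graph →
    (dualToHilbert (τ₁ ∘L resGraph A z) (dualMap ι₁ χ.1) +
      dualToHilbert (τ₂ ∘L resGraph A z) (dualMap ι₂ χ.2), y) ∈ τext.graph →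
    χ.1 x.1 + χ.2 x.2 = conj (ψ.1 y.1 + ψ.2 y.2)
  /-- the parameters `B₀, B₁, B₂` -/
  B₀ : Dual' b₂ →L[ℂ] Dual' b₂₂
  B₁ : b₁ →L[ℂ] Dual' b₁
  B₂ : b₂ →L[ℂ] Dual' b₂₂
  /-- `B₁ = B₁*` -/
  B₁_symm : ∀ x y : b₁, B₁ x y = conj (B₁ y x)
  /-- `B₀ B₂* = B₂ B₀*` on `b₂₂ = b₂₂**`: here `ψ = B₂* x ∈ b₂*` and `v = B₀* x ∈ b₂ = b₂**` -/
  B₀B₂_symm : ∀ (x : b₂₂) (ψ : Dual' b₂) (v : b₂), (∀ w : b₂, ψ w = conj (B₂ w x)) →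
    (∀ χ : Dual' b₂, χ v = B₀ χ x) → B₀ ψ = B₂ v

namespace PerturbationData

variable {H h₁ h₂ b₁ b₂ b₂₂ : Type*}
    [NormedAddCommGroup H] [InnerProductSpace ℂ H] [CompleteSpace H]
    [NormedAddCommGroup h₁] [InnerProductSpace ℂ h₁] [CompleteSpace h₁]
    [NormedAddCommGroup h₂] [InnerProductSpace ℂ h₂] [CompleteSpace h₂]
    [NormedAddCommGroup b₁] [NormedSpace ℂ b₁] [CompleteSpace b₁]
    [NormedAddCommGroup b₂] [NormedSpace ℂ b₂] [CompleteSpace b₂]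
    [NormedAddCommGroup b₂₂] [NormedSpace ℂ b₂₂] [CompleteSpace b₂₂]
    (P : PerturbationData H h₁ h₂ b₁ b₂ b₂₂)

/-- `G^1_z = (τ₁ R_{z̄})* : h₁* → H`. -/
def G₁ (z : ℂ) : Dual' h₁ →L[ℂ] H := dualToHilbert (P.τ₁ ∘L resGraph P.A (conj z))

/-- `G^2_z = (τ₂ R_{z̄})* : h₂* → H`. -/
def G₂ (z : ℂ) : Dual' h₂ →L[ℂ] H := dualToHilbert (P.τ₂ ∘L resGraph P.A (conj z))

/-- `G_z | b₁* ⊕ b₂* → H`. -/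
def G (z : ℂ) : (Dual' b₁ × Dual' b₂) →L[ℂ] H :=
  (P.G₁ z ∘L dualMap P.ι₁).coprod (P.G₂ z ∘L dualMap P.ι₂)

/-- `(G_{z̄})* = τ R_z`, as an operator `H → b₁ ⊕ b₂`. -/
def Gstar (z : ℂ) : H →L[ℂ] (b₁ × b₂) :=
  (P.ι₁ ∘L P.τ₁ ∘L resGraph P.A z).prod (P.ι₂ ∘L P.τ₂ ∘L resGraph P.A z)

open Classical in
/-- `τ G_z : b₁* ⊕ b₂* → b₁ ⊕ b₂` for `z ∈ ϱ(A)`. -/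
def τG (z : ℂ) : (Dual' b₁ × Dual' b₂) →L[ℂ] (b₁ × b₂) :=
  if hz : ∃ T : (Dual' b₁ × Dual' b₂) →L[ℂ] (b₁ × b₂), ∀ ψ, (P.G z ψ, T ψ) ∈ P.τext.graph then
    hz.choose else 0

/-- `τ₁ G^1_z : b₁* → b₁`. -/
def τ₁G₁ (z : ℂ) : Dual' b₁ →L[ℂ] b₁ :=
  ContinuousLinearMap.fst ℂ b₁ b₂ ∘L P.τG z ∘L
    ContinuousLinearMap.inl ℂ (Dual' b₁) (Dual' b₂)

/-- `M_z = (1 ⊕ B₀) - (B₁ ⊕ B₂) τ G_z`. -/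
def M (z : ℂ) : (Dual' b₁ × Dual' b₂) →L[ℂ] (Dual' b₁ × Dual' b₂₂) :=
  (ContinuousLinearMap.id ℂ (Dual' b₁)).prodMap P.B₀ - P.B₁.prodMap P.B₂ ∘L P.τG z

/-- `Z_B`: the `z ∈ ϱ(A)` such that `M_z` and `M_{z̄}` have bounded inverses. -/
def Z : Set ℂ :=
  {z | z ∈ resolventSet P.A ∧ (P.M z).IsInvertible ∧ (P.M (conj z)).IsInvertible}

/-- `Λ_z = M_z⁻¹ (B₁ ⊕ B₂)`. -/
def Λ (z : ℂ) : (b₁ × b₂) →L[ℂ] (Dual' b₁ × Dual' b₂) :=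
  (P.M z).inverse ∘L P.B₁.prodMap P.B₂

/-- `R^B_z = R_z + G_z Λ_z (G_{z̄})*`, for `z ∈ Z_B`. -/
def RB (z : ℂ) : H →L[ℂ] H := res P.A z + P.G z ∘L P.Λ z ∘L P.Gstar z

/-- The operator `A_B`. -/
def AB : H →ₗ.[ℂ] H := opOfResolvent P.Z P.RB

/-- `M^{B₁}_z = 1 - B₁ τ₁ G^1_z`. -/
def M₁ (z : ℂ) : Dual' b₁ →L[ℂ] Dual' b₁ :=
  ContinuousLinearMap.id ℂ (Dual' b₁) - P.B₁ ∘L P.τ₁G₁ z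

/-- `Z_{B₁}`: the `z ∈ ϱ(A)` such that `M^{B₁}_z` and `M^{B₁}_{z̄}` have bounded inverses. -/
def Z₁ : Set ℂ :=
  {z | z ∈ resolventSet P.A ∧ (P.M₁ z).IsInvertible ∧ (P.M₁ (conj z)).IsInvertible}

/-- `Λ^{B₁}_z = (1 - B₁ τ₁ G^1_z)⁻¹ B₁`. -/
def Λ₁ (z : ℂ) : b₁ →L[ℂ] Dual' b₁ := (P.M₁ z).inverse ∘L P.B₁

/-- `R^{B₁}_z = R_z + G^1_z Λ^{B₁}_z (G^1_{z̄})*`, for `z ∈ Z_{B₁}`. -/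
def RB₁ (z : ℂ) : H →L[ℂ] H :=
  res P.A z + (P.G₁ z ∘L dualMap P.ι₁) ∘L P.Λ₁ z ∘L (P.ι₁ ∘L P.τ₁ ∘L resGraph P.A z)

/-- The operator `A_{B₁}`. -/
def AB₁ : H →ₗ.[ℂ] H := opOfResolvent P.Z₁ P.RB₁

/-- `K : b₂* → H` is the operator `G^{B₁}_z = (τ₂ R^{B₁}_{z̄})*`, where `R^{B₁}` is the resolvent of
`A_{B₁}` and `τ₂` is the second component of the extension of `τ`. -/
def IsGB₁ (z : ℂ) (K : Dual' b₂ →L[ℂ] H) : Prop :=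
  ∀ (ψ : Dual' b₂) (u : H), ∃ y : b₁ × b₂,
    (res P.AB₁ (conj z) u, y) ∈ P.τext.graph ∧ ⟪u, K ψ⟫_ℂ = ψ y.2

end PerturbationData

section Weighted

/-- A measurable weight `M → [1, ∞)`. -/
structure Weight (M : Type*) [MeasurableSpace M] where
  w : M → ℝ
  measurable_w : Measurable w
  one_le_w : ∀ x, 1 ≤ w x

variable {M : Type*} [MeasurableSpace M]

/-- The measure `φ^{2s} m`. -/
def wMeasure (m : Measure M) (φ : Weight M) (s : ℝ) : Measure M :=
  m.withDensity fun x => ENNReal.ofReal ((φ.w x ^ s) ^ 2)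

/-- `L²_{φ^s}(M, m) = {u : φ^s u ∈ L²(M, m)} = L²(M, φ^{2s} m)`. -/
abbrev L2w (m : Measure M) (φ : Weight M) (s : ℝ) := Lp ℂ 2 (wMeasure m φ s)

theorem norm_toLp_mono {μ ν : Measure M} (h : ν ≤ μ) (f : Lp ℂ 2 μ) :
    ‖((Lp.memLp f).mono_measure h).toLp (f : M → ℂ)‖ ≤ 1 * ‖f‖ := by
  rw [one_mul, Lp.norm_toLp, Lp.norm_def]
  exact ENNReal.toReal_mono (Lp.eLpNorm_ne_top f) (eLpNorm_mono_measure f h)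

/-- The embedding `L²(μ) ↪ L²(ν)`, `u ↦ u`, for `ν ≤ μ`. -/
def lpEmb {μ ν : Measure M} (h : ν ≤ μ) : Lp ℂ 2 μ →L[ℂ] Lp ℂ 2 ν :=
  LinearMap.mkContinuous
    { toFun := fun f => ((Lp.memLp f).mono_measure h).toLp f
      map_add' := by
        intro f g
        rw [← MemLp.toLp_add]
        exact MemLp.toLp_congr _ _ (h.absolutelyContinuous.ae_eq (Lp.coeFn_add f g))
      map_smul' := by
        intro c f
        rw [RingHom.id_apply, ← MemLp.toLp_const_smul]
        exact MemLp.toLp_congr _ _ (h.absolutelyContinuous.ae_eq (Lp.coeFn_smul c f)) }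
    1 (fun f => norm_toLp_mono h f)

theorem wMeasure_mono (m : Measure M) (φ : Weight M) {s t : ℝ} (h : s ≤ t) :
    wMeasure m φ s ≤ wMeasure m φ t := by
  refine withDensity_mono (Eventually.of_forall fun x => ENNReal.ofReal_le_ofReal ?_)
  have h1 := φ.one_le_w x
  have h0 : 0 ≤ φ.w x ^ s := Real.rpow_nonneg (by linarith) s
  have h2 : φ.w x ^ s ≤ φ.w x ^ t := Real.rpow_le_rpow_of_exponent_le h1 h
  gcongr

theorem wMeasure_zero (m : Measure M) (φ : Weight M) : wMeasure m φ 0 = m := by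
  have h : (fun x => ENNReal.ofReal ((φ.w x ^ (0 : ℝ)) ^ 2)) = fun _ => (1 : ℝ≥0∞) := by
    funext x; simp
  rw [wMeasure, h]; exact withDensity_one

variable (m : Measure M) (φ : Weight M)

/-- The embedding `L²_{φ^t} ↪ L²_{φ^s}` for `s ≤ t`. -/
def embW {s t : ℝ} (h : s ≤ t) : L2w m φ t →L[ℂ] L2w m φ s := lpEmb (wMeasure_mono m φ h)

/-- The embedding `L²_{φ^t} ↪ L²` for `t ≥ 0`. -/
def toL2 {t : ℝ} (h : 0 ≤ t) : L2w m φ t →L[ℂ] Lp ℂ 2 m :=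
  lpEmb ((wMeasure_zero m φ).symm.le.trans (wMeasure_mono m φ h))

/-- The embedding `L² ↪ L²_{φ⁻¹}`. -/
def fromL2 : Lp ℂ 2 m →L[ℂ] L2w m φ (-1) :=
  lpEmb ((wMeasure_mono m φ (by norm_num : (-1 : ℝ) ≤ 0)).trans (wMeasure_zero m φ).le)

/-- A bounded operator on `L²`, regarded as an element of `B(L²_φ, L²_{φ⁻¹})`. -/
def asWeighted (T : Lp ℂ 2 m →L[ℂ] Lp ℂ 2 m) : L2w m φ 1 →L[ℂ] L2w m φ (-1) :=
  fromL2 m φ ∘L T ∘L toL2 m φ zero_le_one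

open Classical in
/-- The map `z ↦ R^±_z`, equal to the resolvent of `T` at `z ∈ ϱ(T)` and to the boundary value
`Rlim x` at a real `z = x ∉ ϱ(T)`. -/
def extRes (T : Lp ℂ 2 m →ₗ.[ℂ] Lp ℂ 2 m) (Rlim : ℝ → (L2w m φ 1 →L[ℂ] L2w m φ (-1))) (z : ℂ) :
    L2w m φ 1 →L[ℂ] L2w m φ (-1) :=
  if z ∈ resolventSet T then asWeighted m φ (res T z) else Rlim z.re

/-- The Limiting Absorption Principle for `T` with exceptional set `e`: `e` is closed of zero
Lebesgue measure, the limits `Rp x`, `Rm x` of the resolvent at `x ± iε` as `ε ↘ 0` exist in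
`B(L²_φ, L²_{φ⁻¹})` for all real `x ∉ e`, and the maps `z ↦ R^±_z` are continuous on
`(ℝ \ e) ∪ ℂ_±`. -/
structure LAP (T : Lp ℂ 2 m →ₗ.[ℂ] Lp ℂ 2 m) (e : Set ℝ)
    (Rp Rm : ℝ → (L2w m φ 1 →L[ℂ] L2w m φ (-1))) : Prop where
  isClosed : IsClosed e
  null : volume e = 0
  tendsto_p : ∀ x : ℝ, x ∉ e →
    Tendsto (fun ε : ℝ => asWeighted m φ (res T (x + ε * Complex.I))) (𝓝[>] 0) (𝓝 (Rp x))
  tendsto_m : ∀ x : ℝ, x ∉ e →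
    Tendsto (fun ε : ℝ => asWeighted m φ (res T (x - ε * Complex.I))) (𝓝[>] 0) (𝓝 (Rm x))
  cont_p : ContinuousOn (extRes m φ T Rp) {z : ℂ | (z.im = 0 ∧ z.re ∉ e) ∨ 0 < z.im}
  cont_m : ContinuousOn (extRes m φ T Rm) {z : ℂ | (z.im = 0 ∧ z.re ∉ e) ∨ z.im < 0}

/-- `D` is discrete in the open set `E`: `D ⊆ E` and no accumulation point of `D` lies in `E`. -/
def DiscreteIn (D E : Set ℝ) : Prop :=
  IsOpen E ∧ D ⊆ E ∧ ∀ x : ℝ, AccPt x (𝓟 D) → x ∉ E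

/-- Hypothesis (H1) for an operator `T`: it is bounded from above, and for some positive
`c ≥ sup σ(T)` the resolvent maps `L²_φ` boundedly into itself whenever `Re z > c`. -/
def HypH1 (T : Lp ℂ 2 m →ₗ.[ℂ] Lp ℂ 2 m) : Prop :=
  BddAboveOp T ∧ ∃ c : ℝ, 0 < c ∧ (∀ x ∈ spec T, x ≤ c) ∧
    ∀ z ∈ resolventSet T, c < z.re → ∃ S : L2w m φ 1 →L[ℂ] L2w m φ 1,
      ∀ u, toL2 m φ zero_le_one (S u) = res T z (toL2 m φ zero_le_one u)

/-- Hypothesis (H3) for the boundary values `Rp`, `Rm`: for compact `K ⊆ ℝ \ e` there is `c > 0`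
such that `R^±_x u ∈ L²` and `‖R^±_x u‖ ≤ c ‖u‖_{φ²}` for all `x ∈ K` and all `u ∈ L²_{φ²}` with
`R^+_x u = R^-_x u`. -/
def HypH3 (e : Set ℝ) (Rp Rm : ℝ → (L2w m φ 1 →L[ℂ] L2w m φ (-1))) : Prop :=
  ∀ K : Set ℝ, IsCompact K → K ⊆ eᶜ → ∃ c > 0, ∀ x ∈ K, ∀ u : L2w m φ 2,
    (Rp x - Rm x) (embW m φ one_le_two u) = 0 →
      (∃ v : Lp ℂ 2 m, fromL2 m φ v = Rp x (embW m φ one_le_two u) ∧ ‖v‖ ≤ c * ‖u‖) ∧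
      (∃ v : Lp ℂ 2 m, fromL2 m φ v = Rm x (embW m φ one_le_two u) ∧ ‖v‖ ≤ c * ‖u‖)

variable {h₁ h₂ b₁ b₂ b₂₂ : Type*}
    [NormedAddCommGroup h₁] [InnerProductSpace ℂ h₁] [CompleteSpace h₁]
    [NormedAddCommGroup h₂] [InnerProductSpace ℂ h₂] [CompleteSpace h₂]
    [NormedAddCommGroup b₁] [NormedSpace ℂ b₁] [CompleteSpace b₁]
    [NormedAddCommGroup b₂] [NormedSpace ℂ b₂] [CompleteSpace b₂]
    [NormedAddCommGroup b₂₂] [NormedSpace ℂ b₂₂] [CompleteSpace b₂₂]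

/-- Hypothesis (H4): `A_B` is bounded from above, the embedding `h₂ ↪ b₂` is compact, and for some
positive `c > sup σ(A_{B₁})` and some `η > 0` the operator `G^{B₁}_z` is bounded from `h₂*` to
`L²_{φ^{2+η}}` whenever `z ∈ ϱ(A_{B₁})` and `Re z > c`. -/
def HypH4 (P : PerturbationData (Lp ℂ 2 m) h₁ h₂ b₁ b₂ b₂₂) : Prop :=
  BddAboveOp P.AB ∧ IsCompactOperator P.ι₂ ∧
    ∃ c : ℝ, 0 < c ∧ (∃ c' < c, ∀ x ∈ spec P.AB₁, x ≤ c') ∧ ∃ (η : ℝ) (hη : 0 < η),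
      ∀ z ∈ resolventSet P.AB₁, c < z.re → ∃ S : Dual' h₂ →L[ℂ] L2w m φ (2 + η),
        P.IsGB₁ z (toL2 m φ (by linarith) ∘L S ∘L dualMap P.ι₂)

end Weighted

end KreinLAP

end

/-!
The limiting absorption principle for `A_{B₁}` is carried over to `A_B` by a compactness argument.

*Reduction to a compact perturbation.* The Kreĭn formulas for the two operators over `A` combine into
one for `A_B` relative to `A_{B₁}` (`PerturbationData.RB_sub_RB₁`): the difference of the resolvents
is `G N G*` with `G = G^{B₁}`. A real point `c` beyond both spectra need not belong to `ϱ(A)`, where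
these formulas live, so the factorization is moved there from a non-real point with the resolvent
identity (`PerturbationData.res_AB_sub_res_AB₁`). Since `G` maps `h₂*` into `L²_{φ^{2+η}}`, the
difference at `c` extends to an operator `K : L²_{φ⁻¹} → L²_{φ²}`, and `K` is compact because it
factors through `h₂ ↪ b₂` (`PerturbationData.exists_compactPerturbation`). What remains concerns two
self-adjoint operators `T`, `T₁` with such a `K`, and is done for a `CompactPerturbation`.

*The perturbed resolvent.* With `R_z`, `S_z` the resolvents of `T`, `T₁`, the resolvent identity gives
`R_z = (S_z + K (1 + (c - z) S_z)) (1 - (c - z) K (1 + (c - z) S_z))⁻¹`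
(`CompactPerturbation.perturbed_sandwich`), where only `S_z : L²_φ → L²_{φ⁻¹}` enters and the
inverse is that of a compact perturbation of the identity of `L²_φ`. The right hand side is
continuous in `z` and `S_z` jointly, so all limits and all continuity come down to the invertibility
at the boundary.

*Invertibility.* By the Fredholm alternative, non-invertibility at a real `x` gives `u ≠ 0` with
`u = (c - x) K (1 + (c - x) Ψ) u`, `Ψ` a boundary value of `S_z`. As `K` is symmetric, `⟨Ψ u, u⟩` is
real. Its imaginary part is the limit of `Im z ‖S_z u‖²`, so by the Cauchy-Schwarz inequality the two
boundary values agree at `u`. As `u` lies in `L²_{φ²}`, the hypothesis on the boundary values puts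
`Ψ u` into `L²`; then `(1 + (c - x) Ψ) u` is an eigenvector of `T`
(`CompactPerturbation.BoundaryValues.eq_zero_of_comp_eq`).

*Eigenvalues.* Conversely every eigenvector `v` arises in this way, with `‖v‖ ≤ C ‖K v‖` and `C`
uniform on compact sets. A compact operator is not bounded below on an orthonormal sequence, so there
are finitely many eigenvalues in each compact set
(`CompactPerturbation.finite_pointSpec_inter`).

*Essential spectrum.* The resolvent difference at `c` is compact in `L²`. Weyl's theorem is proved by
characterizing the complement of the essential spectrum through left parametrices of
`(-T + x) (-T + c)⁻¹` (`exists_parametrix_of_mem_discSpec`, `not_mem_essSpec_of_parametrix`).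
-/

noncomputable section

namespace KreinLAP

/-! ### Resolvents of self-adjoint operators -/

section Resolvents

variable {H : Type*} [NormedAddCommGroup H] [InnerProductSpace ℂ H]
  {T : H →ₗ.[ℂ] H} {z w : ℂ} {R R' : H →L[ℂ] H}

theorem inner_self_eq_ofReal (u : H) : ⟪u, u⟫_ℂ = ((‖u‖ ^ 2 : ℝ) : ℂ) := by
  rw [inner_self_eq_norm_sq_to_K]; norm_cast

theorem IsResolventAt.apply_of_mem (h : IsResolventAt T z R) {u v : H} (huv : (u, v) ∈ T.graph) :
    R (z • u - v) = u := by
  obtain ⟨x, hx, hv⟩ := (T.mem_graph_iff).1 huv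
  simp only at hx hv
  rw [← hx, ← hv]
  exact h.2 x

theorem IsResolventAt.unique (h : IsResolventAt T z R) (h' : IsResolventAt T z R') : R = R' := by
  ext f
  have := h'.apply_of_mem (h.1 f)
  rw [sub_sub_cancel] at this
  exact this.symm

theorem IsResolventAt.mem (h : IsResolventAt T z R) : z ∈ resolventSet T := ⟨R, h⟩

theorem IsResolventAt.res_eq (h : IsResolventAt T z R) : res T z = R :=
  (isResolventAt_res h.mem).unique h

theorem res_mem_graph (hz : z ∈ resolventSet T) (f : H) :
    (res T z f, z • res T z f - f) ∈ T.graph :=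
  (isResolventAt_res hz).1 f

theorem res_apply_of_mem (hz : z ∈ resolventSet T) {u v : H} (huv : (u, v) ∈ T.graph) :
    res T z (z • u - v) = u :=
  (isResolventAt_res hz).apply_of_mem huv

/-- The first resolvent identity, for the resolvent `(-T + z)⁻¹`. -/
theorem res_identity (hz : z ∈ resolventSet T) (hw : w ∈ resolventSet T) (f : H) :
    res T z f = res T w f + (w - z) • res T z (res T w f) := by
  have h := res_apply_of_mem hz (res_mem_graph hw f)
  have e : z • res T w f - (w • res T w f - f) = f - (w - z) • res T w f := by module
  rw [e, map_sub, map_smul] at h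
  exact sub_eq_iff_eq_add.1 h

theorem res_commute (hz : z ∈ resolventSet T) (hw : w ∈ resolventSet T) (f : H) :
    res T z (res T w f) = res T w (res T z f) := by
  by_cases hzw : w - z = 0
  · rw [sub_eq_zero] at hzw; rw [hzw]
  have h1 := res_identity hz hw f
  have h2 := res_identity hw hz f
  have h3 : (w - z) • res T z (res T w f) = (w - z) • res T w (res T z f) := by
    rw [← sub_eq_iff_eq_add'] at h1 h2
    rw [← h1, ← neg_sub z w, neg_smul, ← h2]; module
  exact smul_right_injective H hzw h3

theorem resGraph_apply (hz : z ∈ resolventSet T) (f : H) :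
    (resGraph T z f : H × H) = (res T z f, z • res T z f - f) := by
  rw [resGraph, dif_pos hz]; rfl

theorem res_injective (hz : z ∈ resolventSet T) : Function.Injective (res T z) := by
  rw [injective_iff_map_eq_zero]
  intro f hf
  have h := res_mem_graph hz f
  rw [hf, smul_zero, zero_sub] at h
  have := T.graph_fst_eq_zero_snd h rfl
  simpa using this

theorem mem_eigenspace {x : ℝ} {u : H} : u ∈ eigenspace T x ↔ (u, (x : ℂ) • u) ∈ T.graph := Iff.rfl

theorem mem_eigenspace_iff_res {x : ℝ} (hz : z ∈ resolventSet T) {u : H} :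
    u ∈ eigenspace T x ↔ u = (z - x) • res T z u := by
  rw [mem_eigenspace]
  constructor
  · intro h
    have := res_apply_of_mem hz h
    rw [← sub_smul, map_smul] at this
    exact this.symm
  · intro h
    have h1 := T.graph.smul_mem (z - x) (res_mem_graph hz u)
    rw [Prod.smul_mk, smul_sub, smul_comm, ← h] at h1
    convert h1 using 2
    module

theorem not_mem_resolventSet_of_pointSpec {x : ℝ} (hx : x ∈ pointSpec T) :
    (x : ℂ) ∉ resolventSet T := by
  intro h
  obtain ⟨u, hu, hu0⟩ := hx
  apply hu0
  rw [(mem_eigenspace_iff_res h).1 hu, sub_self, zero_smul]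

end Resolvents

section SelfAdjoint

variable {H : Type*} [NormedAddCommGroup H] [InnerProductSpace ℂ H] [CompleteSpace H]
  {T : H →ₗ.[ℂ] H} {z w : ℂ}

theorem inner_graph_symm (hT : IsSelfAdjoint T) {u v u' v' : H} (h : (u, v) ∈ T.graph)
    (h' : (u', v') ∈ T.graph) : ⟪v, u'⟫_ℂ = ⟪u, v'⟫_ℂ := by
  have hf := LinearPMap.adjoint_isFormalAdjoint hT.dense_domain
  rw [LinearPMap.isSelfAdjoint_def.1 hT] at hf
  obtain ⟨x, hx, hv⟩ := (T.mem_graph_iff).1 h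
  obtain ⟨x', hx', hv'⟩ := (T.mem_graph_iff).1 h'
  simp only at hx hv hx' hv'
  rw [← hx, ← hv, ← hx', ← hv']
  exact hf x x'

theorem im_inner_graph (hT : IsSelfAdjoint T) {u v : H} (h : (u, v) ∈ T.graph) :
    (⟪u, v⟫_ℂ).im = 0 := by
  have h1 := inner_graph_symm hT h h
  rw [← inner_conj_symm] at h1
  exact Complex.conj_eq_iff_im.1 h1

/-- The graph of a self-adjoint operator contains the graph of its adjoint. -/
theorem mem_graph_of_forall_inner (hT : IsSelfAdjoint T) {y y' : H}
    (h : ∀ u v : H, (u, v) ∈ T.graph → ⟪y', u⟫_ℂ = ⟪y, v⟫_ℂ) : (y, y') ∈ T.graph := by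
  have h' : ∀ x : T.domain, ⟪y', (x : H)⟫_ℂ = ⟪y, T x⟫_ℂ := fun x => h _ _ (T.mem_graph x)
  have hd := LinearPMap.mem_adjoint_domain_of_exists y ⟨y', h'⟩
  have ha := LinearPMap.adjoint_apply_eq hT.dense_domain ⟨y, hd⟩ (x₀ := y') h'
  have hm : (y, y') ∈ T.adjoint.graph := by
    have := LinearPMap.mem_graph T.adjoint ⟨y, hd⟩
    rwa [ha] at this
  rwa [LinearPMap.isSelfAdjoint_def.1 hT] at hm

theorem inner_res (hT : IsSelfAdjoint T) (hz : z ∈ resolventSet T)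
    (hz' : conj z ∈ resolventSet T) (f g : H) : ⟪res T z f, g⟫_ℂ = ⟪f, res T (conj z) g⟫_ℂ := by
  have h := inner_graph_symm hT (res_mem_graph hz f) (res_mem_graph hz' g)
  rw [inner_sub_left, inner_sub_right, inner_smul_left, inner_smul_right] at h
  linear_combination h

/-- A point `z` at which `z - T` and `z̄ - T` are bounded below belongs to `ϱ(T)`. -/
theorem mem_resolventSet_of_lower_bound (hT : IsSelfAdjoint T) {δ : ℝ} (hδ : 0 < δ)
    (h : ∀ u v : H, (u, v) ∈ T.graph → δ * ‖u‖ ≤ ‖z • u - v‖)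
    (h' : ∀ u v : H, (u, v) ∈ T.graph → δ * ‖u‖ ≤ ‖conj z • u - v‖) : z ∈ resolventSet T := by
  -- `L (u, T u) = z u - T u` has closed range, whose orthogonal complement is `ker (T - z̄) = 0`
  have hcl : IsClosed (T.graph : Set (H × H)) := hT.isClosed
  have : CompleteSpace T.graph := hcl.completeSpace_coe
  let L : T.graph →L[ℂ] H :=
    (z • ContinuousLinearMap.fst ℂ H H - ContinuousLinearMap.snd ℂ H H) ∘L T.graph.subtypeL
  have hL : ∀ x : T.graph, L x = z • (x : H × H).1 - (x : H × H).2 := fun x => rfl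
  have hb : ∀ x : T.graph, δ * ‖(x : H × H).1‖ ≤ ‖L x‖ := fun x => h _ _ x.2
  have hanti : AntilipschitzWith (Real.toNNReal (δ⁻¹ + (1 + ‖z‖ * δ⁻¹))) L := by
    refine L.antilipschitz_of_bound fun x => ?_
    have h1 : ‖(x : H × H).1‖ ≤ δ⁻¹ * ‖L x‖ := by
      rw [inv_mul_eq_div, le_div_iff₀ hδ, mul_comm]; exact hb x
    have h2 : ‖(x : H × H).2‖ ≤ (1 + ‖z‖ * δ⁻¹) * ‖L x‖ := by
      have e : (x : H × H).2 = z • (x : H × H).1 - L x := by rw [hL]; abel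
      calc ‖(x : H × H).2‖ ≤ ‖z • (x : H × H).1‖ + ‖L x‖ := by rw [e]; exact norm_sub_le _ _
        _ ≤ ‖z‖ * (δ⁻¹ * ‖L x‖) + ‖L x‖ := by rw [norm_smul]; gcongr
        _ = _ := by ring
    have h0 : 0 ≤ δ⁻¹ := by positivity
    have h0' : 0 ≤ 1 + ‖z‖ * δ⁻¹ := by positivity
    rw [Real.coe_toNNReal _ (by positivity)]
    change ‖(x : H × H)‖ ≤ _
    rw [Prod.norm_def]
    refine max_le ?_ ?_ <;> nlinarith [norm_nonneg (L x)]
  have hinj : Function.Injective L := hanti.injective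
  have hclr : IsClosed (L.range : Set H) := by
    have := hanti.isClosed_range L.uniformContinuous
    exact this
  have : CompleteSpace L.range := hclr.completeSpace_coe
  have htop : L.range = ⊤ := by
    rw [← Submodule.orthogonal_eq_bot_iff, Submodule.eq_bot_iff]
    intro y hy
    have hy' : ∀ u v : H, (u, v) ∈ T.graph → ⟪conj z • y, u⟫_ℂ = ⟪y, v⟫_ℂ := by
      intro u v huv
      have := (Submodule.mem_orthogonal' _ _).1 hy _ ⟨⟨(u, v), huv⟩, rfl⟩
      change ⟪y, z • u - v⟫_ℂ = 0 at this
      rw [inner_sub_right, inner_smul_right] at this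
      rw [inner_smul_left, Complex.conj_conj]
      linear_combination this
    have hm := h' _ _ (mem_graph_of_forall_inner hT hy')
    rw [sub_self, norm_zero] at hm
    have : ‖y‖ ≤ 0 := by
      by_contra hc
      push Not at hc
      nlinarith
    simpa using this
  have hbij : Function.Bijective L := ⟨hinj, LinearMap.range_eq_top.1 htop⟩
  let E : T.graph ≃ₗ[ℂ] H := LinearEquiv.ofBijective (L : T.graph →ₗ[ℂ] H) hbij
  have hE : ∀ x, E x = L x := fun x => rfl
  refine ⟨LinearMap.mkContinuous ((LinearMap.fst ℂ H H ∘ₗ T.graph.subtype) ∘ₗ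
    (E.symm : H →ₗ[ℂ] T.graph)) δ⁻¹ (fun f => ?_), fun f => ?_, fun x => ?_⟩
  · have h1 := hb (E.symm f)
    rw [← hE, E.apply_symm_apply] at h1
    rw [inv_mul_eq_div, le_div_iff₀ hδ, mul_comm]
    exact h1
  · have h1 : L (E.symm f) = f := by rw [← hE, E.apply_symm_apply]
    rw [hL] at h1
    have h2 := (E.symm f).2
    convert h2 using 1
    refine Prod.ext rfl ?_
    change z • ((E.symm f : T.graph) : H × H).1 - f = _
    nth_rewrite 2 [← h1]
    abel
  · have h1 : E ⟨((x : H), T x), T.mem_graph x⟩ = z • (x : H) - T x := rfl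
    change ((E.symm (z • (x : H) - T x) : T.graph) : H × H).1 = _
    rw [← h1, E.symm_apply_apply]

theorem abs_im_mul_norm_le (hT : IsSelfAdjoint T) (z : ℂ) {u v : H} (h : (u, v) ∈ T.graph) :
    |z.im| * ‖u‖ ≤ ‖z • u - v‖ := by
  have h1 : (⟪u, z • u - v⟫_ℂ).im = z.im * ‖u‖ ^ 2 := by
    rw [inner_sub_right, inner_smul_right, inner_self_eq_ofReal, Complex.sub_im,
      im_inner_graph hT h, sub_zero, Complex.im_mul_ofReal]
  have h2 : |z.im| * ‖u‖ ^ 2 ≤ ‖u‖ * ‖z • u - v‖ := by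
    calc |z.im| * ‖u‖ ^ 2 = |(⟪u, z • u - v⟫_ℂ).im| := by
          rw [h1, abs_mul, abs_of_nonneg (sq_nonneg ‖u‖)]
      _ ≤ ‖⟪u, z • u - v⟫_ℂ‖ := Complex.abs_im_le_norm _
      _ ≤ _ := norm_inner_le_norm _ _
  by_cases hu : ‖u‖ = 0
  · rw [hu, mul_zero]; exact norm_nonneg _
  · have hu' : 0 < ‖u‖ := lt_of_le_of_ne (norm_nonneg _) (Ne.symm hu)
    refine le_of_mul_le_mul_left ?_ hu'
    nlinarith

theorem mem_resolventSet_of_im_ne_zero (hT : IsSelfAdjoint T) (hz : z.im ≠ 0) :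
    z ∈ resolventSet T := by
  refine mem_resolventSet_of_lower_bound hT (abs_pos.2 hz)
    (fun u v h => abs_im_mul_norm_le hT z h) (fun u v h => ?_)
  have := abs_im_mul_norm_le hT (conj z) h
  rwa [Complex.conj_im, abs_neg] at this

theorem conj_mem_resolventSet (hT : IsSelfAdjoint T) (hz : z ∈ resolventSet T) :
    conj z ∈ resolventSet T := by
  by_cases h : z.im = 0
  · rwa [Complex.conj_eq_iff_im.2 h]
  · refine mem_resolventSet_of_im_ne_zero hT ?_
    rwa [Complex.conj_im, neg_ne_zero]

theorem abs_im_mul_norm_res_le (hT : IsSelfAdjoint T) (hz : z ∈ resolventSet T) (f : H) :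
    |z.im| * ‖res T z f‖ ≤ ‖f‖ := by
  have := abs_im_mul_norm_le hT z (res_mem_graph hz f)
  rwa [sub_sub_cancel] at this

/-- A self-adjoint operator that is bounded from above has no spectrum near `+∞`. -/
theorem BddAboveOp.exists_mem_resolventSet (hT : IsSelfAdjoint T) (hb : BddAboveOp T) :
    ∃ c₀ : ℝ, ∀ c : ℝ, c₀ < c → (c : ℂ) ∈ resolventSet T := by
  obtain ⟨c₀, h0⟩ := hb
  refine ⟨c₀, fun c hc => ?_⟩
  have key : ∀ u v : H, (u, v) ∈ T.graph → (c - c₀) * ‖u‖ ≤ ‖(c : ℂ) • u - v‖ := by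
    intro u v h
    have h1 : (⟪u, v⟫_ℂ).re ≤ c₀ * ‖u‖ ^ 2 := by
      obtain ⟨x, hx, hv⟩ := (T.mem_graph_iff).1 h
      simp only at hx hv
      rw [← hx, ← hv]
      exact h0 x
    have h2 : (⟪u, (c : ℂ) • u - v⟫_ℂ).re = c * ‖u‖ ^ 2 - (⟪u, v⟫_ℂ).re := by
      rw [inner_sub_right, inner_smul_right, inner_self_eq_ofReal, Complex.sub_re,
        Complex.re_mul_ofReal, Complex.ofReal_re]
    have h3 : (⟪u, (c : ℂ) • u - v⟫_ℂ).re ≤ ‖u‖ * ‖(c : ℂ) • u - v‖ :=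
      (Complex.re_le_norm _).trans (norm_inner_le_norm _ _)
    by_cases hu : ‖u‖ = 0
    · rw [hu, mul_zero]; exact norm_nonneg _
    · have hu' : 0 < ‖u‖ := lt_of_le_of_ne (norm_nonneg _) (Ne.symm hu)
      refine le_of_mul_le_mul_left ?_ hu'
      nlinarith
  refine mem_resolventSet_of_lower_bound hT (sub_pos.2 hc) key ?_
  rw [Complex.conj_ofReal]
  exact key

theorem inner_eigenspace_eq_zero (hT : IsSelfAdjoint T) {x y : ℝ} (hxy : x ≠ y) {u v : H}
    (hu : u ∈ eigenspace T x) (hv : v ∈ eigenspace T y) : ⟪u, v⟫_ℂ = 0 := by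
  have h := inner_graph_symm hT hu hv
  rw [inner_smul_left, inner_smul_right, Complex.conj_ofReal] at h
  have h2 : ((x : ℂ) - y) * ⟪u, v⟫_ℂ = 0 := by linear_combination h
  rcases mul_eq_zero.1 h2 with h3 | h3
  · exact absurd (by exact_mod_cast sub_eq_zero.1 h3) hxy
  · exact h3

/-- A family of operators on a set `Z = Z̄` that satisfies the resolvent identity, is injective and
has the symmetry `R_z* = R_z̄` is the resolvent, on `Z`, of a self-adjoint operator. -/
theorem opOfResolvent_spec {Z : Set ℂ} {R : ℂ → H →L[ℂ] H} (hne : Z.Nonempty)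
    (hconj : ∀ z ∈ Z, conj z ∈ Z)
    (hid : ∀ z ∈ Z, ∀ w ∈ Z, ∀ f, R z f = R w f + (w - z) • R z (R w f))
    (hinj : ∀ z ∈ Z, ∀ f, R z f = 0 → f = 0)
    (hadj : ∀ z ∈ Z, ∀ f g, ⟪R z f, g⟫_ℂ = ⟪f, R (conj z) g⟫_ℂ) :
    IsSelfAdjoint (opOfResolvent Z R) ∧ ∀ z ∈ Z, IsResolventAt (opOfResolvent Z R) z (R z) := by
  have hmem : ∀ p : H × H, p ∈ (opOfResolvent Z R).graph ↔ ∀ z ∈ Z, R z (z • p.1 - p.2) = p.1 := by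
    intro p
    rw [opOfResolvent, Submodule.toLinearPMap_graph_eq]
    · rfl
    · intro q hq hq1
      obtain ⟨z, hz⟩ := hne
      have h := hq z hz
      rw [hq1, smul_zero, zero_sub] at h
      have := hinj z hz _ h
      simpa using this
  have hmem1 : ∀ p : H × H, ∀ z ∈ Z, R z (z • p.1 - p.2) = p.1 →
      p ∈ (opOfResolvent Z R).graph := by
    intro p z hz h
    rw [hmem]
    intro w hw
    have e : w • p.1 - p.2 = (z • p.1 - p.2) + (w - z) • R z (z • p.1 - p.2) := by
      rw [h]; module
    rw [e, map_add, map_smul, hid w hw z hz, h]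
    module
  have hres : ∀ z ∈ Z, IsResolventAt (opOfResolvent Z R) z (R z) := by
    intro z hz
    refine ⟨fun f => hmem1 _ z hz ?_, fun x => ?_⟩
    · simp only [sub_sub_cancel]
    · exact (hmem _).1 ((opOfResolvent Z R).mem_graph x) z hz
  refine ⟨?_, hres⟩
  set T := opOfResolvent Z R with hTdef
  -- the domain is dense because `R_z̄` is injective
  have hdense : Dense (T.domain : Set H) := by
    rw [Submodule.dense_iff_topologicalClosure_eq_top, Submodule.topologicalClosure_eq_top_iff,
      Submodule.eq_bot_iff]
    intro y hy
    obtain ⟨z, hz⟩ := hne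
    refine hinj (conj z) (hconj z hz) y (ext_inner_left ℂ fun f => ?_)
    rw [← hadj z hz, inner_zero_right]
    exact (Submodule.mem_orthogonal _ _).1 hy _
      (LinearPMap.mem_domain_of_mem_graph ((hres z hz).1 f))
  have hformal : T.IsFormalAdjoint T := by
    intro x y
    obtain ⟨z, hz⟩ := hne
    have hx := (hmem _).1 (T.mem_graph x) z hz
    have hy := (hmem _).1 (T.mem_graph y) (conj z) (hconj z hz)
    simp only at hx hy
    have h := hadj z hz (z • (x : H) - T x) (conj z • (y : H) - T y)
    rw [hx, hy, inner_sub_left, inner_sub_right, inner_smul_left, inner_smul_right] at h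
    linear_combination h
  rw [LinearPMap.isSelfAdjoint_def]
  refine le_antisymm ?_ (hformal.le_adjoint hdense)
  rw [← LinearPMap.le_graph_iff]
  -- every `(y, y')` in the graph of the adjoint satisfies `R_z̄ (z̄ y - y') = y`
  rintro ⟨y, y'⟩ hy
  obtain ⟨z, hz⟩ := hne
  refine hmem1 _ (conj z) (hconj z hz) (ext_inner_left ℂ fun f => ?_)
  obtain ⟨x, hx, hx'⟩ := (LinearPMap.mem_graph_iff _).1 hy
  obtain ⟨u, hu, hu'⟩ := (LinearPMap.mem_graph_iff _).1 ((hres z hz).1 f)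
  simp only at hx hx' hu hu' ⊢
  have hxu := LinearPMap.adjoint_isFormalAdjoint hdense x u
  rw [hx, hx', hu, hu', inner_sub_right, inner_smul_right] at hxu
  have h1 : ⟪R z f, y'⟫_ℂ = conj z * ⟪R z f, y⟫_ℂ - ⟪f, y⟫_ℂ := by
    rw [← inner_conj_symm, hxu, map_sub, map_mul, inner_conj_symm, inner_conj_symm]
  rw [← hadj z hz, inner_sub_right, inner_smul_right, h1]
  ring

end SelfAdjoint

/-! ### Resolvent formulas of Kreĭn type -/

section KreinSystem

variable {H : Type*} [NormedAddCommGroup H] [InnerProductSpace ℂ H] {T : H →ₗ.[ℂ] H} {z w : ℂ}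

/-- `1 + (w - z) R_z` and `1 + (z - w) R_w` are inverse to each other. -/
theorem one_add_res_one_add_res (hz : z ∈ resolventSet T) (hw : w ∈ resolventSet T) (h : H) :
    (h + (z - w) • res T w h) + (w - z) • res T z (h + (z - w) • res T w h) = h := by
  rw [map_add, map_smul, res_identity hz hw h]
  module

/-- The operators entering a Krein-type resolvent formula over `A`: the spaces `b`, `D`, `E` play
the roles of the space of traces, its dual, and the target of the boundary conditions; `pr` is the
pairing of `D` with `b`. The fields are the facts about `G_z`, its adjoint and its trace from which
the resolvent identity, symmetry and injectivity of the perturbed resolvent follow. -/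
structure KreinSystem (A : H →ₗ.[ℂ] H) (b D E : Type*)
    [NormedAddCommGroup b] [NormedSpace ℂ b] [NormedAddCommGroup D] [NormedSpace ℂ D]
    [NormedAddCommGroup E] [NormedSpace ℂ E] where
  /-- `G_z`, the adjoint of the trace of the resolvent at `z̄` -/
  G : ℂ → D →L[ℂ] H
  /-- the trace of the resolvent at `z` -/
  Gs : ℂ → H →L[ℂ] b
  /-- the trace of `G_z` -/
  Q : ℂ → D →L[ℂ] b
  B₀ : D →L[ℂ] E
  B : b →L[ℂ] E
  pr : D → b →ₗ⋆[ℂ] ℂ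
  Gs_sub : ∀ z ∈ resolventSet A, ∀ w ∈ resolventSet A, ∀ f,
    Gs z f = Gs w f + (w - z) • Gs z (res A w f)
  G_sub : ∀ z ∈ resolventSet A, ∀ w ∈ resolventSet A, ∀ ψ,
    G z ψ = G w ψ + (w - z) • res A z (G w ψ)
  Q_sub : ∀ z ∈ resolventSet A, ∀ w ∈ resolventSet A, ∀ ψ,
    Q z ψ = Q w ψ + (w - z) • Gs z (G w ψ)
  inner_G : ∀ z ∈ resolventSet A, ∀ u ψ, ⟪u, G z ψ⟫_ℂ = pr ψ (Gs (conj z) u)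
  /-- `Λ_z* = Λ_z̄` for `Λ_z = M_z⁻¹ B` -/
  symm : ∀ z ∈ resolventSet A, (B₀ - B ∘L Q z).IsInvertible →
    (B₀ - B ∘L Q (conj z)).IsInvertible → ∀ x y,
    pr ((B₀ - B ∘L Q z).inverse (B x)) y = conj (pr ((B₀ - B ∘L Q (conj z)).inverse (B y)) x)
  /-- the boundary condition determines a resolvent without kernel -/
  inj : ∀ z ∈ resolventSet A, ∀ f ψ, res A z f + G z ψ = 0 → B₀ ψ = B (Gs z f + Q z ψ) → f = 0

namespace KreinSystem

variable {A : H →ₗ.[ℂ] H} {b D E : Type*}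
    [NormedAddCommGroup b] [NormedSpace ℂ b] [NormedAddCommGroup D] [NormedSpace ℂ D]
    [NormedAddCommGroup E] [NormedSpace ℂ E] (K : KreinSystem A b D E)

/-- `M_z = B₀ - B τ G_z`. -/
def M (z : ℂ) : D →L[ℂ] E := K.B₀ - K.B ∘L K.Q z

/-- The points of `ϱ(A)` at which `M_z` and `M_z̄` are invertible. -/
def Z : Set ℂ := {z | z ∈ resolventSet A ∧ (K.M z).IsInvertible ∧ (K.M (conj z)).IsInvertible}

/-- `Λ_z = M_z⁻¹ B`. -/
def Λ (z : ℂ) : b →L[ℂ] D := (K.M z).inverse ∘L K.B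

/-- The perturbed resolvent `R_z + G_z Λ_z (G_z̄)*`. -/
def R (z : ℂ) : H →L[ℂ] H := res A z + K.G z ∘L K.Λ z ∘L K.Gs z

/-- The perturbed operator. -/
def op : H →ₗ.[ℂ] H := opOfResolvent K.Z K.R

variable {K}

theorem R_apply (z : ℂ) (f : H) : K.R z f = res A z f + K.G z (K.Λ z (K.Gs z f)) := rfl

theorem M_apply (z : ℂ) (ψ : D) : K.M z ψ = K.B₀ ψ - K.B (K.Q z ψ) := rfl

theorem M_Λ (hz : (K.M z).IsInvertible) (x : b) : K.M z (K.Λ z x) = K.B x :=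
  hz.self_apply_inverse _

theorem M_sub (hz : z ∈ resolventSet A) (hw : w ∈ resolventSet A) (ψ : D) :
    K.M z ψ = K.M w ψ - (w - z) • K.B (K.Gs z (K.G w ψ)) := by
  rw [M_apply, M_apply, K.Q_sub z hz w hw, map_add, map_smul]
  abel

theorem Λ_sub (hz : z ∈ K.Z) (hw : w ∈ K.Z) (x : b) :
    K.Λ z x = K.Λ w x + (w - z) • K.Λ z (K.Gs z (K.G w (K.Λ w x))) := by
  apply hz.2.1.injective
  rw [map_add, map_smul, M_Λ hz.2.1, M_Λ hz.2.1, M_sub hz.1 hw.1, M_Λ hw.2.1]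
  module

theorem R_identity (hz : z ∈ K.Z) (hw : w ∈ K.Z) (f : H) :
    K.R z f = K.R w f + (w - z) • K.R z (K.R w f) := by
  simp only [R_apply, map_add, smul_add]
  have h1 := res_identity hz.1 hw.1 f
  have h2 := K.G_sub z hz.1 w hw.1 (K.Λ w (K.Gs w f))
  have h3 := congrArg (fun x => K.G z (K.Λ z x)) (K.Gs_sub z hz.1 w hw.1 f)
  have h4 := congrArg (K.G z) (Λ_sub hz hw (K.Gs w f))
  simp only [map_add, map_smul] at h3 h4
  rw [h3, h4, h1, h2]
  abel

theorem conj_mem_Z (hA : ∀ z ∈ resolventSet A, conj z ∈ resolventSet A) (hz : z ∈ K.Z) :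
    conj z ∈ K.Z :=
  ⟨hA z hz.1, hz.2.2, by rw [Complex.conj_conj]; exact hz.2.1⟩

theorem R_injective (hz : z ∈ K.Z) {f : H} (hf : K.R z f = 0) : f = 0 := by
  refine K.inj z hz.1 f (K.Λ z (K.Gs z f)) hf ?_
  have := M_Λ hz.2.1 (K.Gs z f)
  rw [M_apply] at this
  rw [map_add, ← this]
  abel

variable [CompleteSpace H]

theorem inner_R (hA : IsSelfAdjoint A) (hz : z ∈ K.Z) (f g : H) :
    ⟪K.R z f, g⟫_ℂ = ⟪f, K.R (conj z) g⟫_ℂ := by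
  have hz' := conj_mem_resolventSet hA hz.1
  rw [R_apply, R_apply, inner_add_left, inner_add_right, inner_res hA hz.1 hz',
    ← inner_conj_symm (K.G z _) g, K.inner_G z hz.1, K.inner_G _ hz', Complex.conj_conj]
  congr 1
  have := K.symm z hz.1 hz.2.1 hz.2.2 (K.Gs z f) (K.Gs (conj z) g)
  change K.pr (K.Λ z _) _ = conj (K.pr (K.Λ (conj z) _) _) at this
  rw [this, Complex.conj_conj]

/-- The Krein formula defines the resolvent of a self-adjoint operator. -/
theorem op_spec (hA : IsSelfAdjoint A) (hne : K.Z.Nonempty) :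
    IsSelfAdjoint K.op ∧ ∀ z ∈ K.Z, IsResolventAt K.op z (K.R z) :=
  opOfResolvent_spec hne (fun _ hz => conj_mem_Z (fun _ h => conj_mem_resolventSet hA h) hz)
    (fun _ hz _ hw f => R_identity hz hw f) (fun _ hz _ hf => R_injective hz hf)
    (fun _ hz f g => inner_R hA hz f g)

/-- If `M_w` is invertible then so is `M_z` for every other common point `z` of the resolvent sets of
`A` and of the perturbed operator: `M_w⁻¹ M_z = 1 - d a` with `a = G_z` and
`d = (w - z) Λ_w (G_w̄)*`, and `1 - a d = (1 + (w - z) R_z) (1 + (z - w) R^B_w)` is invertible. -/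
theorem isInvertible_M (hA : IsSelfAdjoint A) (hw : w ∈ K.Z) (hz : z ∈ resolventSet A)
    (hz' : z ∈ resolventSet K.op) : (K.M z).IsInvertible := by
  have hres := (op_spec hA ⟨w, hw⟩).2 w hw
  have hRw := hres.res_eq
  have hw' := hres.mem
  let d : H →L[ℂ] D := (w - z) • K.Λ w ∘L K.Gs w
  let a : D →L[ℂ] H := K.G z
  let V : H →L[ℂ] H := (ContinuousLinearMap.id ℂ H + (w - z) • res K.op z) ∘L
    (ContinuousLinearMap.id ℂ H + (z - w) • res A w)
  have hV : ∀ h, V h = (h + (z - w) • res A w h) +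
    (w - z) • res K.op z (h + (z - w) • res A w h) := fun h => rfl
  have had : ∀ h, h - a (d h) = (h + (z - w) • res K.op w h) +
      (w - z) • res A z (h + (z - w) • res K.op w h) := by
    intro h
    have e1 : a (d h) = (w - z) • K.G z (K.Λ w (K.Gs w h)) := by
      change K.G z ((w - z) • K.Λ w (K.Gs w h)) = _
      rw [map_smul]
    have e2 : K.G w (K.Λ w (K.Gs w h)) = res K.op w h - res A w h := by
      rw [hRw, R_apply]; abel
    have e3 := one_add_res_one_add_res hz hw.1 h
    rw [e1, K.G_sub z hz w hw.1, e2]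
    simp only [map_sub, map_add, map_smul] at e3 ⊢
    linear_combination (norm := module) -e3
  -- `V` is a two-sided inverse of `1 - a d`, hence `1 + d V a` is one of `1 - d a`
  have h1 : ∀ h, V (h - a (d h)) = h := by
    intro h
    rw [hV, had]
    have := one_add_res_one_add_res hw.1 hz (h + (z - w) • res K.op w h)
    rw [this]
    exact one_add_res_one_add_res hz' hw' h
  have h2 : ∀ h, V h - a (d (V h)) = h := by
    intro h
    rw [had, hV]
    have := one_add_res_one_add_res hw' hz' (h + (z - w) • res A w h)
    rw [this]
    exact one_add_res_one_add_res hz hw.1 h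
  have hinv : (ContinuousLinearMap.id ℂ D - d ∘L a).IsInvertible := by
    refine ContinuousLinearMap.IsInvertible.of_inverse
      (g := ContinuousLinearMap.id ℂ D + d ∘L V ∘L a) ?_ ?_
    · ext ψ
      change (ψ + d (V (a ψ))) - d (a (ψ + d (V (a ψ)))) = ψ
      have := congrArg d (h2 (a ψ))
      rw [map_sub] at this
      rw [map_add, map_add]
      linear_combination (norm := module) this
    · ext ψ
      change (ψ - d (a ψ)) + d (V (a (ψ - d (a ψ)))) = ψ
      rw [map_sub, h1]
      abel
  have hM : K.M z = K.M w ∘L (ContinuousLinearMap.id ℂ D - d ∘L a) := by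
    ext ψ
    change K.M z ψ = K.M w (ψ - (w - z) • K.Λ w (K.Gs w (K.G z ψ)))
    have := M_sub (K := K) hw.1 hz ψ
    rw [map_sub, map_smul, M_Λ hw.2.1, this]
    module
  rw [hM]
  exact hw.2.1.comp hinv

theorem mem_Z (hA : IsSelfAdjoint A) (hne : K.Z.Nonempty) (hz : z ∈ resolventSet A)
    (hz' : z ∈ resolventSet K.op) : z ∈ K.Z := by
  obtain ⟨w, hw⟩ := hne
  exact ⟨hz, isInvertible_M hA hw hz hz', isInvertible_M hA hw (conj_mem_resolventSet hA hz)
    (conj_mem_resolventSet (op_spec hA ⟨w, hw⟩).1 hz')⟩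

end KreinSystem

/-- `G_z - G_w = (w - z) R_z G_w`, by duality from the resolvent identity. -/
theorem adjoint_trace_sub [CompleteSpace H] {A : H →ₗ.[ℂ] H} (hA : IsSelfAdjoint A) {b D : Type*}
    [NormedAddCommGroup b] [NormedSpace ℂ b] {G : ℂ → D → H} {Gs : ℂ → H → b}
    {pr : D → b →ₗ⋆[ℂ] ℂ}
    (hGs : ∀ z ∈ resolventSet A, ∀ w ∈ resolventSet A, ∀ f,
      Gs z f = Gs w f + (w - z) • Gs z (res A w f))
    (hG : ∀ z ∈ resolventSet A, ∀ u ψ, ⟪u, G z ψ⟫_ℂ = pr ψ (Gs (conj z) u))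
    (hz : z ∈ resolventSet A) (hw : w ∈ resolventSet A) (ψ : D) :
    G z ψ = G w ψ + (w - z) • res A z (G w ψ) := by
  have hz' := conj_mem_resolventSet hA hz
  have hw' := conj_mem_resolventSet hA hw
  refine ext_inner_left ℂ fun u => ?_
  have h1 := inner_res hA hz' (by rwa [Complex.conj_conj]) u (G w ψ)
  rw [Complex.conj_conj] at h1
  rw [inner_add_right, inner_smul_right, hG z hz, hG w hw, ← h1, hG w hw, hGs _ hw' _ hz' u,
    map_add, map_smulₛₗ, map_sub, Complex.conj_conj, Complex.conj_conj]
  simp only [smul_eq_mul]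
  ring

/-- The symmetry `Λ_z* = Λ_z̄` of `Λ_z = M_z⁻¹ B`, `M_z = B₀ - B Q_z`, from `Q_z* = Q_z̄` and
`B₀ B* = B B₀*`. Given `x`, reflexivity provides `a` with `x = (M_z̄)* a`, and then
`Λ_z x = B* a`. -/
theorem krein_symm {b D E F : Type*}
    [NormedAddCommGroup b] [NormedSpace ℂ b] [NormedAddCommGroup D] [NormedSpace ℂ D]
    [NormedAddCommGroup E] [NormedSpace ℂ E]
    {pr : D →ₗ[ℂ] b →ₗ⋆[ℂ] ℂ} {prE : E →ₗ[ℂ] F → ℂ}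
    {Q Q' : D →L[ℂ] b} {B₀ : D →L[ℂ] E} {B : b →L[ℂ] E}
    (hcont : ∀ x, Continuous fun ψ => pr ψ x)
    (hsep : ∀ x y, (∀ χ, pr χ x = pr χ y) → x = y)
    (hrefl : ∀ f : E →L[ℂ] ℂ, ∃ a, ∀ θ, f θ = prE θ a)
    (hB : ∀ a, ∃ ψ, ∀ w, pr ψ w = conj (prE (B w) a))
    (hB₀ : ∀ a, ∃ v, ∀ χ, pr χ v = prE (B₀ χ) a)
    (hcomm : ∀ a ψ v, (∀ w, pr ψ w = conj (prE (B w) a)) → (∀ χ, pr χ v = prE (B₀ χ) a) →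
      B₀ ψ = B v)
    (hQ : ∀ ψ χ, pr χ (Q ψ) = conj (pr ψ (Q' χ)))
    (hM : (B₀ - B ∘L Q).IsInvertible) (hM' : (B₀ - B ∘L Q').IsInvertible) (x y : b) :
    pr ((B₀ - B ∘L Q).inverse (B x)) y = conj (pr ((B₀ - B ∘L Q').inverse (B y)) x) := by
  let f : E →L[ℂ] ℂ :=
    { toFun := fun θ => pr ((B₀ - B ∘L Q').inverse θ) x
      map_add' := fun θ θ' => by rw [map_add, map_add]; rfl
      map_smul' := fun c θ => by rw [map_smul, map_smul]; rfl
      cont := (hcont x).comp (B₀ - B ∘L Q').inverse.continuous }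
  obtain ⟨a, ha⟩ := hrefl f
  have ha' : ∀ χ, pr χ x = prE ((B₀ - B ∘L Q') χ) a := fun χ => by
    rw [← ha]
    change _ = pr ((B₀ - B ∘L Q').inverse ((B₀ - B ∘L Q') χ)) x
    rw [hM'.inverse_apply_self]
  obtain ⟨ψ, hψ⟩ := hB a
  obtain ⟨v, hv⟩ := hB₀ a
  have hx : x = v - Q ψ := by
    refine hsep _ _ fun χ => ?_
    rw [ha', sub_apply, map_sub, Pi.sub_apply, ← hv, map_sub, hQ, hψ,
      Complex.conj_conj]
    rfl
  have hψx : (B₀ - B ∘L Q).inverse (B x) = ψ := by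
    have : B x = (B₀ - B ∘L Q) ψ := by
      rw [hx, map_sub, ← hcomm a ψ v hψ hv]; rfl
    rw [this, hM.inverse_apply_self]
  rw [hψx, hψ, ha', hM'.self_apply_inverse]

end KreinSystem

/-! ### The Kreĭn formulas of the two perturbed operators -/

section DualPairing

variable {X Y : Type*} [NormedAddCommGroup X] [NormedSpace ℂ X]
  [NormedAddCommGroup Y] [NormedSpace ℂ Y]

/-- The conjugate-linear functional `x ↦ conj (f x)`. -/
def conjFunctional (f : X →L[ℂ] ℂ) : Dual' X := (starL ℂ (A := ℂ)).toContinuousLinearMap.comp f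

theorem conjFunctional_apply (f : X →L[ℂ] ℂ) (x : X) : conjFunctional f x = conj (f x) := rfl

/-- Evaluation at `x`, as a functional on `X*`. -/
def evalDual (x : X) : Dual' X →L[ℂ] ℂ :=
  LinearMap.mkContinuous
    { toFun := fun ψ => ψ x
      map_add' := fun _ _ => rfl
      map_smul' := fun _ _ => rfl } ‖x‖ (fun ψ => by
        rw [mul_comm]; exact ψ.le_opNorm x)

theorem eq_of_forall_dual' {x y : X} (h : ∀ χ : Dual' X, χ x = χ y) : x = y := by
  refine (SeparatingDual.eq_iff_forall_dual_eq (R := ℂ)).2 fun g => ?_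
  have := h (conjFunctional g)
  rw [conjFunctional_apply, conjFunctional_apply] at this
  exact (starRingEnd ℂ).injective this

/-- In a reflexive space every linear functional on `X*` is an evaluation. -/
theorem Reflexive'.exists_eval (hX : Reflexive' X) (f : Dual' X →L[ℂ] ℂ) :
    ∃ x : X, ∀ ψ : Dual' X, f ψ = ψ x := by
  obtain ⟨x, hx⟩ := hX (conjFunctional f)
  refine ⟨x, fun ψ => ?_⟩
  have := hx ψ
  rw [conjFunctional_apply] at this
  exact (starRingEnd ℂ).injective this

/-- The pairing of `X*` with `X`. -/
def dualPairing (X : Type*) [NormedAddCommGroup X] [NormedSpace ℂ X] :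
    Dual' X →ₗ[ℂ] X →ₗ⋆[ℂ] ℂ where
  toFun ψ := ψ
  map_add' _ _ := rfl
  map_smul' _ _ := rfl

/-- The pairing of `X* ⊕ Y*` with `X ⊕ Y`. -/
def dualPairingProd (X Y : Type*) [NormedAddCommGroup X] [NormedSpace ℂ X]
    [NormedAddCommGroup Y] [NormedSpace ℂ Y] : (Dual' X × Dual' Y) →ₗ[ℂ] X × Y →ₗ⋆[ℂ] ℂ where
  toFun ψ := (ψ.1 : X →ₗ⋆[ℂ] ℂ) ∘ₛₗ LinearMap.fst ℂ X Y + (ψ.2 : Y →ₗ⋆[ℂ] ℂ) ∘ₛₗ LinearMap.snd ℂ X Y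
  map_add' ψ χ := by
    ext x
    exact add_add_add_comm (ψ.1 x.1) (χ.1 x.1) (ψ.2 x.2) (χ.2 x.2)
  map_smul' c ψ := by
    ext x
    exact (mul_add c (ψ.1 x.1) (ψ.2 x.2)).symm

theorem dualPairingProd_apply (ψ : Dual' X × Dual' Y) (x : X × Y) :
    dualPairingProd X Y ψ x = ψ.1 x.1 + ψ.2 x.2 := rfl

/-- The pairings as functions of the second variable, which enter linearly in the first. -/
def dualEval (X : Type*) [NormedAddCommGroup X] [NormedSpace ℂ X] : Dual' X →ₗ[ℂ] X → ℂ where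
  toFun ψ := ψ
  map_add' _ _ := rfl
  map_smul' _ _ := rfl

/-- The analogue of `dualEval` for a direct sum. -/
def dualEvalProd (X Y : Type*) [NormedAddCommGroup X] [NormedSpace ℂ X]
    [NormedAddCommGroup Y] [NormedSpace ℂ Y] : (Dual' X × Dual' Y) →ₗ[ℂ] X × Y → ℂ where
  toFun ψ := dualPairingProd X Y ψ
  map_add' ψ χ := by rw [map_add]; rfl
  map_smul' c ψ := by rw [map_smul]; rfl

variable {H : Type*} [NormedAddCommGroup H] [InnerProductSpace ℂ H]

theorem resGraph_sub {A : H →ₗ.[ℂ] H} {z w : ℂ} (hz : z ∈ resolventSet A)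
    (hw : w ∈ resolventSet A) (f : H) :
    resGraph A z f = resGraph A w f + (w - z) • resGraph A z (res A w f) := by
  apply Subtype.ext
  rw [Submodule.coe_add, Submodule.coe_smul, resGraph_apply hz, resGraph_apply hw,
    resGraph_apply hz, res_identity hz hw f]
  refine Prod.ext rfl ?_
  simp only [Prod.snd_add, Prod.smul_snd]
  module

theorem resGraph_of_mem {A : H →ₗ.[ℂ] H} {z : ℂ} (hz : z ∈ resolventSet A) (x : A.graph) :
    resGraph A z (z • (x : H × H).1 - (x : H × H).2) = x := by
  apply Subtype.ext
  rw [resGraph_apply hz, res_apply_of_mem hz x.2, sub_sub_cancel]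

theorem inner_dualToHilbert [CompleteSpace H] (L : H →L[ℂ] X) (u : H) (ψ : Dual' X) :
    ⟪u, dualToHilbert L ψ⟫_ℂ = ψ (L u) := inner_riesz _ _

end DualPairing

namespace PerturbationData

variable {H h₁ h₂ b₁ b₂ b₂₂ : Type*}
    [NormedAddCommGroup H] [InnerProductSpace ℂ H] [CompleteSpace H]
    [NormedAddCommGroup h₁] [InnerProductSpace ℂ h₁] [CompleteSpace h₁]
    [NormedAddCommGroup h₂] [InnerProductSpace ℂ h₂] [CompleteSpace h₂]
    [NormedAddCommGroup b₁] [NormedSpace ℂ b₁] [CompleteSpace b₁]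
    [NormedAddCommGroup b₂] [NormedSpace ℂ b₂] [CompleteSpace b₂]
    [NormedAddCommGroup b₂₂] [NormedSpace ℂ b₂₂] [CompleteSpace b₂₂]
    (P : PerturbationData H h₁ h₂ b₁ b₂ b₂₂) {z w : ℂ}

theorem Gstar_apply (z : ℂ) (f : H) :
    P.Gstar z f = (P.ι₁ (P.τ₁ (resGraph P.A z f)), P.ι₂ (P.τ₂ (resGraph P.A z f))) := rfl

theorem G_apply (z : ℂ) (ψ : Dual' b₁ × Dual' b₂) :
    P.G z ψ = P.G₁ z (dualMap P.ι₁ ψ.1) + P.G₂ z (dualMap P.ι₂ ψ.2) := rfl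

theorem inner_G₁ (z : ℂ) (u : H) (ψ : Dual' b₁) :
    ⟪u, P.G₁ z (dualMap P.ι₁ ψ)⟫_ℂ = ψ (P.Gstar (conj z) u).1 :=
  inner_dualToHilbert _ _ _

theorem inner_G₂ (z : ℂ) (u : H) (ψ : Dual' b₂) :
    ⟪u, P.G₂ z (dualMap P.ι₂ ψ)⟫_ℂ = ψ (P.Gstar (conj z) u).2 :=
  inner_dualToHilbert _ _ _

theorem inner_G (z : ℂ) (u : H) (ψ : Dual' b₁ × Dual' b₂) :
    ⟪u, P.G z ψ⟫_ℂ = dualPairingProd b₁ b₂ ψ (P.Gstar (conj z) u) := by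
  rw [G_apply, inner_add_right, inner_G₁, inner_G₂]; rfl

theorem Gstar_sub (hz : z ∈ resolventSet P.A) (hw : w ∈ resolventSet P.A) (f : H) :
    P.Gstar z f = P.Gstar w f + (w - z) • P.Gstar z (res P.A w f) := by
  rw [Gstar_apply, resGraph_sub hz hw f]
  simp only [map_add, map_smul]
  rfl

theorem G_sub (hz : z ∈ resolventSet P.A) (hw : w ∈ resolventSet P.A)
    (ψ : Dual' b₁ × Dual' b₂) : P.G z ψ = P.G w ψ + (w - z) • res P.A z (P.G w ψ) :=
  adjoint_trace_sub P.selfAdjoint (G := fun z => P.G z) (Gs := fun z => P.Gstar z)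
    (fun _ hz _ hw f => P.Gstar_sub hz hw f) (fun z _ u ψ => P.inner_G z u ψ) hz hw ψ

theorem τG_mem (hz : z ∈ resolventSet P.A) (ψ : Dual' b₁ × Dual' b₂) :
    (P.G z ψ, P.τG z ψ) ∈ P.τext.graph := by
  have h : ∃ T : (Dual' b₁ × Dual' b₂) →L[ℂ] (b₁ × b₂), ∀ ψ, (P.G z ψ, T ψ) ∈ P.τext.graph :=
    P.τext_bounded z hz
  rw [τG, dif_pos h]
  exact h.choose_spec ψ

theorem res_mem_τext (hz : z ∈ resolventSet P.A) (f : H) :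
    (res P.A z f, P.Gstar z f) ∈ P.τext.graph := by
  have := P.τext_extends (resGraph P.A z f)
  rwa [resGraph_apply hz f] at this

theorem τG_sub (hz : z ∈ resolventSet P.A) (hw : w ∈ resolventSet P.A)
    (ψ : Dual' b₁ × Dual' b₂) : P.τG z ψ = P.τG w ψ + (w - z) • P.Gstar z (P.G w ψ) := by
  have h := P.τext.graph.add_mem (P.τG_mem hw ψ)
    (P.τext.graph.smul_mem (w - z) (P.res_mem_τext hz (P.G w ψ)))
  rw [Prod.smul_mk, Prod.mk_add_mk, ← P.G_sub hz hw] at h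
  exact P.τext.mem_graph_snd_inj (P.τG_mem hz ψ) h rfl

theorem τG_symm (hz : z ∈ resolventSet P.A) (ψ χ : Dual' b₁ × Dual' b₂) :
    χ.1 (P.τG z ψ).1 + χ.2 (P.τG z ψ).2 =
      conj (ψ.1 (P.τG (conj z) χ).1 + ψ.2 (P.τG (conj z) χ).2) := by
  refine P.τext_symm z hz ψ χ _ _ (P.τG_mem hz ψ) ?_
  have := P.τG_mem (conj_mem_resolventSet P.selfAdjoint hz) χ
  rw [G_apply, G₁, G₂, Complex.conj_conj] at this
  exact this

/-- The element `w ↦ conj (B w a)` of `X*`, that is `B* a`. -/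
theorem exists_adjoint {X Y : Type*} [NormedAddCommGroup X] [NormedSpace ℂ X]
    [NormedAddCommGroup Y] [NormedSpace ℂ Y] (B : X →L[ℂ] Dual' Y) (a : Y) :
    ∃ ψ : Dual' X, ∀ w, ψ w = conj (B w a) :=
  ⟨conjFunctional (evalDual a ∘L B), fun _ => rfl⟩

theorem krein_symm_full (hz : z ∈ resolventSet P.A) (hM : (P.M z).IsInvertible)
    (hM' : (P.M (conj z)).IsInvertible) (x y : b₁ × b₂) :
    dualPairingProd b₁ b₂ ((P.M z).inverse (P.B₁.prodMap P.B₂ x)) y =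
      conj (dualPairingProd b₁ b₂ ((P.M (conj z)).inverse (P.B₁.prodMap P.B₂ y)) x) := by
  refine krein_symm (prE := dualEvalProd b₁ b₂₂) (fun x => ?_) (fun x y h => ?_) (fun f => ?_)
    (fun a => ?_) (fun a => ?_) (fun a ψ v h h' => ?_) (fun ψ χ => P.τG_symm hz ψ χ) hM hM' x y
  · exact (((evalDual x.1).continuous.comp continuous_fst).add
      ((evalDual x.2).continuous.comp continuous_snd))
  · refine Prod.ext (eq_of_forall_dual' fun χ => ?_) (eq_of_forall_dual' fun χ => ?_)
    · simpa [dualPairingProd_apply] using h (χ, 0)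
    · simpa [dualPairingProd_apply] using h (0, χ)
  · obtain ⟨a, ha⟩ := P.reflexive_b₁.exists_eval (f ∘L ContinuousLinearMap.inl ℂ _ _)
    obtain ⟨a', ha'⟩ := P.reflexive_b₂₂.exists_eval (f ∘L ContinuousLinearMap.inr ℂ _ _)
    refine ⟨(a, a'), fun θ => ?_⟩
    change _ = θ.1 a + θ.2 a'
    rw [← ha, ← ha']
    change _ = f (θ.1, 0) + f (0, θ.2)
    rw [← map_add, Prod.mk_add_mk, add_zero, zero_add]
  · obtain ⟨ψ, hψ⟩ := exists_adjoint P.B₁ a.1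
    obtain ⟨ψ', hψ'⟩ := exists_adjoint P.B₂ a.2
    refine ⟨(ψ, ψ'), fun w => ?_⟩
    change ψ w.1 + ψ' w.2 = conj (P.B₁ w.1 a.1 + P.B₂ w.2 a.2)
    rw [hψ, hψ', map_add]
  · obtain ⟨v, hv⟩ := P.reflexive_b₂.exists_eval (evalDual a.2 ∘L P.B₀)
    refine ⟨(a.1, v), fun χ => ?_⟩
    change χ.1 a.1 + χ.2 v = χ.1 a.1 + P.B₀ χ.2 a.2
    rw [← hv]; rfl
  · refine Prod.ext ?_ ?_
    · have h1 : v.1 = a.1 := eq_of_forall_dual' fun χ => by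
        have : χ v.1 + (0 : Dual' b₂) v.2 = χ a.1 + P.B₀ 0 a.2 := h' (χ, 0)
        simpa using this
      change ψ.1 = P.B₁ v.1
      ext w
      have : ψ.1 w + ψ.2 0 = conj (P.B₁ w a.1 + P.B₂ 0 a.2) := h (w, 0)
      rw [h1, P.B₁_symm]
      simpa using this
    · refine P.B₀B₂_symm a.2 ψ.2 v.2 (fun w => ?_) (fun χ => ?_)
      · have : ψ.1 0 + ψ.2 w = conj (P.B₁ 0 a.1 + P.B₂ w a.2) := h (0, w)
        simpa using this
      · have : (0 : Dual' b₁) v.1 + χ v.2 = (0 : Dual' b₁) a.1 + P.B₀ χ a.2 := h' (0, χ)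
        simpa using this

/-- The Krein system of `A_B`. -/
def krein : KreinSystem P.A (b₁ × b₂) (Dual' b₁ × Dual' b₂) (Dual' b₁ × Dual' b₂₂) where
  G := P.G
  Gs := P.Gstar
  Q := P.τG
  B₀ := (ContinuousLinearMap.id ℂ (Dual' b₁)).prodMap P.B₀
  B := P.B₁.prodMap P.B₂
  pr := dualPairingProd b₁ b₂
  Gs_sub _ hz _ hw f := P.Gstar_sub hz hw f
  G_sub _ hz _ hw ψ := P.G_sub hz hw ψ
  Q_sub _ hz _ hw ψ := P.τG_sub hz hw ψ
  inner_G z _ u ψ := P.inner_G z u ψ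
  symm _ hz hM hM' x y := P.krein_symm_full hz hM hM' x y
  inj z hz f ψ h0 hb := by
    -- `τ (R_z f + G_z ψ) = 0`, so the boundary condition forces `ψ₁ = 0`; the remaining relation
    -- `R_z f = - G²_z ψ₂` gives `f ⟂ ker τ₂`.
    have h1 := P.τext.graph.add_mem (P.res_mem_τext hz f) (P.τG_mem hz ψ)
    rw [Prod.mk_add_mk, h0] at h1
    have h2 := P.τext.graph_fst_eq_zero_snd h1 rfl
    rw [h2, map_zero] at hb
    have h3 : ψ.1 = 0 := congrArg Prod.fst hb
    rw [G_apply, h3, map_zero, map_zero, zero_add] at h0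
    have hz' := conj_mem_resolventSet P.selfAdjoint hz
    have key : ∀ u ∈ {u : H | ∃ x : P.A.graph, (x : H × H).1 = u ∧ P.τ₂ x = 0}, ⟪u, f⟫_ℂ = 0 := by
      rintro u ⟨x, rfl, hx⟩
      have h4 := congrArg (fun v => ⟪conj z • (x : H × H).1 - (x : H × H).2, v⟫_ℂ) h0
      simp only [inner_add_right, inner_zero_right] at h4
      have h5 := inner_res P.selfAdjoint hz' (by rwa [Complex.conj_conj])
        (conj z • (x : H × H).1 - (x : H × H).2) f
      rw [inner_G₂, Gstar_apply, resGraph_of_mem hz', hx, map_zero, map_zero, add_zero] at h4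
      rw [Complex.conj_conj, h4, res_apply_of_mem hz' x.2] at h5
      exact h5
    have hcl : IsClosed {u : H | ⟪u, f⟫_ℂ = 0} :=
      isClosed_eq (continuous_id.inner continuous_const) continuous_const
    have h6 : f ∈ {u : H | ⟪u, f⟫_ℂ = 0} :=
      hcl.closure_subset_iff.2 key (P.dense_ker_τ₂ f)
    exact inner_self_eq_zero.1 h6

theorem inner_G₁' (z : ℂ) (u : H) (ψ : Dual' b₁) :
    ⟪u, (P.G₁ z ∘L dualMap P.ι₁) ψ⟫_ℂ =
      dualPairing b₁ ψ ((P.ι₁ ∘L P.τ₁ ∘L resGraph P.A (conj z)) u) :=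
  P.inner_G₁ z u ψ

theorem G_inl (z : ℂ) (ψ : Dual' b₁) : P.G z (ψ, 0) = P.G₁ z (dualMap P.ι₁ ψ) := by
  rw [G_apply, map_zero, map_zero, add_zero]

theorem krein_symm_one (hz : z ∈ resolventSet P.A) (hM : (P.M₁ z).IsInvertible)
    (hM' : (P.M₁ (conj z)).IsInvertible) (x y : b₁) :
    dualPairing b₁ ((P.M₁ z).inverse (P.B₁ x)) y =
      conj (dualPairing b₁ ((P.M₁ (conj z)).inverse (P.B₁ y)) x) := by
  refine krein_symm (prE := dualEval b₁) (fun x => (evalDual x).continuous)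
    (fun x y h => eq_of_forall_dual' h) (fun f => P.reflexive_b₁.exists_eval f)
    (fun a => exists_adjoint P.B₁ a) (fun a => ⟨a, fun _ => rfl⟩) (fun a ψ v h h' => ?_)
    (fun ψ χ => ?_) hM hM' x y
  · have h1 : v = a := eq_of_forall_dual' h'
    change ψ = P.B₁ v
    ext w
    rw [h1, P.B₁_symm]
    exact h w
  · have := P.τG_symm hz (ψ, 0) (χ, 0)
    simp only [zero_apply, add_zero] at this
    exact this

/-- The Krein system of `A_{B₁}`. -/
def krein₁ : KreinSystem P.A b₁ (Dual' b₁) (Dual' b₁) where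
  G z := P.G₁ z ∘L dualMap P.ι₁
  Gs z := P.ι₁ ∘L P.τ₁ ∘L resGraph P.A z
  Q := P.τ₁G₁
  B₀ := ContinuousLinearMap.id ℂ (Dual' b₁)
  B := P.B₁
  pr := dualPairing b₁
  Gs_sub _ hz _ hw f := congrArg Prod.fst (P.Gstar_sub hz hw f)
  G_sub _ hz _ hw ψ := by
    have := P.G_sub hz hw (ψ, 0)
    rwa [G_inl, G_inl] at this
  Q_sub _ hz w hw ψ := by
    have := congrArg Prod.fst (P.τG_sub hz hw (ψ, 0))
    rwa [G_inl] at this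
  inner_G z _ u ψ := P.inner_G₁' z u ψ
  symm _ hz hM hM' x y := P.krein_symm_one hz hM hM' x y
  inj z hz f ψ h0 hb := by
    -- `τ₁ (R_z f + G¹_z ψ) = 0`, so the boundary condition forces `ψ = 0`
    have h1 := P.τext.graph.add_mem (P.res_mem_τext hz f) (P.τG_mem hz (ψ, 0))
    rw [Prod.mk_add_mk, G_inl] at h1
    have h2 := P.τext.graph_fst_eq_zero_snd h1 h0
    have h3 : P.ι₁ (P.τ₁ (resGraph P.A z f)) + P.τ₁G₁ z ψ = 0 := congrArg Prod.fst h2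
    have h4 : ψ = P.B₁ (P.ι₁ (P.τ₁ (resGraph P.A z f)) + P.τ₁G₁ z ψ) := hb
    rw [h3, map_zero] at h4
    rw [h4, map_zero, add_zero] at h0
    exact res_injective hz (h0.trans (map_zero _).symm)

theorem AB_spec (hne : P.Z.Nonempty) :
    IsSelfAdjoint P.AB ∧ ∀ z ∈ P.Z, IsResolventAt P.AB z (P.RB z) :=
  KreinSystem.op_spec (K := P.krein) P.selfAdjoint hne

theorem AB₁_spec (hne : P.Z₁.Nonempty) :
    IsSelfAdjoint P.AB₁ ∧ ∀ z ∈ P.Z₁, IsResolventAt P.AB₁ z (P.RB₁ z) :=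
  KreinSystem.op_spec (K := P.krein₁) P.selfAdjoint hne

/-- `Z` contains all common points of the two resolvent sets, in particular all non-real points. -/
theorem mem_Z (hne : P.Z.Nonempty) (hz : z ∈ resolventSet P.A) (hz' : z ∈ resolventSet P.AB) :
    z ∈ P.Z :=
  KreinSystem.mem_Z (K := P.krein) P.selfAdjoint hne hz hz'

theorem mem_Z₁ (hne : P.Z₁.Nonempty) (hz : z ∈ resolventSet P.A)
    (hz' : z ∈ resolventSet P.AB₁) : z ∈ P.Z₁ :=
  KreinSystem.mem_Z (K := P.krein₁) P.selfAdjoint hne hz hz'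

end PerturbationData

/-! ### The difference of the perturbed resolvents -/

namespace PerturbationData

variable {H h₁ h₂ b₁ b₂ b₂₂ : Type*}
    [NormedAddCommGroup H] [InnerProductSpace ℂ H] [CompleteSpace H]
    [NormedAddCommGroup h₁] [InnerProductSpace ℂ h₁] [CompleteSpace h₁]
    [NormedAddCommGroup h₂] [InnerProductSpace ℂ h₂] [CompleteSpace h₂]
    [NormedAddCommGroup b₁] [NormedSpace ℂ b₁] [CompleteSpace b₁]
    [NormedAddCommGroup b₂] [NormedSpace ℂ b₂] [CompleteSpace b₂]
    [NormedAddCommGroup b₂₂] [NormedSpace ℂ b₂₂] [CompleteSpace b₂₂]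
    (P : PerturbationData H h₁ h₂ b₁ b₂ b₂₂) {z : ℂ}

/-- `τ₂ R^{B₁}_z = τ₂ R_z + τ₂ G¹_z Λ^{B₁}_z τ₁ R_z`. -/
def traceRB₁ (z : ℂ) : H →L[ℂ] b₂ :=
  ContinuousLinearMap.snd ℂ b₁ b₂ ∘L (P.Gstar z + P.τG z ∘L
    ContinuousLinearMap.inl ℂ (Dual' b₁) (Dual' b₂) ∘L P.Λ₁ z ∘L
      ContinuousLinearMap.fst ℂ b₁ b₂ ∘L P.Gstar z)

/-- `G^{B₁}_z = G²_z + G¹_z Λ^{B₁}_z τ₁ G²_z`. -/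
def GB₁ (z : ℂ) : Dual' b₂ →L[ℂ] H :=
  P.G₂ z ∘L dualMap P.ι₂ + (P.G₁ z ∘L dualMap P.ι₁) ∘L P.Λ₁ z ∘L
    ContinuousLinearMap.fst ℂ b₁ b₂ ∘L P.τG z ∘L
      ContinuousLinearMap.inr ℂ (Dual' b₁) (Dual' b₂)

/-- The lower right corner of `M_z⁻¹ (B₁ ⊕ B₂)`. -/
def cornerΛ (z : ℂ) : b₂ →L[ℂ] Dual' b₂ :=
  ContinuousLinearMap.snd ℂ (Dual' b₁) (Dual' b₂) ∘L (P.M z).inverse ∘L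
    ContinuousLinearMap.inr ℂ (Dual' b₁) (Dual' b₂₂) ∘L P.B₂

theorem traceRB₁_apply (z : ℂ) (f : H) :
    P.traceRB₁ z f = (P.Gstar z f).2 + (P.τG z (P.Λ₁ z (P.Gstar z f).1, 0)).2 := rfl

theorem GB₁_apply (z : ℂ) (ψ : Dual' b₂) :
    P.GB₁ z ψ = P.G₂ z (dualMap P.ι₂ ψ) +
      P.G₁ z (dualMap P.ι₁ (P.Λ₁ z (P.τG z (0, ψ)).1)) := rfl

theorem RB₁_apply (z : ℂ) (f : H) :
    P.RB₁ z f = res P.A z f + P.G₁ z (dualMap P.ι₁ (P.Λ₁ z (P.Gstar z f).1)) := rfl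

theorem RB_apply (z : ℂ) (f : H) : P.RB z f = res P.A z f + P.G z (P.Λ z (P.Gstar z f)) := rfl

theorem RB₁_mem_τext (hz : z ∈ P.Z₁) (f : H) :
    ∃ x : b₁, (P.RB₁ z f, (x, P.traceRB₁ z f)) ∈ P.τext.graph := by
  have h := P.τext.graph.add_mem (P.res_mem_τext hz.1 f)
    (P.τG_mem hz.1 (P.Λ₁ z (P.Gstar z f).1, 0))
  rw [G_inl] at h
  exact ⟨_, h⟩

/-- `G^{B₁}_z` is the adjoint of `τ₂ R^{B₁}_z̄`. -/
theorem inner_GB₁ (hz : z ∈ P.Z₁) (u : H) (ψ : Dual' b₂) :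
    ⟪u, P.GB₁ z ψ⟫_ℂ = ψ (P.traceRB₁ (conj z) u) := by
  rw [GB₁_apply, traceRB₁_apply, inner_add_right, inner_G₁, inner_G₂, map_add]
  congr 1
  have h1 := P.krein_symm_one hz.1 hz.2.1 hz.2.2 (P.τG z (0, ψ)).1 (P.Gstar (conj z) u).1
  change P.Λ₁ z _ _ = conj (P.Λ₁ (conj z) _ _) at h1
  rw [h1]
  have h2 := P.τG_symm hz.1 (0, ψ) (P.Λ₁ (conj z) (P.Gstar (conj z) u).1, 0)
  simp only [zero_apply, add_zero, zero_add] at h2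
  rw [h2, Complex.conj_conj]

/-- Krein's formula for `A_B` relative to `A_{B₁}`. -/
theorem RB_sub_RB₁ (hz : z ∈ P.Z) (hz₁ : z ∈ P.Z₁) (f : H) :
    P.RB z f - P.RB₁ z f = P.GB₁ z (P.cornerΛ z (P.traceRB₁ z f)) := by
  set ψ := P.Λ z (P.Gstar z f) with hψ
  set χ := P.Λ₁ z (P.Gstar z f).1 with hχ
  have hM : P.M z ψ = (P.B₁ (P.Gstar z f).1, P.B₂ (P.Gstar z f).2) := hz.2.1.self_apply_inverse _
  have hM' : ∀ θ : Dual' b₁ × Dual' b₂, P.M z θ =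
      (θ.1 - P.B₁ (P.τG z θ).1, P.B₀ θ.2 - P.B₂ (P.τG z θ).2) := fun θ => rfl
  have hM₁ : ∀ θ, θ - P.B₁ (P.τG z (θ, 0)).1 = P.M₁ z θ := fun θ => rfl
  have hχ' : P.M₁ z χ = P.B₁ (P.Gstar z f).1 := hz₁.2.1.self_apply_inverse _
  have hsplit : P.τG z ψ = P.τG z (ψ.1, 0) + P.τG z (0, ψ.2) := by
    rw [← map_add, Prod.mk_add_mk, add_zero, zero_add]
  have h2 : P.cornerΛ z (P.traceRB₁ z f) = ψ.2 := by
    have h3 : P.M z (ψ.1 - χ, ψ.2) = (0, P.B₂ (P.traceRB₁ z f)) := by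
      have h4 : ((ψ.1 - χ, ψ.2) : Dual' b₁ × Dual' b₂) = ψ - (χ, 0) :=
        Prod.ext rfl (sub_zero _).symm
      rw [h4, map_sub, hM, hM' (χ, 0), hM₁, hχ', traceRB₁_apply, map_zero, ← hχ]
      refine Prod.ext (sub_self _) ?_
      simp only [Prod.snd_sub, map_add]
      abel
    change ((P.M z).inverse (0, P.B₂ (P.traceRB₁ z f))).2 = ψ.2
    rw [← h3, hz.2.1.inverse_apply_self]
  have h1 : ψ.1 = χ + P.Λ₁ z (P.τG z (0, ψ.2)).1 := by
    apply hz₁.2.1.injective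
    have h5 : ψ.1 - P.B₁ (P.τG z ψ).1 = P.B₁ (P.Gstar z f).1 :=
      congrArg Prod.fst ((hM' ψ).symm.trans hM)
    have h6 : P.M₁ z (P.Λ₁ z (P.τG z (0, ψ.2)).1) = P.B₁ (P.τG z (0, ψ.2)).1 :=
      hz₁.2.1.self_apply_inverse _
    rw [map_add, hχ', h6, ← h5, ← hM₁, hsplit, Prod.fst_add, map_add]
    abel
  rw [h2, RB_apply, RB₁_apply, GB₁_apply, ← hψ, ← hχ, G_apply, h1, map_add, map_add]
  abel

/-- At a common point `c` of the resolvent sets of `A_B` and `A_{B₁}` that need not belong to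
`ϱ(A)`, the resolvent difference is still of the form `G^{B₁}_c N τ₂ R^{B₁}_c`. -/
theorem res_AB_sub_res_AB₁ (hne : P.Z.Nonempty) (hne₁ : P.Z₁.Nonempty) {c : ℝ}
    (hc : (c : ℂ) ∈ resolventSet P.AB) (hc₁ : (c : ℂ) ∈ resolventSet P.AB₁)
    {K : Dual' b₂ →L[ℂ] H} (hK : P.IsGB₁ c K) :
    ∃ (N : b₂ →L[ℂ] Dual' b₂) (Y : H →L[ℂ] b₂), (∀ u ψ, ⟪u, K ψ⟫_ℂ = ψ (Y u)) ∧
      ∀ f, res P.AB c f - res P.AB₁ c f = K (N (Y f)) := by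
  obtain ⟨hsa, hres⟩ := P.AB_spec hne
  obtain ⟨hsa₁, hres₁⟩ := P.AB₁_spec hne₁
  -- an auxiliary non-real point, at which the Kreĭn formulas over `A` are available
  obtain ⟨z, hz⟩ : ∃ z : ℂ, z.im ≠ 0 := ⟨Complex.I, by simp⟩
  have hz' : (conj z).im ≠ 0 := by rwa [Complex.conj_im, neg_ne_zero]
  have hzZ : z ∈ P.Z := P.mem_Z hne (mem_resolventSet_of_im_ne_zero P.selfAdjoint hz)
    (mem_resolventSet_of_im_ne_zero hsa hz)
  have hzZ₁ : z ∈ P.Z₁ := P.mem_Z₁ hne₁ (mem_resolventSet_of_im_ne_zero P.selfAdjoint hz)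
    (mem_resolventSet_of_im_ne_zero hsa₁ hz)
  have hzZ₁' : conj z ∈ P.Z₁ := P.mem_Z₁ hne₁ (mem_resolventSet_of_im_ne_zero P.selfAdjoint hz')
    (mem_resolventSet_of_im_ne_zero hsa₁ hz')
  have hR := (hres z hzZ).res_eq
  have hR₁ := (hres₁ z hzZ₁).res_eq
  have hR₁' := (hres₁ _ hzZ₁').res_eq
  have hzr := (hres z hzZ).mem
  have hzr₁ := (hres₁ z hzZ₁).mem
  have hzr₁' := (hres₁ _ hzZ₁').mem
  set S := res P.AB₁ c with hS
  set R := res P.AB c with hRc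
  set ζ : ℂ := z - c with hζ
  set k : H → H := fun g => P.GB₁ z (P.cornerΛ z (P.traceRB₁ z g)) with hk
  have hkz : ∀ g, k g = res P.AB z g - res P.AB₁ z g := fun g => by
    rw [hR, hR₁, P.RB_sub_RB₁ hzZ hzZ₁]
  -- `R_z (1 + (z - c) R_c) = R_c`, in both orders and for both operators
  have shift : ∀ {T : H →ₗ.[ℂ] H} {w : ℂ}, w ∈ resolventSet T → (c : ℂ) ∈ resolventSet T →
      ∀ f, res T w (f + (w - c) • res T c f) = res T c f := by
    intro T w hw hc f
    rw [map_add, map_smul, res_commute hw hc, ← res_identity hc hw]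
  have shift' : ∀ {T : H →ₗ.[ℂ] H} {w : ℂ}, w ∈ resolventSet T → (c : ℂ) ∈ resolventSet T →
      ∀ f, res T w f + (w - c) • res T c (res T w f) = res T c f := by
    intro T w hw hc f
    rw [← res_identity hc hw]
  -- `Y = τ₂ S`, and `K` is the adjoint of `Y`
  let Y : H →L[ℂ] b₂ := P.traceRB₁ z ∘L (ContinuousLinearMap.id ℂ H + ζ • S)
  have hY : ∀ u, Y u = P.traceRB₁ z (u + ζ • S u) := fun u => rfl
  have hYmem : ∀ u, ∃ x : b₁, (S u, (x, Y u)) ∈ P.τext.graph := by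
    intro u
    obtain ⟨x, hx⟩ := P.RB₁_mem_τext hzZ₁ (u + ζ • S u)
    rw [← hR₁, shift hzr₁ hc₁] at hx
    exact ⟨x, hx⟩
  have huniq : ∀ {u : H} {x : b₁} {y : b₂} {x' : b₁ × b₂}, (u, (x, y)) ∈ P.τext.graph →
      (u, x') ∈ P.τext.graph → y = x'.2 := fun h h' =>
    congrArg Prod.snd (P.τext.mem_graph_snd_inj h h' rfl)
  have hKY : ∀ u ψ, ⟪u, K ψ⟫_ℂ = ψ (Y u) := by
    intro u ψ
    obtain ⟨y, hy, hy'⟩ := hK ψ u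
    rw [Complex.conj_ofReal] at hy
    obtain ⟨x, hx⟩ := hYmem u
    rw [hy', huniq hx hy]
  have hKG : ∀ ψ, P.GB₁ z ψ + ζ • S (P.GB₁ z ψ) = K ψ := by
    intro ψ
    refine ext_inner_left ℂ fun u => ?_
    have h1 := inner_res hsa₁ hc₁ (by rwa [Complex.conj_ofReal]) u (P.GB₁ z ψ)
    rw [Complex.conj_ofReal, ← hS] at h1
    rw [inner_add_right, inner_smul_right, ← h1, P.inner_GB₁ hzZ₁, P.inner_GB₁ hzZ₁, hKY]
    have h2 : P.traceRB₁ (conj z) (u + conj ζ • S u) = Y u := by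
      obtain ⟨x, hx⟩ := P.RB₁_mem_τext hzZ₁' (u + conj ζ • S u)
      have h3 : conj ζ = conj z - c := by rw [hζ, map_sub, Complex.conj_ofReal]
      rw [← hR₁', h3, shift hzr₁' hc₁, ← h3] at hx
      obtain ⟨x', hx'⟩ := hYmem u
      exact huniq hx hx'
    rw [← h2, map_add, map_smul, map_add, map_smulₛₗ, Complex.conj_conj, smul_eq_mul]
  -- `R - S` in terms of itself, from either side of the shift between `z` and `c`; inserting `hdiff'`
  -- into `hdiff` gives the claim
  have hdiff : ∀ f, R f - S f = K (P.cornerΛ z (P.traceRB₁ z (f + ζ • R f))) := by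
    intro f
    rw [← hKG]
    change _ = k (f + ζ • R f) + ζ • S (k (f + ζ • R f))
    rw [hkz, shift hzr hc, map_sub, smul_sub]
    have := shift' hzr₁ hc₁ (f + ζ • R f)
    have e : S (f + ζ • R f) = S f + ζ • S (R f) := by rw [map_add, map_smul]
    rw [← hS, ← hζ, e] at this
    linear_combination (norm := module) this
  have hdiff' : ∀ f, R f - S f = k (f + ζ • S f) + ζ • R (k (f + ζ • S f)) := by
    intro f
    rw [hkz, shift hzr₁ hc₁, map_sub, smul_sub]
    have := shift' hzr hc (f + ζ • S f)
    have e : R (f + ζ • S f) = R f + ζ • R (S f) := by rw [map_add, map_smul]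
    rw [← hRc, ← hζ, e] at this
    linear_combination (norm := module) -this
  let N : b₂ →L[ℂ] Dual' b₂ := P.cornerΛ z + ζ • P.cornerΛ z ∘L P.traceRB₁ z ∘L
    (ContinuousLinearMap.id ℂ H + ζ • R) ∘L P.GB₁ z ∘L P.cornerΛ z
  refine ⟨N, Y, hKY, fun f => ?_⟩
  have hN : N (Y f) = P.cornerΛ z (Y f) +
      ζ • P.cornerΛ z (P.traceRB₁ z (k (f + ζ • S f) + ζ • R (k (f + ζ • S f)))) := rfl
  have e : f + ζ • R f = (f + ζ • S f) + ζ • (R f - S f) := by module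
  have h5 := hdiff f
  rw [e, map_add (P.traceRB₁ z), map_smul (P.traceRB₁ z), map_add (P.cornerΛ z),
    map_smul (P.cornerΛ z)] at h5
  rw [hN, ← hdiff', hY]
  exact h5

end PerturbationData

/-! ### Boundary values under compact perturbations -/

section CompactOperators

variable {H : Type*} [NormedAddCommGroup H] [InnerProductSpace ℂ H]

/-- The Fredholm alternative. -/
theorem isUnit_one_sub_of_isCompactOperator {X : Type*} [NormedAddCommGroup X] [NormedSpace ℂ X]
    [CompleteSpace X] {C : X →L[ℂ] X} (hC : IsCompactOperator C) (h : ∀ x, C x = x → x = 0) :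
    IsUnit (1 - C) := by
  rcases hC.hasEigenvalue_or_mem_resolventSet (one_ne_zero (α := ℂ)) with h1 | h1
  · obtain ⟨x, hx⟩ := h1.exists_hasEigenvector
    refine absurd (h x ?_) hx.2
    simpa using hx.apply_eq_smul
  · have h2 := spectrum.mem_resolventSet_iff.1 h1
    rwa [map_one] at h2

theorem continuousOn_res [CompleteSpace H] (T : H →ₗ.[ℂ] H) :
    ContinuousOn (res T) (resolventSet T) := by
  intro x hx
  have key : ∀ z ∈ resolventSet T, res T z * (1 - (x - z) • res T x) = res T x := by
    intro z hz
    ext f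
    change res T z (f - (x - z) • res T x f) = res T x f
    rw [map_sub, map_smul, res_identity hz hx f]
    abel
  have hc : ContinuousAt (fun z : ℂ => (1 : H →L[ℂ] H) - (x - z) • res T x) x := by fun_prop
  have h1 : (1 : H →L[ℂ] H) - (x - x) • res T x = 1 := by rw [sub_self, zero_smul, sub_zero]
  have hi : ContinuousAt (fun z : ℂ => res T x * Ring.inverse (1 - (x - z) • res T x)) x := by
    refine continuousAt_const.mul (ContinuousAt.comp (g := Ring.inverse) ?_ hc)
    simp only [h1]
    exact NormedRing.inverse_continuousAt 1
  have hu : ∀ᶠ z in 𝓝 x, IsUnit ((1 : H →L[ℂ] H) - (x - z) • res T x) := by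
    refine hc.eventually (Units.isOpen.mem_nhds ?_)
    simp only [h1]
    exact isUnit_one
  have he : (fun z : ℂ => res T x * Ring.inverse (1 - (x - z) • res T x)) =ᶠ[𝓝[resolventSet T] x]
      res T := by
    filter_upwards [nhdsWithin_le_nhds hu, self_mem_nhdsWithin] with z hz hz'
    nth_rewrite 1 [← key z hz']
    rw [mul_assoc, Ring.mul_inverse_cancel _ hz, mul_one]
  refine (hi.continuousWithinAt (s := resolventSet T)).congr_of_eventuallyEq he.symm ?_
  simp only [h1, Ring.inverse_one, mul_one]

/-- A compact operator is not bounded below on an orthonormal sequence. -/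
theorem not_bounded_below_of_orthonormal [CompleteSpace H] {Z : Type*} [NormedAddCommGroup Z]
    [NormedSpace ℂ Z] {κ : H →L[ℂ] Z} (hκ : IsCompactOperator κ) {v : ℕ → H}
    (hv : Orthonormal ℂ v) {C : ℝ} (hC : ∀ n, 1 ≤ C * ‖κ (v n)‖) : False := by
  obtain ⟨S, hS, hS'⟩ := hκ.image_closedBall_subset_compact 1
  have hmem : ∀ n, κ (v n) ∈ S := fun n => hS' ⟨v n, by simp [hv.1 n], rfl⟩
  obtain ⟨y, -, a, ha, hy⟩ := hS.tendsto_subseq hmem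
  have hy0 : y = 0 := by
    refine (SeparatingDual.eq_iff_forall_dual_eq (R := ℂ)).2 fun g => ?_
    rw [map_zero]
    have h1 : Tendsto (fun n => g (κ (v (a n)))) atTop (𝓝 (g y)) :=
      (g.continuous.tendsto y).comp hy
    have h2 : Tendsto (fun n => g (κ (v n))) atTop (𝓝 0) := by
      have hs := (hv.inner_products_summable
        ((InnerProductSpace.toDual ℂ H).symm (g ∘L κ))).tendsto_atTop_zero
      rw [tendsto_zero_iff_norm_tendsto_zero]
      have hs' := hs.sqrt
      simp only [Real.sqrt_zero, Real.sqrt_sq (norm_nonneg _)] at hs'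
      refine hs'.congr fun n => ?_
      rw [norm_inner_symm, InnerProductSpace.toDual_symm_apply]
      rfl
    exact tendsto_nhds_unique h1 (h2.comp ha.tendsto_atTop)
  have h3 : Tendsto (fun n => C * ‖κ (v (a n))‖) atTop (𝓝 (C * ‖y‖)) := (hy.norm).const_mul C
  have h4 := ge_of_tendsto' h3 fun n => hC (a n)
  rw [hy0, norm_zero, mul_zero] at h4
  linarith

end CompactOperators

/-- A scale of spaces `X₂ → X → H → Y`, where `U` identifies `Y` with the dual of the Hilbert space
`X`, together with self-adjoint operators `T`, `T₁` in `H` whose resolvents differ at a real point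
`c` by an operator that extends to a compact map `Y → X₂`. -/
structure CompactPerturbation {H : Type*} [NormedAddCommGroup H] [InnerProductSpace ℂ H]
    [CompleteSpace H] (T T₁ : H →ₗ.[ℂ] H) (X X₂ Y : Type*)
    [NormedAddCommGroup X] [InnerProductSpace ℂ X]
    [NormedAddCommGroup X₂] [NormedSpace ℂ X₂] [NormedAddCommGroup Y] [NormedSpace ℂ Y] where
  /-- the embeddings of the scale -/
  e : X₂ →L[ℂ] X
  i : X →L[ℂ] H
  j : H →L[ℂ] Y
  U : Y →L[ℂ] X
  i_injective : Function.Injective i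
  j_injective : Function.Injective j
  U_injective : Function.Injective U
  inner_U : ∀ h x, ⟪U (j h), x⟫_ℂ = ⟪h, i x⟫_ℂ
  selfAdjoint : IsSelfAdjoint T
  selfAdjoint₁ : IsSelfAdjoint T₁
  c : ℝ
  mem : (c : ℂ) ∈ resolventSet T
  mem₁ : (c : ℂ) ∈ resolventSet T₁
  /-- `(-T₁ + c)⁻¹` maps `X` into itself -/
  regular : ∀ x, ∃ x', i x' = res T₁ c (i x)
  /-- the extension of `(-T + c)⁻¹ - (-T₁ + c)⁻¹` -/
  K : Y →L[ℂ] X₂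
  compact_K : IsCompactOperator K
  res_sub : ∀ f, res T c f - res T₁ c f = i (e (K (j f)))

namespace CompactPerturbation

variable {H : Type*} [NormedAddCommGroup H] [InnerProductSpace ℂ H] [CompleteSpace H]
  {T T₁ : H →ₗ.[ℂ] H} {X X₂ Y : Type*} [NormedAddCommGroup X] [InnerProductSpace ℂ X]
  [NormedAddCommGroup X₂] [NormedSpace ℂ X₂] [NormedAddCommGroup Y] [NormedSpace ℂ Y]
  (W : CompactPerturbation T T₁ X X₂ Y) {z : ℂ}

/-- A bounded operator in `H`, as an operator `X → Y`. -/
def sandwich (S : H →L[ℂ] H) : X →L[ℂ] Y := W.j ∘L S ∘L W.i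

/-- `x ↦ (1 + (c - z) Ψ) x`, as an operator `X → Y`. -/
def shifted (z : ℂ) (Ψ : X →L[ℂ] Y) : X →L[ℂ] Y := W.j ∘L W.i + (W.c - z) • Ψ

/-- The compact operator `(c - z) K (1 + (c - z) Ψ)` in `X`. -/
def comp (z : ℂ) (Ψ : X →L[ℂ] Y) : X →L[ℂ] X := (W.c - z) • (W.e ∘L W.K ∘L W.shifted z Ψ)

/-- The operator `(Ψ + K (1 + (c - z) Ψ)) (1 - (c - z) K (1 + (c - z) Ψ))⁻¹`; it equals the resolvent
of `T` at `z` when `Ψ` is the resolvent of `T₁` at `z`. -/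
def perturbed (z : ℂ) (Ψ : X →L[ℂ] Y) : X →L[ℂ] Y :=
  (Ψ + W.j ∘L W.i ∘L W.e ∘L W.K ∘L W.shifted z Ψ) ∘L Ring.inverse (1 - W.comp z Ψ)

theorem comp_apply (z : ℂ) (Ψ : X →L[ℂ] Y) (x : X) :
    W.comp z Ψ x = (W.c - z) • W.e (W.K (W.shifted z Ψ x)) := rfl

theorem shifted_sandwich (z : ℂ) (x : X) : W.shifted z (W.sandwich (res T₁ z)) x =
    W.j (W.i x + (W.c - z) • res T₁ z (W.i x)) := by
  rw [map_add, map_smul]; rfl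

theorem isCompactOperator_comp (z : ℂ) (Ψ : X →L[ℂ] Y) : IsCompactOperator (W.comp z Ψ) :=
  (((W.compact_K.comp_clm (W.shifted z Ψ)).clm_comp W.e)).smul (W.c - z)

/-- For `f ∈ H` and `h = (1 + (c - z) S_z) f` one has `f - (c - z) K h = (1 - (c - z) R_c) h`. -/
theorem sub_smul_res_sub (hz₁ : z ∈ resolventSet T₁) (f : H) :
    f - (W.c - z) • (res T W.c (f + (W.c - z) • res T₁ z f) -
        res T₁ W.c (f + (W.c - z) • res T₁ z f)) =
      (f + (W.c - z) • res T₁ z f) - (W.c - z) • res T W.c (f + (W.c - z) • res T₁ z f) ∧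
      res T₁ W.c (f + (W.c - z) • res T₁ z f) = res T₁ z f := by
  have h : res T₁ W.c (f + (W.c - z) • res T₁ z f) = res T₁ z f := by
    rw [map_add, map_smul, res_commute W.mem₁ hz₁, ← res_identity hz₁ W.mem₁]
  refine ⟨?_, h⟩
  rw [h]
  module

theorem i_comp_sandwich (z : ℂ) (x : X) :
    W.i (W.comp z (W.sandwich (res T₁ z)) x) =
      (W.c - z) • (res T W.c (W.i x + (W.c - z) • res T₁ z (W.i x)) -
        res T₁ W.c (W.i x + (W.c - z) • res T₁ z (W.i x))) := by
  rw [comp_apply, map_smul, shifted_sandwich, ← W.res_sub]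

theorem res_sub_smul_res (hz : z ∈ resolventSet T) (h : H) :
    res T z (h - (W.c - z) • res T W.c h) = res T W.c h := by
  rw [map_sub, map_smul, res_identity hz W.mem h]
  abel

/-- A fixed point `x` of the compact operator satisfies `(1 - (c - z) R_c) (1 + (c - z) S_z) x = 0`,
and both factors are injective. -/
theorem isUnit_one_sub_comp_sandwich [CompleteSpace X] (hz : z ∈ resolventSet T)
    (hz₁ : z ∈ resolventSet T₁) : IsUnit (1 - W.comp z (W.sandwich (res T₁ z))) := by
  refine isUnit_one_sub_of_isCompactOperator (W.isCompactOperator_comp _ _) fun x hx => ?_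
  have h1 := W.i_comp_sandwich z x
  rw [hx, ← sub_eq_zero] at h1
  obtain ⟨h2, h3⟩ := W.sub_smul_res_sub hz₁ (W.i x)
  rw [h2] at h1
  have h4 := W.res_sub_smul_res hz (W.i x + (W.c - z) • res T₁ z (W.i x))
  rw [h1, map_zero] at h4
  have h5 := res_injective W.mem (h4.symm.trans (map_zero _).symm)
  rw [h5, map_zero] at h3
  have h6 := res_injective hz₁ (h3.symm.trans (map_zero _).symm)
  exact W.i_injective (h6.trans (map_zero _).symm)

/-- The resolvent of `T` at `z` from that of `T₁` at `z`. -/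
theorem perturbed_sandwich [CompleteSpace X] (hz : z ∈ resolventSet T)
    (hz₁ : z ∈ resolventSet T₁) :
    W.perturbed z (W.sandwich (res T₁ z)) = W.sandwich (res T z) := by
  have hu := W.isUnit_one_sub_comp_sandwich hz hz₁
  have key : W.sandwich (res T z) ∘L (1 - W.comp z (W.sandwich (res T₁ z))) =
      W.sandwich (res T₁ z) +
        W.j ∘L W.i ∘L W.e ∘L W.K ∘L W.shifted z (W.sandwich (res T₁ z)) := by
    ext x
    change W.j (res T z (W.i (x - W.comp z (W.sandwich (res T₁ z)) x))) =
      W.j (res T₁ z (W.i x)) + W.j (W.i (W.e (W.K (W.shifted z (W.sandwich (res T₁ z)) x))))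
    obtain ⟨h2, h3⟩ := W.sub_smul_res_sub hz₁ (W.i x)
    rw [map_sub W.i, i_comp_sandwich, h2, W.res_sub_smul_res hz, shifted_sandwich, ← W.res_sub, h3,
      ← map_add]
    congr 1
    abel
  rw [perturbed, ← key, ContinuousLinearMap.comp_assoc]
  have := Ring.mul_inverse_cancel _ hu
  rw [ContinuousLinearMap.mul_def] at this
  rw [this]
  rfl

theorem continuousAt_perturbed [CompleteSpace X] {Ψ : X →L[ℂ] Y}
    (hu : IsUnit (1 - W.comp z Ψ)) :
    ContinuousAt (fun p : ℂ × (X →L[ℂ] Y) => W.perturbed p.1 p.2) (z, Ψ) := by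
  have hs : Continuous fun p : ℂ × (X →L[ℂ] Y) => W.shifted p.1 p.2 := by
    unfold shifted; fun_prop
  have hc : Continuous fun p : ℂ × (X →L[ℂ] Y) => 1 - W.comp p.1 p.2 := by
    unfold comp
    exact continuous_const.sub (((continuous_const.sub continuous_fst)).smul
      (continuous_const.clm_comp (continuous_const.clm_comp hs)))
  have hi : ContinuousAt (fun p : ℂ × (X →L[ℂ] Y) => Ring.inverse (1 - W.comp p.1 p.2)) (z, Ψ) := by
    refine ContinuousAt.comp (g := Ring.inverse) ?_ hc.continuousAt
    obtain ⟨u, hu'⟩ := hu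
    rw [← hu']
    exact NormedRing.inverse_continuousAt u
  unfold perturbed
  exact (((continuous_snd.add (continuous_const.clm_comp (continuous_const.clm_comp
    (continuous_const.clm_comp (continuous_const.clm_comp hs)))))).continuousAt).clm_comp hi

theorem eq_zero_of_forall_inner_i {h : H} (hh : ∀ x, ⟪h, W.i x⟫_ℂ = 0) : h = 0 := by
  apply W.j_injective
  apply W.U_injective
  rw [map_zero, map_zero]
  refine ext_inner_right ℂ fun x => ?_
  rw [W.inner_U, hh, inner_zero_left]

theorem denseRange_i : DenseRange W.i := by
  have : W.i.range.topologicalClosure = ⊤ := by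
    rw [Submodule.topologicalClosure_eq_top_iff, Submodule.eq_bot_iff]
    intro h hh
    exact W.eq_zero_of_forall_inner_i fun x => (Submodule.mem_orthogonal' _ _).1 hh _ ⟨x, rfl⟩
  exact Submodule.dense_iff_topologicalClosure_eq_top.2 this

/-- `Ψ` and `Ψ'` are the boundary values at `x` of the resolvent of `T₁`, in the topology of
`B(X, Y)`, along the points `z` of a filter on the vertical line through `x`, and along `z̄`. -/
structure BoundaryValues (l : Filter ℂ) (x : ℝ) (Ψ Ψ' : X →L[ℂ] Y) : Prop where
  neBot : l.NeBot
  tendsto_id : Tendsto id l (𝓝 (x : ℂ))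
  vertical : ∀ᶠ z in l, z.im ≠ 0 ∧ z.re = x
  tendsto : Tendsto (fun z => W.sandwich (res T₁ z)) l (𝓝 Ψ)
  tendsto_conj : Tendsto (fun z => W.sandwich (res T₁ (conj z))) l (𝓝 Ψ')

variable {W} {l : Filter ℂ} {x : ℝ} {Ψ Ψ' : X →L[ℂ] Y}

theorem BoundaryValues.tendsto_inner (hb : W.BoundaryValues l x Ψ Ψ') (u u' : X) :
    Tendsto (fun z => ⟪res T₁ z (W.i u), W.i u'⟫_ℂ) l (𝓝 ⟪W.U (Ψ u), u'⟫_ℂ) := by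
  have h1 : Tendsto (fun z => W.sandwich (res T₁ z) u) l (𝓝 (Ψ u)) :=
    ((ContinuousLinearMap.apply ℂ Y u).continuous.tendsto Ψ).comp hb.tendsto
  have h2 := Filter.Tendsto.inner (𝕜 := ℂ) ((W.U.continuous.tendsto _).comp h1)
    (tendsto_const_nhds (x := u'))
  refine h2.congr fun z => ?_
  exact W.inner_U _ _

theorem BoundaryValues.tendsto_inner_conj (hb : W.BoundaryValues l x Ψ Ψ') (u u' : X) :
    Tendsto (fun z => ⟪res T₁ (conj z) (W.i u), W.i u'⟫_ℂ) l (𝓝 ⟪W.U (Ψ' u), u'⟫_ℂ) := by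
  have h1 : Tendsto (fun z => W.sandwich (res T₁ (conj z)) u) l (𝓝 (Ψ' u)) :=
    ((ContinuousLinearMap.apply ℂ Y u).continuous.tendsto Ψ').comp hb.tendsto_conj
  have h2 := Filter.Tendsto.inner (𝕜 := ℂ) ((W.U.continuous.tendsto _).comp h1)
    (tendsto_const_nhds (x := u'))
  refine h2.congr fun z => ?_
  exact W.inner_U _ _

theorem im_inner_res {T : H →ₗ.[ℂ] H} (hT : IsSelfAdjoint T) (hz : z ∈ resolventSet T) (f : H) :
    (⟪res T z f, f⟫_ℂ).im = z.im * ‖res T z f‖ ^ 2 := by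
  have h := im_inner_graph hT (res_mem_graph hz f)
  rw [inner_sub_right, inner_smul_right, inner_self_eq_ofReal, Complex.sub_im,
    Complex.im_mul_ofReal] at h
  linarith

/-- Where the quadratic form of the boundary value is real, the two boundary values agree: by the
Cauchy-Schwarz inequality for the form `Im ⟨S_z f, f⟩ = Im z ‖S_z f‖²`. -/
theorem BoundaryValues.eq_of_im_eq_zero (hb : W.BoundaryValues l x Ψ Ψ') {u : X}
    (hu : (⟪W.U (Ψ u), u⟫_ℂ).im = 0) : Ψ u = Ψ' u := by
  have := hb.neBot
  rw [← sub_eq_zero]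
  apply W.U_injective
  rw [map_zero]
  refine ext_inner_right ℂ fun u' => ?_
  rw [inner_zero_left, map_sub, inner_sub_left]
  have h1 := (((hb.tendsto_inner u u').sub (hb.tendsto_inner_conj u u')).norm).pow 2
  have h2 : Tendsto (fun z => 4 * (|(⟪res T₁ z (W.i u), W.i u⟫_ℂ).im| *
      |(⟪res T₁ z (W.i u'), W.i u'⟫_ℂ).im|)) l
      (𝓝 (4 * (|(⟪W.U (Ψ u), u⟫_ℂ).im| * |(⟪W.U (Ψ u'), u'⟫_ℂ).im|))) :=
    ((((Complex.continuous_im.tendsto _).comp (hb.tendsto_inner u u)).abs).mul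
      (((Complex.continuous_im.tendsto _).comp (hb.tendsto_inner u' u')).abs)).const_mul 4
  rw [hu, abs_zero, zero_mul, mul_zero] at h2
  have h3 := le_of_tendsto_of_tendsto h1 h2 (by
    filter_upwards [hb.vertical] with z hz
    have hz1 := mem_resolventSet_of_im_ne_zero W.selfAdjoint₁ hz.1
    have hz2 := conj_mem_resolventSet W.selfAdjoint₁ hz1
    rw [im_inner_res W.selfAdjoint₁ hz1, im_inner_res W.selfAdjoint₁ hz1, ← inner_sub_left]
    have e : res T₁ z (W.i u) - res T₁ (conj z) (W.i u) =
        (conj z - z) • res T₁ (conj z) (res T₁ z (W.i u)) := by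
      rw [res_commute hz2 hz1, res_identity hz1 hz2 (W.i u)]
      abel
    have hz3 : conj (conj z) ∈ resolventSet T₁ := by rwa [Complex.conj_conj]
    rw [e, inner_smul_left, inner_res W.selfAdjoint₁ hz2 hz3, Complex.conj_conj, norm_mul,
      RCLike.norm_conj, ← norm_neg, neg_sub, Complex.sub_conj, norm_mul, Complex.norm_I, mul_one,
      Complex.norm_real, Real.norm_eq_abs, abs_mul, abs_two]
    have h4 := norm_inner_le_norm (𝕜 := ℂ) (res T₁ z (W.i u)) (res T₁ z (W.i u'))
    calc (2 * |z.im| * ‖⟪res T₁ z (W.i u), res T₁ z (W.i u')⟫_ℂ‖) ^ 2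
        ≤ (2 * |z.im| * (‖res T₁ z (W.i u)‖ * ‖res T₁ z (W.i u')‖)) ^ 2 := by gcongr
      _ = _ := by
        rw [abs_mul, abs_mul, abs_of_nonneg (sq_nonneg ‖res T₁ z (W.i u)‖),
          abs_of_nonneg (sq_nonneg ‖res T₁ z (W.i u')‖)]
        ring)
  have h5 : ‖⟪W.U (Ψ u), u'⟫_ℂ - ⟪W.U (Ψ' u), u'⟫_ℂ‖ = 0 := by
    have := norm_nonneg (⟪W.U (Ψ u), u'⟫_ℂ - ⟪W.U (Ψ' u), u'⟫_ℂ)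
    nlinarith
  exact norm_eq_zero.1 h5

/-- The difference of the resolvents at the real point `c` is symmetric. -/
theorem im_inner_res_sub (h : H) : (⟪W.U (W.j h), W.e (W.K (W.j h))⟫_ℂ).im = 0 := by
  have h1 := im_inner_res W.selfAdjoint W.mem h
  have h2 := im_inner_res W.selfAdjoint₁ W.mem₁ h
  rw [Complex.ofReal_im, zero_mul] at h1 h2
  rw [W.inner_U, ← W.res_sub, ← inner_conj_symm, Complex.conj_im, inner_sub_left, Complex.sub_im,
    h1, h2]
  simp

/-- A fixed point `u` of the compact operator at a real point `x` yields the eigenvector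
`(1 + (c - x) Ψ) u` of `T`: symmetry of `K` makes the quadratic form of `Ψ` real at `u`, so that the
two boundary values agree at `u`, and by hypothesis `Ψ u` then belongs to `H`. -/
theorem BoundaryValues.eq_zero_of_comp_eq (hb : W.BoundaryValues l x Ψ Ψ')
    (h3 : ∀ u : X₂, Ψ (W.e u) = Ψ' (W.e u) → ∃ w, W.j w = Ψ (W.e u))
    (hx : x ∉ pointSpec T) {u : X} (hu : W.comp x Ψ u = u) : u = 0 := by
  have := hb.neBot
  set ζ : ℂ := W.c - x with hζ
  have hζr : ζ = ((W.c - x : ℝ) : ℂ) := by rw [hζ, Complex.ofReal_sub]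
  by_cases hζ0 : W.c - x = 0
  · rw [← hu, comp_apply, ← hζ, hζr, hζ0, Complex.ofReal_zero, zero_smul]
  set y := W.shifted x Ψ u with hy
  have hy' : y = W.j (W.i u) + ζ • Ψ u := rfl
  have hu' : u = ζ • W.e (W.K y) := hu.symm
  have hyreal : (⟪W.U y, W.e (W.K y)⟫_ℂ).im = 0 := by
    have h1 : Tendsto (fun z => W.j (W.i u + ζ • res T₁ z (W.i u))) l (𝓝 y) := by
      have h2 : Tendsto (fun z => W.sandwich (res T₁ z) u) l (𝓝 (Ψ u)) :=
        ((ContinuousLinearMap.apply ℂ Y u).continuous.tendsto Ψ).comp hb.tendsto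
      have h4 := (h2.const_smul ζ).const_add (W.j (W.i u))
      refine h4.congr fun z => ?_
      rw [map_add, map_smul]; rfl
    have h5 : Continuous fun y => (⟪W.U y, W.e (W.K y)⟫_ℂ).im :=
      Complex.continuous_im.comp (W.U.continuous.inner (W.e.continuous.comp W.K.continuous))
    have h6 := (h5.tendsto y).comp h1
    refine tendsto_nhds_unique h6 ?_
    refine tendsto_const_nhds.congr fun z => ?_
    exact (im_inner_res_sub _).symm
  have himu : (⟪W.U (Ψ u), u⟫_ℂ).im = 0 := by
    have h1 : ⟪W.U y, u⟫_ℂ = ((W.c - x : ℝ) : ℂ) * ⟪W.U y, W.e (W.K y)⟫_ℂ := by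
      nth_rewrite 1 [hu']
      rw [inner_smul_right, hζr]
    have h2 : ⟪W.U y, u⟫_ℂ = ⟪W.i u, W.i u⟫_ℂ + ((W.c - x : ℝ) : ℂ) * ⟪W.U (Ψ u), u⟫_ℂ := by
      rw [hy', map_add, map_smul, inner_add_left, inner_smul_left, W.inner_U, hζr,
        Complex.conj_ofReal]
    rw [h2] at h1
    have h4 := congrArg Complex.im h1
    rw [Complex.add_im, Complex.im_ofReal_mul, Complex.im_ofReal_mul, hyreal, mul_zero,
      inner_self_eq_ofReal, Complex.ofReal_im, zero_add] at h4
    exact (mul_eq_zero.1 h4).resolve_left hζ0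
  have hΨ := hb.eq_of_im_eq_zero himu
  -- `u = e (ζ K y)` comes from `X₂`, so the hypothesis on `X₂` applies to it
  have heu : W.e (ζ • W.K y) = u := by rw [map_smul]; exact hu
  obtain ⟨w, hw⟩ := h3 (ζ • W.K y) (by rw [heu]; exact hΨ)
  rw [heu] at hw
  set v := W.i u + ζ • w with hv
  have hjv : W.j v = y := by rw [hv, map_add, map_smul, hw, hy']
  -- the resolvent identity between `c` and `z`, in the limit `z → x`
  have hwv : w = res T₁ W.c v := by
    rw [← sub_eq_zero]
    refine W.eq_zero_of_forall_inner_i fun u' => ?_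
    rw [inner_sub_left, sub_eq_zero]
    obtain ⟨u'', hu''⟩ := W.regular u'
    have hcc : conj (W.c : ℂ) ∈ resolventSet T₁ := by rw [Complex.conj_ofReal]; exact W.mem₁
    have hadj : ∀ g, ⟪res T₁ W.c g, W.i u'⟫_ℂ = ⟪g, W.i u''⟫_ℂ := fun g => by
      rw [inner_res W.selfAdjoint₁ W.mem₁ hcc, Complex.conj_ofReal, hu'']
    have hlim : ∀ u₁ : X, ⟪W.U (Ψ u), u₁⟫_ℂ = ⟪w, W.i u₁⟫_ℂ := fun u₁ => by
      rw [← hw, W.inner_U]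
    have h1 := hb.tendsto_inner u u'
    have hconj : Tendsto (fun z : ℂ => conj ((W.c : ℂ) - z)) l (𝓝 (conj ζ)) :=
      (Complex.continuous_conj.tendsto _).comp (tendsto_const_nhds.sub hb.tendsto_id)
    have h2 := (hconj.mul (hb.tendsto_inner u u'')).const_add ⟪W.i u, W.i u''⟫_ℂ
    have h4 : (fun z => ⟪res T₁ z (W.i u), W.i u'⟫_ℂ) =ᶠ[l] fun z => ⟪W.i u, W.i u''⟫_ℂ +
        conj ((W.c : ℂ) - z) * ⟪res T₁ z (W.i u), W.i u''⟫_ℂ := by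
      filter_upwards [hb.vertical] with z hz
      have hz1 := mem_resolventSet_of_im_ne_zero W.selfAdjoint₁ hz.1
      rw [← hadj, ← hadj, ← inner_smul_left, ← inner_add_left, res_commute W.mem₁ hz1,
        ← res_identity hz1 W.mem₁]
    have h5 := tendsto_nhds_unique (h1.congr' h4) h2
    rw [hlim, hlim] at h5
    rw [h5, hadj, hv, inner_add_left, inner_smul_left]
  have hveig : v ∈ eigenspace T x := by
    rw [mem_eigenspace_iff_res W.mem]
    have h1 := W.res_sub v
    rw [← hwv, hjv, sub_eq_iff_eq_add] at h1
    change v = ζ • res T W.c v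
    rw [h1, smul_add, ← map_smul, ← hu', hv]
  by_contra hne
  refine hx ⟨v, hveig, fun hv0 => hne ?_⟩
  rw [hu', ← hjv, hv0, map_zero, map_zero, map_zero, smul_zero]

/-- Off the point spectrum of `T` the boundary value of the perturbed resolvent can be formed. -/
theorem BoundaryValues.isUnit [CompleteSpace X] (hb : W.BoundaryValues l x Ψ Ψ')
    (h3 : ∀ u : X₂, Ψ (W.e u) = Ψ' (W.e u) → ∃ w, W.j w = Ψ (W.e u))
    (hx : x ∉ pointSpec T) : IsUnit (1 - W.comp x Ψ) :=
  isUnit_one_sub_of_isCompactOperator (W.isCompactOperator_comp _ _) fun _ hu =>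
    hb.eq_zero_of_comp_eq h3 hx hu

/-- For `w ∈ H` the vectors `(x - z) S_z w` tend to `0` weakly as `z → x`; in particular `x` is not
an eigenvalue of `T₁`. -/
theorem BoundaryValues.tendsto_smul_res (hb : W.BoundaryValues l x Ψ Ψ') (w : H) (u : X) :
    Tendsto (fun z => ⟪((x : ℂ) - z) • res T₁ z w, W.i u⟫_ℂ) l (𝓝 0) := by
  have hvert : ∀ {z : ℂ}, z.im ≠ 0 ∧ z.re = x → ‖(x : ℂ) - z‖ = |z.im| := by
    intro z hz
    have : (x : ℂ) - z = ((-z.im : ℝ) : ℂ) * Complex.I := by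
      apply Complex.ext <;> simp [hz.2]
    rw [this, norm_mul, Complex.norm_I, mul_one, Complex.norm_real, Real.norm_eq_abs, abs_neg]
  have hdense : Dense {w : H | Tendsto (fun z => ⟪((x : ℂ) - z) • res T₁ z w, W.i u⟫_ℂ) l (𝓝 0)} := by
    refine W.denseRange_i.mono ?_
    rintro _ ⟨u', rfl⟩
    have h1 : Tendsto (fun z : ℂ => conj ((x : ℂ) - z)) l (𝓝 (conj ((x : ℂ) - x))) :=
      (Complex.continuous_conj.tendsto _).comp (tendsto_const_nhds.sub hb.tendsto_id)
    have h2 := h1.mul (hb.tendsto_inner u' u)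
    rw [sub_self, map_zero, zero_mul] at h2
    refine h2.congr fun z => ?_
    rw [inner_smul_left]
  refine Metric.tendsto_nhds.2 fun ε hε => ?_
  obtain ⟨w', hw', hd⟩ := Metric.dense_iff.1 hdense w (ε / (2 * (‖W.i u‖ + 1))) (by positivity)
  rw [Metric.mem_ball, dist_comm, dist_eq_norm] at hw'
  filter_upwards [hb.vertical, Metric.tendsto_nhds.1 hd (ε / 2) (by positivity)] with z hz hz'
  rw [dist_zero_right] at hz' ⊢
  have hz1 := mem_resolventSet_of_im_ne_zero W.selfAdjoint₁ hz.1
  have e : ⟪((x : ℂ) - z) • res T₁ z w, W.i u⟫_ℂ = ⟪((x : ℂ) - z) • res T₁ z w', W.i u⟫_ℂ +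
      ⟪((x : ℂ) - z) • res T₁ z (w - w'), W.i u⟫_ℂ := by
    rw [← inner_add_left, ← smul_add, ← map_add, add_sub_cancel]
  have h1 : ‖⟪((x : ℂ) - z) • res T₁ z (w - w'), W.i u⟫_ℂ‖ ≤ ‖w - w'‖ * ‖W.i u‖ := by
    refine (norm_inner_le_norm _ _).trans ?_
    rw [norm_smul, hvert hz]
    exact mul_le_mul_of_nonneg_right (abs_im_mul_norm_res_le W.selfAdjoint₁ hz1 _) (norm_nonneg _)
  have h2 : ‖w - w'‖ * ‖W.i u‖ ≤ ε / 2 := by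
    calc ‖w - w'‖ * ‖W.i u‖ ≤ ε / (2 * (‖W.i u‖ + 1)) * (‖W.i u‖ + 1) := by
          gcongr
          linarith
      _ = ε / 2 := by field_simp
  rw [e]
  refine (norm_add_le _ _).trans_lt ?_
  linarith

/-- Eigenvectors `v` of `T` are controlled by `K v`: `v = u + (c - x) w` with `u` a multiple of `K v` and
`w = (-T₁ + c)⁻¹ v`, and `w` turns out to be the boundary value of the resolvent of `T₁` at `u`. -/
theorem BoundaryValues.norm_le_of_mem_eigenspace (hb : W.BoundaryValues l x Ψ Ψ') {C : ℝ}
    (h3 : ∀ u : X₂, Ψ (W.e u) = Ψ' (W.e u) → ∃ w, W.j w = Ψ (W.e u) ∧ ‖w‖ ≤ C * ‖u‖)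
    {v : H} (hv : v ∈ eigenspace T x) :
    ‖v‖ ≤ (‖W.i ∘L W.e‖ + ‖(W.c : ℂ) - x‖ * C) * ‖(W.c : ℂ) - x‖ * ‖W.K (W.j v)‖ := by
  have := hb.neBot
  set ζ : ℂ := W.c - x with hζ
  set u := ζ • W.K (W.j v) with hu
  set w := res T₁ W.c v with hw
  have hvw : v = W.i (W.e u) + ζ • w := by
    have h1 : v = ζ • res T W.c v := (mem_eigenspace_iff_res W.mem).1 hv
    have h2 := W.res_sub v
    rw [sub_eq_iff_eq_add] at h2
    rw [h2, smul_add, ← map_smul, ← map_smul] at h1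
    exact h1
  have hS : ∀ {z : ℂ}, z ∈ resolventSet T₁ →
      res T₁ z (W.i (W.e u)) = w + ((x : ℂ) - z) • res T₁ z w := by
    intro z hz
    have h1 : W.i (W.e u) = v - ζ • w := by
      nth_rewrite 1 [hvw]; abel
    rw [h1, map_sub, map_smul, res_identity hz W.mem₁ v, ← hw, hζ]
    module
  have hΨ : Ψ (W.e u) = W.j w := by
    apply W.U_injective
    refine ext_inner_right ℂ fun u' => ?_
    rw [W.inner_U]
    have h1 := (hb.tendsto_smul_res w u').const_add ⟪w, W.i u'⟫_ℂ
    rw [add_zero] at h1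
    refine tendsto_nhds_unique (hb.tendsto_inner (W.e u) u') (h1.congr' ?_)
    filter_upwards [hb.vertical] with z hz
    rw [hS (mem_resolventSet_of_im_ne_zero W.selfAdjoint₁ hz.1), inner_add_left]
  have hΨ' : Ψ (W.e u) = Ψ' (W.e u) := by
    refine hb.eq_of_im_eq_zero ?_
    rw [hΨ, W.inner_U]
    have h1 : W.i (W.e u) = v - ζ • w := by
      nth_rewrite 1 [hvw]; abel
    have hζr : ζ = ((W.c - x : ℝ) : ℂ) := by rw [hζ, Complex.ofReal_sub]
    have h2 := im_inner_res W.selfAdjoint₁ W.mem₁ v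
    rw [Complex.ofReal_im, zero_mul] at h2
    rw [h1, inner_sub_right, inner_smul_right, Complex.sub_im, h2, hζr, Complex.im_ofReal_mul,
      inner_self_eq_ofReal, Complex.ofReal_im]
    simp
  obtain ⟨w', hw', hC⟩ := h3 u hΨ'
  rw [hΨ] at hw'
  rw [W.j_injective hw'] at hC
  have hun : ‖u‖ = ‖ζ‖ * ‖W.K (W.j v)‖ := norm_smul _ _
  calc ‖v‖ ≤ ‖(W.i ∘L W.e) u‖ + ‖ζ • w‖ := by
        nth_rewrite 1 [hvw]; exact norm_add_le _ _
    _ ≤ ‖W.i ∘L W.e‖ * ‖u‖ + ‖ζ‖ * (C * ‖u‖) := by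
        rw [norm_smul]
        gcongr
        exact ContinuousLinearMap.le_opNorm _ _
    _ = _ := by rw [hun]; ring

/-- Eigenvalues of `T` with eigenvectors uniformly controlled by `K` are finite in number. -/
theorem finite_pointSpec_inter (W : CompactPerturbation T T₁ X X₂ Y) {S : Set ℝ} {C : ℝ}
    (hC : ∀ x ∈ S, ∀ v ∈ eigenspace T x, ‖v‖ ≤ C * ‖W.K (W.j v)‖) :
    (pointSpec T ∩ S).Finite := by
  by_contra hinf
  have hinf' : (pointSpec T ∩ S).Infinite := hinf
  let a : ℕ ↪ (pointSpec T ∩ S : Set ℝ) := Set.Infinite.natEmbedding _ hinf'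
  have hex : ∀ n, ∃ v ∈ eigenspace T (a n : ℝ), ‖v‖ = 1 := by
    intro n
    obtain ⟨v, hv, hv0⟩ := (a n).2.1
    refine ⟨((‖v‖⁻¹ : ℝ) : ℂ) • v, Submodule.smul_mem _ _ hv, ?_⟩
    rw [norm_smul, Complex.norm_real, norm_inv, norm_norm, inv_mul_cancel₀ (norm_ne_zero_iff.2 hv0)]
  choose v hv hv1 using hex
  have hon : Orthonormal ℂ v := by
    refine ⟨hv1, fun m n hmn => ?_⟩
    refine inner_eigenspace_eq_zero W.selfAdjoint ?_ (hv m) (hv n)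
    intro h
    exact hmn (a.injective (Subtype.ext h))
  refine not_bounded_below_of_orthonormal (κ := W.K ∘L W.j) (W.compact_K.comp_clm W.j) hon
    (C := C) fun n => ?_
  have := hC _ (a n).2.2 _ (hv n)
  rwa [hv1] at this

end CompactPerturbation

/-! ### The essential spectrum -/

section EssentialSpectrum

variable {H : Type*} [NormedAddCommGroup H] [InnerProductSpace ℂ H] {T : H →ₗ.[ℂ] H} {c : ℝ}

/-- The bounded operator `(-T + x) (-T + c)⁻¹ = 1 - (c - x) (-T + c)⁻¹`. -/
def relOp (T : H →ₗ.[ℂ] H) (c x : ℝ) : H →L[ℂ] H := 1 - ((c : ℂ) - x) • res T c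

theorem relOp_apply (T : H →ₗ.[ℂ] H) (c x : ℝ) (f : H) :
    relOp T c x f = f - ((c : ℂ) - x) • res T c f := rfl

theorem isUnit_relOp_iff (hc : (c : ℂ) ∈ resolventSet T) {x : ℝ} :
    IsUnit (relOp T c x) ↔ (x : ℂ) ∈ resolventSet T := by
  constructor
  · rintro ⟨u, hu⟩
    refine ⟨res T c ∘L (↑u⁻¹ : H →L[ℂ] H), fun f => ?_, fun v => ?_⟩
    · have h1 : relOp T c x ((↑u⁻¹ : H →L[ℂ] H) f) = f := by
        have := u.mul_inv
        rw [hu] at this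
        exact congrArg (fun S : H →L[ℂ] H => S f) this
      rw [relOp_apply] at h1
      have h2 := res_mem_graph hc ((↑u⁻¹ : H →L[ℂ] H) f)
      have e : (x : ℂ) • res T c ((↑u⁻¹ : H →L[ℂ] H) f) - f =
          (c : ℂ) • res T c ((↑u⁻¹ : H →L[ℂ] H) f) - (↑u⁻¹ : H →L[ℂ] H) f := by
        nth_rewrite 2 [← h1]
        module
      rw [← e] at h2
      exact h2
    · have h1 := res_apply_of_mem hc (T.mem_graph v)
      have h2 : (x : ℂ) • (v : H) - T v = relOp T c x ((c : ℂ) • (v : H) - T v) := by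
        rw [relOp_apply, h1]
        module
      have h3 : (↑u⁻¹ : H →L[ℂ] H) (relOp T c x ((c : ℂ) • (v : H) - T v)) =
          (c : ℂ) • (v : H) - T v := by
        have := u.inv_mul
        rw [hu] at this
        exact congrArg (fun S : H →L[ℂ] H => S ((c : ℂ) • (v : H) - T v)) this
      rw [h2, ContinuousLinearMap.comp_apply, h3, h1]
  · intro hx
    have h1 : relOp T c x * (1 + ((c : ℂ) - x) • res T x) = 1 := by
      ext f
      change (f + ((c : ℂ) - x) • res T x f) -
        ((c : ℂ) - x) • res T c (f + ((c : ℂ) - x) • res T x f) = f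
      have := one_add_res_one_add_res hc hx f
      linear_combination (norm := module) this
    have h2 : (1 + ((c : ℂ) - x) • res T x) * relOp T c x = 1 := by
      ext f
      change (f - ((c : ℂ) - x) • res T c f) +
        ((c : ℂ) - x) • res T x (f - ((c : ℂ) - x) • res T c f) = f
      have := one_add_res_one_add_res hx hc f
      have e : f - ((c : ℂ) - x) • res T c f = f + ((x : ℂ) - c) • res T c f := by module
      rwa [e]
    exact ⟨⟨_, _, h1, h2⟩, rfl⟩

theorem mem_eigenspace_iff_relOp (hc : (c : ℂ) ∈ resolventSet T) {x : ℝ} {u : H} :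
    u ∈ eigenspace T x ↔ relOp T c x u = 0 := by
  rw [mem_eigenspace_iff_res hc, relOp_apply, sub_eq_zero]

/-- Operators of finite rank are compact. -/
theorem isCompactOperator_of_forall_mem {E : Submodule ℂ H} [FiniteDimensional ℂ E]
    {S : H →L[ℂ] H} (hS : ∀ f, S f ∈ E) : IsCompactOperator S := by
  have : LocallyCompactSpace E := by
    have := FiniteDimensional.proper ℂ E
    infer_instance
  exact (isCompactOperator_of_locallyCompactSpace_dom (S.codRestrict E hS)).clm_comp E.subtypeL

/-- An injective operator with a left inverse modulo compact operators is bounded below. -/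
theorem bounded_below_of_injective {A Q C : H →L[ℂ] H} (hC : IsCompactOperator C)
    (hQ : ∀ f, Q (A f) = f - C f) (hA : ∀ f, A f = 0 → f = 0) :
    ∃ δ > 0, ∀ f, δ * ‖f‖ ≤ ‖A f‖ := by
  by_contra! hcon
  have hex : ∀ n : ℕ, ∃ f : H, ‖f‖ = 1 ∧ ‖A f‖ < 1 / ((n : ℝ) + 1) := by
    intro n
    obtain ⟨f, hf⟩ := hcon (1 / ((n : ℝ) + 1)) (by positivity)
    have hf0 : f ≠ 0 := by
      rintro rfl
      simp at hf
    have hn := norm_pos_iff.2 hf0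
    refine ⟨((‖f‖⁻¹ : ℝ) : ℂ) • f, ?_, ?_⟩
    · rw [norm_smul, Complex.norm_real, norm_inv, norm_norm, inv_mul_cancel₀ hn.ne']
    · rw [map_smul, norm_smul, Complex.norm_real, norm_inv, norm_norm, inv_mul_lt_iff₀ hn, mul_comm]
      exact hf
  choose f hf hAf using hex
  obtain ⟨S, hS, hS'⟩ := hC.image_closedBall_subset_compact 1
  obtain ⟨y, -, a, ha, hy⟩ := hS.tendsto_subseq
    (x := fun n => C (f n)) fun n => hS' ⟨f n, by simp [hf n], rfl⟩
  have hA0 : Tendsto (fun n => A (f (a n))) atTop (𝓝 0) := by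
    have : Tendsto (fun n => A (f n)) atTop (𝓝 0) :=
      squeeze_zero_norm (fun n => (hAf n).le) tendsto_one_div_add_atTop_nhds_zero_nat
    exact this.comp ha.tendsto_atTop
  have hlim : Tendsto (fun n => f (a n)) atTop (𝓝 y) := by
    have h1 := ((Q.continuous.tendsto _).comp hA0).add hy
    rw [map_zero, zero_add] at h1
    refine h1.congr fun n => ?_
    simp [hQ]
  have hy1 : ‖y‖ = 1 := by
    refine tendsto_nhds_unique hlim.norm ?_
    simp only [hf]
    exact tendsto_const_nhds
  have hy0 := hA y (tendsto_nhds_unique ((A.continuous.tendsto _).comp hlim) hA0)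
  rw [hy0, norm_zero] at hy1
  exact zero_ne_one hy1

variable [CompleteSpace H]

/-- The quadratic form of `A²` is coercive. -/
theorem isUnit_of_isSelfAdjoint_of_bounded_below {A : H →L[ℂ] H} (hA : IsSelfAdjoint A) {δ : ℝ}
    (hδ : 0 < δ) (h : ∀ f, δ * ‖f‖ ≤ ‖A f‖) : IsUnit A := by
  have hs := ContinuousLinearMap.isSelfAdjoint_iff_isSymmetric.1 hA
  refine (isUnit_pow_iff (two_ne_zero)).1 (ContinuousLinearMap.isUnit_of_forall_le_norm_inner_map
    (A ^ 2) (c := ⟨δ ^ 2, by positivity⟩) (by change 0 < δ ^ 2; positivity) fun f => ?_)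
  have e : ⟪(A ^ 2) f, f⟫_ℂ = ⟪A f, A f⟫_ℂ := by
    rw [pow_two]
    exact hs (A f) f
  rw [e, inner_self_eq_ofReal, Complex.norm_real, Real.norm_eq_abs, abs_of_nonneg (by positivity)]
  have := pow_le_pow_left₀ (by positivity) (h f) 2
  rw [mul_pow] at this
  rw [mul_comm]
  exact this

theorem isSelfAdjoint_res (hT : IsSelfAdjoint T) (hc : (c : ℂ) ∈ resolventSet T) :
    IsSelfAdjoint (res T c) := by
  refine ContinuousLinearMap.isSelfAdjoint_iff_isSymmetric.2 fun f g => ?_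
  have := inner_res hT hc (by rwa [Complex.conj_ofReal]) f g
  rwa [Complex.conj_ofReal] at this

theorem isSelfAdjoint_relOp (hT : IsSelfAdjoint T) (hc : (c : ℂ) ∈ resolventSet T) (x : ℝ) :
    IsSelfAdjoint (relOp T c x) := by
  refine (IsSelfAdjoint.one _).sub (IsSelfAdjoint.smul ?_ (isSelfAdjoint_res hT hc))
  rw [← Complex.ofReal_sub]
  exact Complex.conj_ofReal _

/-- At a point of the discrete spectrum the functional calculus provides a parametrix: the spectral
projection onto the isolated point has finite rank, and off that point `1 - (c - x) t` is
invertible. -/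
theorem exists_parametrix_of_mem_discSpec (hT : IsSelfAdjoint T) (hc : (c : ℂ) ∈ resolventSet T)
    {x : ℝ} (hx : x ∈ discSpec T) :
    ∃ Q : H →L[ℂ] H, IsCompactOperator (Q * relOp T c x - 1 : H →L[ℂ] H) := by
  obtain ⟨hxp, hfin, ε, hε, hiso⟩ := hx
  have hxc : c - x ≠ 0 := by
    intro h
    rw [sub_eq_zero] at h
    exact not_mem_resolventSet_of_pointSpec hxp (h ▸ hc)
  have hR := isSelfAdjoint_res hT hc
  set R := res T c with hRdef
  let φ : ℝ → ℝ := fun t => 1 - (c - x) * t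
  let p : ℝ → ℝ := fun t => if φ t = 0 then 1 else 0
  let q : ℝ → ℝ := fun t => if φ t = 0 then 0 else (φ t)⁻¹
  have hφc : Continuous φ := by fun_prop
  -- spectral mapping: `φ` vanishes on the spectrum of `R` only at an isolated point, so the jumps of
  -- `p` and `q` do no harm there
  have hspec : ∀ t ∈ spectrum ℝ R, t ≠ 0 → c - t⁻¹ ∈ spec T := by
    intro t ht ht0 hy
    refine ht (spectrum.mem_resolventSet_iff.2 ?_)
    have h1 := (isUnit_relOp_iff hc).2 hy
    have h2 : algebraMap ℝ (H →L[ℂ] H) t - R = (t : ℂ) • relOp T c (c - t⁻¹) := by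
      ext f
      rw [smul_apply, relOp_apply, ← hRdef]
      change t • f - R f = _
      have h3 : (c : ℂ) - ((c - t⁻¹ : ℝ) : ℂ) = (t : ℂ)⁻¹ := by push_cast; ring
      rw [h3, smul_sub, smul_inv_smul₀ (by exact_mod_cast ht0), Complex.coe_smul]
    rw [h2]
    exact h1.smul (Units.mk0 (t : ℂ) (by exact_mod_cast ht0))
  have hev : ∀ t₀ ∈ spectrum ℝ R, φ t₀ = 0 → ∀ᶠ t in 𝓝[spectrum ℝ R] t₀, t = t₀ := by
    intro t₀ _ h0
    have h0' : (c - x) * t₀ = 1 := by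
      change 1 - (c - x) * t₀ = 0 at h0
      linarith
    have ht₀ : t₀ ≠ 0 := by
      rintro rfl
      simp at h0'
    have hxt : c - t₀⁻¹ = x := by
      rw [← eq_inv_of_mul_eq_one_left h0']; ring
    have hcont : ContinuousAt (fun t : ℝ => c - t⁻¹) t₀ :=
      continuousAt_const.sub (continuousAt_id.inv₀ ht₀)
    have h1 := Metric.tendsto_nhds.1 hcont ε hε
    filter_upwards [nhdsWithin_le_nhds h1, nhdsWithin_le_nhds (isOpen_ne.mem_nhds ht₀),
      self_mem_nhdsWithin] with t h2 h3 h4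
    rw [hxt, Real.dist_eq] at h2
    have h5 := hiso _ (hspec t h4 h3) h2
    rw [← hxt, sub_right_inj] at h5
    exact inv_injective h5
  have hpc : ContinuousOn p (spectrum ℝ R) := by
    intro t₀ ht₀
    by_cases h : φ t₀ = 0
    · exact (continuousWithinAt_const : ContinuousWithinAt (fun _ => p t₀) _ t₀).congr_of_eventuallyEq
        ((hev t₀ ht₀ h).mono fun t ht => by rw [ht]) rfl
    · refine (continuousAt_const : ContinuousAt (fun _ : ℝ => (0 : ℝ)) t₀).congr ?_ |>.continuousWithinAt
      filter_upwards [hφc.continuousAt.eventually_ne h] with t ht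
      exact (if_neg ht).symm
  have hqc : ContinuousOn q (spectrum ℝ R) := by
    intro t₀ ht₀
    by_cases h : φ t₀ = 0
    · exact (continuousWithinAt_const : ContinuousWithinAt (fun _ => q t₀) _ t₀).congr_of_eventuallyEq
        ((hev t₀ ht₀ h).mono fun t ht => by rw [ht]) rfl
    · refine (hφc.continuousAt.inv₀ h).congr ?_ |>.continuousWithinAt
      filter_upwards [hφc.continuousAt.eventually_ne h] with t ht
      exact (if_neg ht).symm
  have hφR : cfc φ R = relOp T c x := by
    have h1 : cfc φ R = cfc (fun _ : ℝ => (1 : ℝ)) R - cfc (fun t : ℝ => (c - x) * t) R :=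
      cfc_sub (fun _ : ℝ => (1 : ℝ)) (fun t : ℝ => (c - x) * t) R
        (by fun_prop) (by fun_prop)
    rw [h1, cfc_const_one ℝ R hR, cfc_const_mul_id (c - x) R hR, relOp, ← hRdef,
      ← Complex.ofReal_sub]
    congr 1
  have hqφ : cfc q R * relOp T c x = 1 - cfc p R := by
    rw [← hφR, ← cfc_mul q φ R hqc hφc.continuousOn, ← cfc_const_one ℝ R hR,
      ← cfc_sub (fun _ => (1 : ℝ)) p R continuousOn_const hpc]
    refine cfc_congr fun t _ => ?_
    by_cases h : φ t = 0
    · simp [q, p, h]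
    · simp [q, p, h]
  have hφp : relOp T c x * cfc p R = 0 := by
    rw [← hφR, ← cfc_mul φ p R hφc.continuousOn hpc, ← cfc_const_zero ℝ R]
    refine cfc_congr fun t _ => ?_
    by_cases h : φ t = 0
    · simp [p, h]
    · simp [p, h]
  refine ⟨cfc q R, ?_⟩
  have : cfc q R * relOp T c x - 1 = -cfc p R := by rw [hqφ]; abel
  rw [this]
  have h1 : IsCompactOperator (cfc p R : H →L[ℂ] H) :=
    isCompactOperator_of_forall_mem (E := eigenspace T x) fun f =>
      (mem_eigenspace_iff_relOp hc).2 (congrArg (fun S : H →L[ℂ] H => S f) hφp)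
  exact h1.neg

/-- If `(-T + x) (-T + c)⁻¹` has a left parametrix then `x` is at most in the discrete spectrum. -/
theorem not_mem_essSpec_of_parametrix (hT : IsSelfAdjoint T) (hc : (c : ℂ) ∈ resolventSet T)
    {x : ℝ} {Q : H →L[ℂ] H} (hQ : IsCompactOperator (Q * relOp T c x - 1 : H →L[ℂ] H)) :
    x ∉ essSpec T := by
  rintro ⟨hxs, hxd⟩
  set C : H →L[ℂ] H := 1 - Q * relOp T c x with hC
  have hCc : IsCompactOperator C := by
    have : C = -(Q * relOp T c x - 1) := by rw [hC]; abel
    rw [this]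
    exact hQ.neg
  have hQC : ∀ f, Q (relOp T c x f) = f - C f := fun f => (sub_sub_cancel f _).symm
  -- the eigenspace is finite dimensional: the compact operator `C` is the identity on it
  have hfin : FiniteDimensional ℂ (eigenspace T x) := by
    have hcl : IsClosed (eigenspace T x : Set H) := by
      have : (eigenspace T x : Set H) = relOp T c x ⁻¹' {0} := by
        ext u; exact mem_eigenspace_iff_relOp hc
      rw [this]
      exact isClosed_singleton.preimage (relOp T c x).continuous
    have hid : ∀ u : eigenspace T x, C (u : H) = u := by
      intro u
      have h1 := hQC u
      rw [(mem_eigenspace_iff_relOp hc).1 u.2, map_zero] at h1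
      exact (sub_eq_zero.1 h1.symm).symm
    have h2 : ∀ u : eigenspace T x, (C ∘L (eigenspace T x).subtypeL) u ∈ eigenspace T x :=
      fun u => by
        change C (u : H) ∈ eigenspace T x
        rw [hid]; exact u.2
    have h3 := (hCc.comp_clm (eigenspace T x).subtypeL).codRestrict h2 hcl
    refine FiniteDimensional.of_isCompactOperator_id (𝕜 := ℂ) ?_
    have h4 : (id : eigenspace T x → eigenspace T x) =
        Set.codRestrict (C ∘ (eigenspace T x).subtypeL) _ h2 :=
      funext fun u => Subtype.ext (hid u).symm
    rw [h4]
    exact h3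
  set P := (eigenspace T x).starProjection with hP
  have hPmem : ∀ f, P f ∈ eigenspace T x := fun f => Submodule.starProjection_apply_mem _ f
  have hPeq : ∀ f ∈ eigenspace T x, P f = f := fun f hf =>
    Submodule.starProjection_eq_self_iff.2 hf
  have hPsa : IsSelfAdjoint P := isSelfAdjoint_starProjection _
  have hPsymm : ∀ f g, ⟪P f, g⟫_ℂ = ⟪f, P g⟫_ℂ :=
    ContinuousLinearMap.isSelfAdjoint_iff_isSymmetric.1 hPsa
  have hLsymm : ∀ y f g, ⟪relOp T c y f, g⟫_ℂ = ⟪f, relOp T c y g⟫_ℂ := fun y =>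
    ContinuousLinearMap.isSelfAdjoint_iff_isSymmetric.1 (isSelfAdjoint_relOp hT hc y)
  have hLP : ∀ f, relOp T c x (P f) = 0 := fun f => (mem_eigenspace_iff_relOp hc).1 (hPmem f)
  have hPL : ∀ f, P (relOp T c x f) = 0 := fun f => by
    refine ext_inner_right ℂ fun g => ?_
    rw [hPsymm, hLsymm, hLP, inner_zero_right, inner_zero_left]
  -- adding the projection onto the kernel makes `relOp T c x` invertible, also for nearby `y`; off the
  -- eigenspace this isolates `x` in the spectrum
  have hunit : IsUnit (relOp T c x + P) := by
    obtain ⟨δ, hδ, hb⟩ := bounded_below_of_injective (A := relOp T c x + P) (Q := Q)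
      (C := C - Q * P) (hCc.sub ((isCompactOperator_of_forall_mem hPmem).clm_comp Q))
      (fun f => by
        change Q (relOp T c x f + P f) = f - (C f - Q (P f))
        rw [map_add, hQC]; abel)
      (fun f hf => by
        change relOp T c x f + P f = 0 at hf
        have h1 := congrArg P hf
        rw [map_add, hPL, zero_add, map_zero, hPeq _ (hPmem f)] at h1
        rw [h1, add_zero] at hf
        rw [← hPeq f ((mem_eigenspace_iff_relOp hc).2 hf), h1])
    exact isUnit_of_isSelfAdjoint_of_bounded_below
      ((isSelfAdjoint_relOp hT hc x).add hPsa) hδ hb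
  have hxp : x ∈ pointSpec T := by
    by_contra hxp
    have hP0 : P = 0 := by
      ext f
      by_contra hf
      exact hxp ⟨P f, hPmem f, hf⟩
    rw [hP0, add_zero] at hunit
    exact hxs ((isUnit_relOp_iff hc).1 hunit)
  have hxc : (c : ℂ) - x ≠ 0 := by
    intro h
    rw [sub_eq_zero] at h
    exact not_mem_resolventSet_of_pointSpec hxp (h ▸ hc)
  refine hxd ⟨hxp, hfin, ?_⟩
  have hcont : Continuous fun y : ℝ => relOp T c y + P := by
    unfold relOp
    fun_prop
  have hev : ∀ᶠ y in 𝓝 x, IsUnit (relOp T c y + P) :=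
    hcont.continuousAt.eventually (Units.isOpen.mem_nhds hunit)
  obtain ⟨ε, hε, hball⟩ := Metric.eventually_nhds_iff.1 hev
  refine ⟨ε, hε, fun y hy hyx => ?_⟩
  by_contra hne
  refine hy ((isUnit_relOp_iff hc).1 ?_)
  obtain ⟨u, hu⟩ := hball (y := y) (by rwa [Real.dist_eq])
  -- on the eigenspace, `relOp T c y` is multiplication by `κ`
  set κ : ℂ := ((y : ℂ) - x) / (c - x) with hκ
  have hκ0 : κ ≠ 0 := by
    refine div_ne_zero (sub_ne_zero.2 ?_) hxc
    exact_mod_cast hne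
  have hκconj : conj κ = κ := by
    rw [hκ, map_div₀, map_sub, map_sub, Complex.conj_ofReal, Complex.conj_ofReal,
      Complex.conj_ofReal]
  have hyP : ∀ f, relOp T c y (P f) = κ • P f := by
    intro f
    have h1 := hLP f
    rw [relOp_apply, sub_eq_zero] at h1
    have h2 : res T c (P f) = ((c : ℂ) - x)⁻¹ • P f := by
      nth_rewrite 2 [h1]
      rw [inv_smul_smul₀ hxc]
    rw [relOp_apply, h2, smul_smul]
    nth_rewrite 1 [← one_smul ℂ (P f)]
    rw [← sub_smul]
    congr 1
    rw [hκ]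
    field_simp
    ring
  have hPy : ∀ f, P (relOp T c y f) = κ • P f := by
    intro f
    refine ext_inner_right ℂ fun g => ?_
    rw [hPsymm, hLsymm, hyP, inner_smul_right, inner_smul_left, hPsymm, hκconj]
  have hcomm : Commute P (u : H →L[ℂ] H) := by
    rw [hu]
    ext f
    change P (relOp T c y f + P f) = relOp T c y (P f) + P (P f)
    rw [map_add, hPy, hyP]
  have hcomm' := hcomm.units_inv_right
  set V : H →L[ℂ] H := (↑u⁻¹ : H →L[ℂ] H) with hV
  have hPV : ∀ f, P (V f) = V (P f) := fun f => congrArg (fun S : H →L[ℂ] H => S f) hcomm'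
  have huV : ∀ f, relOp T c y (V f) + P (V f) = f := fun f => by
    have := u.mul_inv
    rw [hu] at this
    exact congrArg (fun S : H →L[ℂ] H => S f) this
  let D : H →L[ℂ] H := V * (1 - P) + κ⁻¹ • P
  have hD : relOp T c y * D = 1 := by
    ext f
    change relOp T c y (V (f - P f) + κ⁻¹ • P f) = f
    have h1 := huV (f - P f)
    rw [hPV, map_sub P, hPeq _ (hPmem f), sub_self, map_zero, add_zero] at h1
    rw [map_add, h1, map_smul, hyP, inv_smul_smul₀ hκ0, sub_add_cancel]
  have hD' : star D * relOp T c y = 1 := by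
    have := congrArg star hD
    rwa [star_mul, (isSelfAdjoint_relOp hT hc y).star_eq, star_one] at this
  exact isUnit_iff_exists_and_exists.2 ⟨⟨D, hD⟩, ⟨star D, hD'⟩⟩

/-- Perturbing the resolvent by a compact operator does not affect the existence of a left
parametrix. -/
theorem essSpec_subset_of_isCompactOperator {T₁ : H →ₗ.[ℂ] H} (hT : IsSelfAdjoint T)
    (hT₁ : IsSelfAdjoint T₁) (hc : (c : ℂ) ∈ resolventSet T) (hc₁ : (c : ℂ) ∈ resolventSet T₁)
    (h : IsCompactOperator (res T c - res T₁ c)) : essSpec T ⊆ essSpec T₁ := by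
  intro x hx
  by_contra hx₁
  have hpar : ∃ Q : H →L[ℂ] H, IsCompactOperator (Q * relOp T₁ c x - 1 : H →L[ℂ] H) := by
    by_cases hs : x ∈ spec T₁
    · exact exists_parametrix_of_mem_discSpec hT₁ hc₁ (by_contra fun hd => hx₁ ⟨hs, hd⟩)
    · obtain ⟨u, hu⟩ := (isUnit_relOp_iff hc₁).2 (not_not.1 hs)
      refine ⟨(↑u⁻¹ : H →L[ℂ] H), ?_⟩
      rw [← hu, u.inv_mul, sub_self]
      exact isCompactOperator_zero
  obtain ⟨Q, hQ⟩ := hpar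
  refine not_mem_essSpec_of_parametrix hT hc (Q := Q) ?_ hx
  have e : Q * relOp T c x - 1 =
      (Q * relOp T₁ c x - 1) - ((c : ℂ) - x) • (Q * (res T c - res T₁ c)) := by
    rw [relOp, relOp, mul_sub, mul_sub, mul_sub, mul_smul_comm, mul_smul_comm, smul_sub]
    abel
  rw [e]
  exact hQ.sub ((h.clm_comp Q).smul _)

/-- Weyl's theorem: the essential spectrum is determined by the resolvent modulo compact
operators. -/
theorem essSpec_eq_of_isCompactOperator {T₁ : H →ₗ.[ℂ] H} (hT : IsSelfAdjoint T)
    (hT₁ : IsSelfAdjoint T₁) (hc : (c : ℂ) ∈ resolventSet T) (hc₁ : (c : ℂ) ∈ resolventSet T₁)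
    (h : IsCompactOperator (res T c - res T₁ c)) : essSpec T = essSpec T₁ := by
  refine (essSpec_subset_of_isCompactOperator hT hT₁ hc hc₁ h).antisymm
    (essSpec_subset_of_isCompactOperator hT₁ hT hc₁ hc ?_)
  have e : res T₁ c - res T c = -(res T c - res T₁ c) := by abel
  rw [e]
  exact h.neg

end EssentialSpectrum

/-! ### Weighted spaces -/

section WeightedSpaces

variable {M : Type*} [MeasurableSpace M] {m : Measure M} {φ : Weight M}

theorem lpEmb_coeFn {μ ν : Measure M} (h : ν ≤ μ) (f : Lp ℂ 2 μ) : lpEmb h f =ᵐ[ν] f :=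
  MemLp.coeFn_toLp ((Lp.memLp f).mono_measure h)

theorem lpEmb_injective {μ ν : Measure M} (h : ν ≤ μ) (h' : μ ≪ ν) :
    Function.Injective (lpEmb h) := by
  intro f g hfg
  refine Lp.ext (h'.ae_eq ?_)
  exact (lpEmb_coeFn h f).symm.trans ((by rw [hfg] : lpEmb h f =ᵐ[ν] lpEmb h g).trans
    (lpEmb_coeFn h g))

theorem lpEmb_lpEmb {μ ν ρ : Measure M} (h : ν ≤ μ) (h' : ρ ≤ ν) (f : Lp ℂ 2 μ) :
    lpEmb h' (lpEmb h f) = lpEmb (h'.trans h) f :=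
  Lp.ext ((lpEmb_coeFn h' _).trans ((h'.absolutelyContinuous.ae_eq (lpEmb_coeFn h f)).trans
    (lpEmb_coeFn (h'.trans h) f).symm))

theorem Weight.rpow_pos (φ : Weight M) (s : ℝ) (x : M) : 0 < φ.w x ^ s :=
  Real.rpow_pos_of_pos (zero_lt_one.trans_le (φ.one_le_w x)) s

theorem Weight.measurable_density (φ : Weight M) (s : ℝ) :
    Measurable fun x => ENNReal.ofReal ((φ.w x ^ s) ^ 2) :=
  ((φ.measurable_w.pow_const s).pow_const 2).ennreal_ofReal

theorem absolutelyContinuous_wMeasure (m : Measure M) (φ : Weight M) (s : ℝ) :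
    m ≪ wMeasure m φ s :=
  withDensity_absolutelyContinuous' (φ.measurable_density s).aemeasurable
    (Eventually.of_forall fun x => by
      have := φ.rpow_pos s x
      simp only [ne_eq, ENNReal.ofReal_eq_zero, not_le]
      positivity)

theorem wMeasure_absolutelyContinuous (m : Measure M) (φ : Weight M) (s : ℝ) :
    wMeasure m φ s ≪ m :=
  withDensity_absolutelyContinuous _ _

theorem toL2_injective {t : ℝ} (h : 0 ≤ t) : Function.Injective (toL2 m φ h) :=
  lpEmb_injective _ (wMeasure_absolutelyContinuous m φ t)

theorem fromL2_injective : Function.Injective (fromL2 m φ) :=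
  lpEmb_injective _ (absolutelyContinuous_wMeasure m φ (-1))

theorem toL2_embW {s t : ℝ} (h : s ≤ t) (hs : 0 ≤ s) (u : L2w m φ t) :
    toL2 m φ hs (embW m φ h u) = toL2 m φ (hs.trans h) u :=
  lpEmb_lpEmb _ _ u

theorem eLpNorm_rpow_smul (s t : ℝ) (f : M → ℂ) :
    eLpNorm (fun x => φ.w x ^ (s - t) • f x) 2 (wMeasure m φ t) = eLpNorm f 2 (wMeasure m φ s) := by
  have h2 : (2 : ℝ≥0∞) ≠ 0 := two_ne_zero
  have h2' : (2 : ℝ≥0∞) ≠ ∞ := ENNReal.ofNat_ne_top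
  rw [eLpNorm_eq_lintegral_rpow_enorm_toReal h2 h2', eLpNorm_eq_lintegral_rpow_enorm_toReal h2 h2',
    wMeasure, wMeasure,
    lintegral_withDensity_eq_lintegral_mul_non_measurable _ (φ.measurable_density t)
      (Eventually.of_forall fun _ => ENNReal.ofReal_lt_top),
    lintegral_withDensity_eq_lintegral_mul_non_measurable _ (φ.measurable_density s)
      (Eventually.of_forall fun _ => ENNReal.ofReal_lt_top)]
  congr 1
  refine lintegral_congr fun x => ?_
  have hx := zero_lt_one.trans_le (φ.one_le_w x)
  simp only [Pi.mul_apply, ENNReal.toReal_ofNat, ENNReal.rpow_ofNat]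
  rw [enorm_smul, mul_pow, ← mul_assoc, Real.enorm_eq_ofReal (φ.rpow_pos _ x).le,
    ← ENNReal.ofReal_pow (φ.rpow_pos _ x).le, ← ENNReal.ofReal_mul (sq_nonneg _), ← mul_pow,
    ← Real.rpow_add hx, add_sub_cancel]

theorem memLp_rpow_smul (s t : ℝ) (f : L2w m φ s) :
    MemLp (fun x => φ.w x ^ (s - t) • f x) 2 (wMeasure m φ t) := by
  refine ⟨?_, ?_⟩
  · have h1 : AEStronglyMeasurable f (wMeasure m φ t) :=
      (Lp.aestronglyMeasurable f).mono_ac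
        ((wMeasure_absolutelyContinuous m φ t).trans (absolutelyContinuous_wMeasure m φ s))
    exact (φ.measurable_w.pow_const (s - t)).aestronglyMeasurable.smul h1
  · rw [eLpNorm_rpow_smul]
    exact Lp.eLpNorm_lt_top f

/-- Multiplication by `φ^{s-t}`, an isometry `L²_{φ^s} → L²_{φ^t}`. -/
def mulW (m : Measure M) (φ : Weight M) (s t : ℝ) : L2w m φ s →L[ℂ] L2w m φ t :=
  LinearMap.mkContinuous
    { toFun := fun f => (memLp_rpow_smul s t f).toLp
      map_add' := by
        intro f g
        rw [← MemLp.toLp_add]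
        refine MemLp.toLp_congr _ _ ?_
        filter_upwards [((wMeasure_absolutelyContinuous m φ t).trans
          (absolutelyContinuous_wMeasure m φ s)).ae_eq (Lp.coeFn_add f g)] with x hx
        rw [hx, Pi.add_apply, Pi.add_apply, smul_add]
      map_smul' := by
        intro c f
        rw [RingHom.id_apply, ← MemLp.toLp_const_smul]
        refine MemLp.toLp_congr _ _ ?_
        filter_upwards [((wMeasure_absolutelyContinuous m φ t).trans
          (absolutelyContinuous_wMeasure m φ s)).ae_eq (Lp.coeFn_smul c f)] with x hx
        rw [hx, Pi.smul_apply, Pi.smul_apply, smul_comm] }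
    1 (fun f => by
      simp only [LinearMap.coe_mk, AddHom.coe_mk, one_mul]
      rw [Lp.norm_toLp, eLpNorm_rpow_smul, Lp.norm_def])

theorem mulW_coeFn (s t : ℝ) (f : L2w m φ s) :
    mulW m φ s t f =ᵐ[m] fun x => φ.w x ^ (s - t) • f x :=
  (absolutelyContinuous_wMeasure m φ t).ae_eq (MemLp.coeFn_toLp (memLp_rpow_smul s t f))

theorem norm_mulW (s t : ℝ) (f : L2w m φ s) : ‖mulW m φ s t f‖ = ‖f‖ := by
  change ‖(memLp_rpow_smul s t f).toLp‖ = _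
  rw [Lp.norm_toLp, eLpNorm_rpow_smul, Lp.norm_def]

theorem mulW_injective (s t : ℝ) : Function.Injective (mulW m φ s t) := by
  refine (injective_iff_map_eq_zero _).2 fun f hf => ?_
  rw [← norm_eq_zero, ← norm_mulW s t f, hf, norm_zero]

/-- Multiplication by `φ⁻²` identifies `L²_{φ⁻¹}` with the dual of `L²_φ` with respect to the
pairing of `L²`. -/
theorem inner_mulW_fromL2 (h : Lp ℂ 2 m) (x : L2w m φ 1) :
    ⟪mulW m φ (-1) 1 (fromL2 m φ h), x⟫_ℂ = ⟪h, toL2 m φ zero_le_one x⟫_ℂ := by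
  rw [L2.inner_def, L2.inner_def]
  refine (integral_withDensity_eq_integral_toReal_smul₀ (φ.measurable_density 1).aemeasurable
    (Eventually.of_forall fun _ => ENNReal.ofReal_lt_top) _).trans (integral_congr_ae ?_)
  have h1 : fromL2 m φ h =ᵐ[m] h :=
    (absolutelyContinuous_wMeasure m φ (-1)).ae_eq (lpEmb_coeFn _ h)
  have h2 : toL2 m φ zero_le_one x =ᵐ[m] x := lpEmb_coeFn _ x
  filter_upwards [mulW_coeFn (-1) 1 (fromL2 m φ h), h1, h2] with a ha h1a h2a
  have hpos := zero_lt_one.trans_le (φ.one_le_w a)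
  rw [ENNReal.toReal_ofReal (sq_nonneg _), ha, h1a, h2a, inner_smul_left_eq_smul, smul_smul,
    Real.rpow_one, ← Real.rpow_natCast, ← Real.rpow_add hpos]
  norm_num

theorem toL2_embW_embW {t : ℝ} (h : 2 ≤ t) (u : L2w m φ t) :
    toL2 m φ zero_le_one (embW m φ one_le_two (embW m φ h u)) =
      toL2 m φ (zero_le_two.trans h) u := by
  rw [toL2_embW, toL2_embW]

end WeightedSpaces

section RieszInverse

variable {H : Type*} [NormedAddCommGroup H] [InnerProductSpace ℂ H]

/-- The inverse `h ↦ ⟨·, h⟩` of the Riesz identification. -/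
def rieszInv : H →L[ℂ] Dual' H :=
  LinearMap.mkContinuous
    { toFun := fun h => LinearMap.mkContinuous
        { toFun := fun g => ⟪g, h⟫_ℂ
          map_add' := fun _ _ => inner_add_left _ _ _
          map_smul' := fun _ _ => inner_smul_left _ _ _ } ‖h‖
        (fun g => by
          rw [mul_comm]
          exact norm_inner_le_norm g h)
      map_add' := fun _ _ => by ext; exact inner_add_right _ _ _
      map_smul' := fun _ _ => by ext; exact inner_smul_right _ _ _ }
    1 (fun h => by
      rw [one_mul]
      refine ContinuousLinearMap.opNorm_le_bound _ (norm_nonneg h) fun g => ?_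
      rw [mul_comm]
      exact norm_inner_le_norm g h)

theorem rieszInv_apply (h g : H) : rieszInv h g = ⟪g, h⟫_ℂ := rfl

theorem rieszInv_riesz [CompleteSpace H] (F : Dual' H) : rieszInv (riesz F) = F := by
  ext g
  rw [rieszInv_apply, inner_riesz]

end RieszInverse

/-! ### The limiting absorption principle -/

section LocallyFinite

/-- Adding to a closed null set `e ⊆ ℝ` a set that is locally finite off `e`. -/
theorem discreteIn_of_locally_finite {e D : Set ℝ} (he : IsClosed e)
    (hD : ∀ x ∉ e, ∃ N ∈ 𝓝 x, (D ∩ N).Finite) : DiscreteIn ((e ∪ D) \ e) eᶜ := by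
  refine ⟨he.isOpen_compl, fun x hx => hx.2, fun x hacc hx => ?_⟩
  obtain ⟨N, hN, hfin⟩ := hD x hx
  rw [accPt_iff_frequently] at hacc
  refine hacc ?_
  have hcl : ((D ∩ N) \ {x})ᶜ ∈ 𝓝 x :=
    (hfin.subset Set.sdiff_subset).isClosed.isOpen_compl.mem_nhds fun h => h.2 rfl
  filter_upwards [hN, hcl] with y hy hy' hyD
  exact hy' ⟨⟨hyD.2.1.resolve_left hyD.2.2, hy⟩, hyD.1⟩

theorem isClosed_union_of_locally_finite {e D : Set ℝ} (he : IsClosed e)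
    (hD : ∀ x ∉ e, ∃ N ∈ 𝓝 x, (D ∩ N).Finite) : IsClosed (e ∪ D) := by
  rw [← isOpen_compl_iff, isOpen_iff_mem_nhds]
  intro x hx
  have hxe : x ∉ e := fun h => hx (Or.inl h)
  obtain ⟨N, hN, hfin⟩ := hD x hxe
  have hcl : (D ∩ N)ᶜ ∈ 𝓝 x :=
    hfin.isClosed.isOpen_compl.mem_nhds fun h => hx (Or.inr h.1)
  filter_upwards [hN, hcl, he.isOpen_compl.mem_nhds hxe] with y h1 h2 h3 h4
  exact h4.elim h3 fun h => h2 ⟨h, h1⟩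

theorem volume_union_of_locally_finite {e D : Set ℝ} (he : volume e = 0)
    (hD : ∀ x ∉ e, ∃ N ∈ 𝓝 x, (D ∩ N).Finite) : volume (e ∪ D) = 0 := by
  rw [← Set.union_sdiff_self, measure_union_null_iff]
  refine ⟨he, measure_null_of_locally_null _ fun x hx => ?_⟩
  obtain ⟨N, hN, hfin⟩ := hD x hx.2
  refine ⟨(D \ e) ∩ N, Filter.inter_mem self_mem_nhdsWithin (mem_nhdsWithin_of_mem_nhds hN), ?_⟩
  exact (hfin.subset (Set.inter_subset_inter_left _ Set.sdiff_subset)).measure_zero _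

end LocallyFinite

namespace CompactPerturbation

section BoundaryValues

variable {H : Type*} [NormedAddCommGroup H] [InnerProductSpace ℂ H] [CompleteSpace H]
  {T T₁ : H →ₗ.[ℂ] H} {X X₂ Y : Type*} [NormedAddCommGroup X] [InnerProductSpace ℂ X]
  [NormedAddCommGroup X₂] [NormedSpace ℂ X₂] [NormedAddCommGroup Y] [NormedSpace ℂ Y]
  {W : CompactPerturbation T T₁ X X₂ Y} {l : Filter ℂ} {x : ℝ} {Ψ Ψ' : X →L[ℂ] Y}

theorem essSpec_eq (W : CompactPerturbation T T₁ X X₂ Y) : essSpec T = essSpec T₁ := by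
  refine essSpec_eq_of_isCompactOperator W.selfAdjoint W.selfAdjoint₁ W.mem W.mem₁ ?_
  have h : res T W.c - res T₁ W.c = (W.i ∘L W.e) ∘L W.K ∘L W.j :=
    ContinuousLinearMap.ext W.res_sub
  rw [h]
  exact (W.compact_K.comp_clm W.j).clm_comp (W.i ∘L W.e)

theorem BoundaryValues.tendsto_sandwich_res (hb : W.BoundaryValues l x Ψ Ψ') {S : H →ₗ.[ℂ] H}
    (hS : IsSelfAdjoint S) (hx : (x : ℂ) ∈ resolventSet S) :
    Tendsto (fun z => W.sandwich (res S z)) l (𝓝 (W.sandwich (res S x))) := by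
  have h1 : Tendsto id l (𝓝[resolventSet S] (x : ℂ)) :=
    tendsto_nhdsWithin_iff.2 ⟨hb.tendsto_id, by
      filter_upwards [hb.vertical] with z hz using mem_resolventSet_of_im_ne_zero hS hz.1⟩
  have h2 : Continuous fun R : H →L[ℂ] H => W.sandwich R := by unfold sandwich; fun_prop
  exact (h2.tendsto _).comp ((continuousOn_res S x hx).tendsto.comp h1)

theorem BoundaryValues.eq_sandwich_res (hb : W.BoundaryValues l x Ψ Ψ')
    (hx : (x : ℂ) ∈ resolventSet T₁) : W.sandwich (res T₁ x) = Ψ :=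
  have := hb.neBot
  tendsto_nhds_unique (hb.tendsto_sandwich_res W.selfAdjoint₁ hx) hb.tendsto

theorem BoundaryValues.tendsto_perturbed [CompleteSpace X] (hb : W.BoundaryValues l x Ψ Ψ')
    (hu : IsUnit (1 - W.comp x Ψ)) :
    Tendsto (fun z => W.sandwich (res T z)) l (𝓝 (W.perturbed x Ψ)) := by
  refine ((W.continuousAt_perturbed hu).tendsto.comp
    (hb.tendsto_id.prodMk_nhds hb.tendsto)).congr' ?_
  filter_upwards [hb.vertical] with z hz
  exact W.perturbed_sandwich (mem_resolventSet_of_im_ne_zero W.selfAdjoint hz.1)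
    (mem_resolventSet_of_im_ne_zero W.selfAdjoint₁ hz.1)

theorem BoundaryValues.perturbed_eq_sandwich_res [CompleteSpace X]
    (hb : W.BoundaryValues l x Ψ Ψ') (hu : IsUnit (1 - W.comp x Ψ))
    (hx : (x : ℂ) ∈ resolventSet T) : W.sandwich (res T x) = W.perturbed x Ψ :=
  have := hb.neBot
  tendsto_nhds_unique (hb.tendsto_sandwich_res W.selfAdjoint hx) (hb.tendsto_perturbed hu)

end BoundaryValues

section Weighted

variable {M : Type*} [MeasurableSpace M] {m : Measure M} {φ : Weight M}
  {T T₁ : Lp ℂ 2 m →ₗ.[ℂ] Lp ℂ 2 m}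
  {W : CompactPerturbation T T₁ (L2w m φ 1) (L2w m φ 2) (L2w m φ (-1))}
  {e : Set ℝ} {Rp Rm : ℝ → (L2w m φ 1 →L[ℂ] L2w m φ (-1))}

theorem sandwich_eq_asWeighted (hi : W.i = toL2 m φ zero_le_one) (hj : W.j = fromL2 m φ)
    (S : Lp ℂ 2 m →L[ℂ] Lp ℂ 2 m) : W.sandwich S = asWeighted m φ S := by
  rw [sandwich, hi, hj, asWeighted]

/-- The points `x + i s ε`, `ε ↘ 0`, approach `x` along the vertical line. -/
theorem vertical_approach (x : ℝ) {s : ℝ} (hs : s ≠ 0) :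
    (map (fun ε : ℝ => (x : ℂ) + s * ε * Complex.I) (𝓝[>] 0)).NeBot ∧
    Tendsto id (map (fun ε : ℝ => (x : ℂ) + s * ε * Complex.I) (𝓝[>] 0)) (𝓝 (x : ℂ)) ∧
    ∀ᶠ z in map (fun ε : ℝ => (x : ℂ) + s * ε * Complex.I) (𝓝[>] 0), z.im ≠ 0 ∧ z.re = x := by
  refine ⟨inferInstance, ?_, ?_⟩
  · have hc : Continuous fun ε : ℝ => (x : ℂ) + s * ε * Complex.I := by fun_prop
    have h := (hc.tendsto 0).mono_left (nhdsWithin_le_nhds (s := Set.Ioi 0))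
    simp only [Complex.ofReal_zero, mul_zero, zero_mul, add_zero] at h
    exact h
  · rw [eventually_map]
    filter_upwards [self_mem_nhdsWithin] with ε hε
    have hε0 : ε ≠ 0 := ne_of_gt hε
    simp [hs, hε0]

/-- The boundary values from the upper half plane. -/
theorem boundaryValues_p (hi : W.i = toL2 m φ zero_le_one) (hj : W.j = fromL2 m φ)
    (h : LAP m φ T₁ e Rp Rm) {x : ℝ} (hx : x ∉ e) :
    W.BoundaryValues (map (fun ε : ℝ => (x : ℂ) + (1 : ℝ) * ε * Complex.I) (𝓝[>] 0)) x
      (Rp x) (Rm x) := by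
  obtain ⟨h1, h2, h3⟩ := vertical_approach x one_ne_zero
  refine ⟨h1, h2, h3, ?_, ?_⟩
  · rw [tendsto_map'_iff]
    refine (h.tendsto_p x hx).congr fun ε => ?_
    simp only [Function.comp_apply, sandwich_eq_asWeighted hi hj, Complex.ofReal_one, one_mul]
  · rw [tendsto_map'_iff]
    refine (h.tendsto_m x hx).congr fun ε => ?_
    simp only [Function.comp_apply, sandwich_eq_asWeighted hi hj, Complex.ofReal_one, one_mul,
      map_add, map_mul, Complex.conj_ofReal, Complex.conj_I, mul_neg, sub_eq_add_neg]

/-- The boundary values from the lower half plane. -/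
theorem boundaryValues_m (hi : W.i = toL2 m φ zero_le_one) (hj : W.j = fromL2 m φ)
    (h : LAP m φ T₁ e Rp Rm) {x : ℝ} (hx : x ∉ e) :
    W.BoundaryValues (map (fun ε : ℝ => (x : ℂ) + (-1 : ℝ) * ε * Complex.I) (𝓝[>] 0)) x
      (Rm x) (Rp x) := by
  obtain ⟨h1, h2, h3⟩ := vertical_approach x (neg_ne_zero.2 one_ne_zero)
  refine ⟨h1, h2, h3, ?_, ?_⟩
  · rw [tendsto_map'_iff]
    refine (h.tendsto_m x hx).congr fun ε => ?_
    simp only [Function.comp_apply, sandwich_eq_asWeighted hi hj, Complex.ofReal_one,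
      Complex.ofReal_neg, neg_mul, one_mul, sub_eq_add_neg]
  · rw [tendsto_map'_iff]
    refine (h.tendsto_p x hx).congr fun ε => ?_
    simp only [Function.comp_apply, sandwich_eq_asWeighted hi hj, Complex.ofReal_one,
      Complex.ofReal_neg, neg_mul, one_mul,
      map_add, map_neg, map_mul, Complex.conj_ofReal, Complex.conj_I, mul_neg, neg_neg]

/-- Continuity up to the real line from one of the half planes `D`. At real points of the resolvent
sets the boundary values are the resolvents themselves, so that `perturbed` describes the extended
resolvent on all of the set. -/
theorem continuousOn_extRes (hi : W.i = toL2 m φ zero_le_one) (hj : W.j = fromL2 m φ)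
    {l : ℝ → Filter ℂ} {Ψ Ψ' : ℝ → (L2w m φ 1 →L[ℂ] L2w m φ (-1))}
    (hb : ∀ x ∉ e, W.BoundaryValues (l x) x (Ψ x) (Ψ' x))
    (hu : ∀ x ∉ e, x ∉ pointSpec T → IsUnit (1 - W.comp x (Ψ x)))
    {D : Set ℂ} (hD : ∀ z ∈ D, z.im ≠ 0)
    (hc : ContinuousOn (extRes m φ T₁ Ψ) {z | (z.im = 0 ∧ z.re ∉ e) ∨ z ∈ D}) :
    ContinuousOn (extRes m φ T fun x => W.perturbed x (Ψ x))
      {z | (z.im = 0 ∧ z.re ∉ e ∪ pointSpec T) ∨ z ∈ D} := by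
  have hreal : ∀ z : ℂ, z.im = 0 → z.re ∉ e → extRes m φ T₁ Ψ z = Ψ z.re := by
    intro z hz hze
    have hz' : ((z.re : ℝ) : ℂ) = z := Complex.ext rfl hz.symm
    rw [extRes]
    split_ifs with h
    · have := (hb _ hze).eq_sandwich_res (by rwa [hz'])
      rwa [hz', sandwich_eq_asWeighted hi hj] at this
    · rfl
  have hunit : ∀ z ∈ {z : ℂ | (z.im = 0 ∧ z.re ∉ e ∪ pointSpec T) ∨ z ∈ D},
      IsUnit (1 - W.comp z (extRes m φ T₁ Ψ z)) ∧
        extRes m φ T (fun x => W.perturbed x (Ψ x)) z = W.perturbed z (extRes m φ T₁ Ψ z) := by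
    rintro z (⟨hz, hze⟩ | hz)
    · have hz' : ((z.re : ℝ) : ℂ) = z := Complex.ext rfl hz.symm
      have hze1 : z.re ∉ e := fun h => hze (Or.inl h)
      have hu' := hu _ hze1 fun h => hze (Or.inr h)
      rw [hreal z hz hze1]
      refine ⟨by rwa [hz'] at hu', ?_⟩
      rw [extRes]
      split_ifs with h
      · have := (hb _ hze1).perturbed_eq_sandwich_res hu' (by rwa [hz'])
        rwa [hz', sandwich_eq_asWeighted hi hj] at this
      · rw [hz']
    · have h1 := mem_resolventSet_of_im_ne_zero W.selfAdjoint (hD z hz)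
      have h2 := mem_resolventSet_of_im_ne_zero W.selfAdjoint₁ (hD z hz)
      rw [extRes, extRes, if_pos h1, if_pos h2, ← sandwich_eq_asWeighted hi hj,
        ← sandwich_eq_asWeighted hi hj]
      exact ⟨W.isUnit_one_sub_comp_sandwich h1 h2, (W.perturbed_sandwich h1 h2).symm⟩
  have hsub : {z : ℂ | (z.im = 0 ∧ z.re ∉ e ∪ pointSpec T) ∨ z ∈ D} ⊆
      {z | (z.im = 0 ∧ z.re ∉ e) ∨ z ∈ D} := fun z hz =>
    hz.imp_left fun h => ⟨h.1, fun h' => h.2 (Or.inl h')⟩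
  refine ContinuousOn.congr (f := fun z => W.perturbed z (extRes m φ T₁ Ψ z)) ?_
    fun z hz => (hunit z hz).2
  intro z hz
  exact ContinuousAt.comp_continuousWithinAt (f := fun z => (z, extRes m φ T₁ Ψ z))
    (W.continuousAt_perturbed (hunit z hz).1)
    (continuousWithinAt_id.prodMk ((hc z (hsub hz)).mono hsub))

/-- Eigenvalues of `T` do not accumulate off `e`: on a compact set the bound on the eigenvectors is
uniform. -/
theorem locally_finite_pointSpec (he : W.e = embW m φ one_le_two)
    (hi : W.i = toL2 m φ zero_le_one) (hj : W.j = fromL2 m φ)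
    (h : LAP m φ T₁ e Rp Rm) (h3 : HypH3 m φ e Rp Rm) {x : ℝ} (hx : x ∉ e) :
    ∃ N ∈ 𝓝 x, (pointSpec T ∩ N).Finite := by
  obtain ⟨K, hK, hxK, hKe⟩ := exists_compact_subset h.isClosed.isOpen_compl hx
  refine ⟨K, mem_interior_iff_mem_nhds.1 hxK, ?_⟩
  obtain ⟨C, hC0, hC⟩ := h3 K hK hKe
  obtain ⟨B, hB⟩ := hK.exists_bound_of_continuousOn (f := fun y : ℝ => (W.c : ℂ) - y)
    (by fun_prop)
  refine finite_pointSpec_inter W (C := (‖W.i ∘L W.e‖ + B * C) * B) fun y hy v hv => ?_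
  have hb := boundaryValues_p hi hj h (hKe hy)
  refine (hb.norm_le_of_mem_eigenspace (C := C) (fun u hu => ?_) hv).trans ?_
  · rw [he] at hu ⊢
    rw [hj]
    exact (hC y hy u (by rw [_root_.sub_apply, hu, sub_self])).1
  · have h1 := hB y hy
    have h0 := (norm_nonneg _).trans h1
    gcongr

/-- The limiting absorption principle passes from `T₁` to `T`. -/
theorem lap_of_lap (he : W.e = embW m φ one_le_two)
    (hi : W.i = toL2 m φ zero_le_one) (hj : W.j = fromL2 m φ)
    (h : LAP m φ T₁ e Rp Rm) (h3 : HypH3 m φ e Rp Rm) :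
    LAP m φ T (e ∪ pointSpec T) (fun x => W.perturbed x (Rp x))
      (fun x => W.perturbed x (Rm x)) := by
  have hfin := fun x (hx : x ∉ e) => locally_finite_pointSpec he hi hj h h3 hx
  have hu : ∀ x ∉ e, x ∉ pointSpec T →
      IsUnit (1 - W.comp x (Rp x)) ∧ IsUnit (1 - W.comp x (Rm x)) := by
    intro x hx hxp
    obtain ⟨C, -, hC⟩ := h3 {x} isCompact_singleton (Set.singleton_subset_iff.2 hx)
    refine ⟨(boundaryValues_p hi hj h hx).isUnit (fun u hu => ?_) hxp,
      (boundaryValues_m hi hj h hx).isUnit (fun u hu => ?_) hxp⟩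
    · rw [he] at hu ⊢
      rw [hj]
      obtain ⟨w, hw, -⟩ := (hC x rfl u (by rw [_root_.sub_apply, hu, sub_self])).1
      exact ⟨w, hw⟩
    · rw [he] at hu ⊢
      rw [hj]
      obtain ⟨w, hw, -⟩ := (hC x rfl u (by rw [_root_.sub_apply, hu, sub_self])).2
      exact ⟨w, hw⟩
  refine ⟨isClosed_union_of_locally_finite h.isClosed hfin,
    volume_union_of_locally_finite h.null hfin, fun x hx => ?_, fun x hx => ?_, ?_, ?_⟩
  · have hxe : x ∉ e := fun h => hx (Or.inl h)
    have h1 := (boundaryValues_p hi hj h hxe).tendsto_perturbed (hu x hxe fun h => hx (Or.inr h)).1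
    rw [tendsto_map'_iff] at h1
    refine h1.congr fun ε => ?_
    simp only [Function.comp_apply, sandwich_eq_asWeighted hi hj, Complex.ofReal_one, one_mul]
  · have hxe : x ∉ e := fun h => hx (Or.inl h)
    have h1 := (boundaryValues_m hi hj h hxe).tendsto_perturbed (hu x hxe fun h => hx (Or.inr h)).2
    rw [tendsto_map'_iff] at h1
    refine h1.congr fun ε => ?_
    simp only [Function.comp_apply, sandwich_eq_asWeighted hi hj, Complex.ofReal_one,
      Complex.ofReal_neg, neg_mul, one_mul, sub_eq_add_neg]
  · exact continuousOn_extRes hi hj (fun x hx => boundaryValues_p hi hj h hx)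
      (fun x hx hxp => (hu x hx hxp).1) (D := {z | 0 < z.im}) (fun z hz => ne_of_gt hz) h.cont_p
  · exact continuousOn_extRes hi hj (fun x hx => boundaryValues_m hi hj h hx)
      (fun x hx hxp => (hu x hx hxp).2) (D := {z | z.im < 0}) (fun z hz => ne_of_lt hz) h.cont_m

end Weighted

end CompactPerturbation

section Application

variable {M : Type*} [MeasurableSpace M] {m : Measure M} {φ : Weight M}
    {h₁ h₂ b₁ b₂ b₂₂ : Type*}
    [NormedAddCommGroup h₁] [InnerProductSpace ℂ h₁] [CompleteSpace h₁]
    [NormedAddCommGroup h₂] [InnerProductSpace ℂ h₂] [CompleteSpace h₂]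
    [NormedAddCommGroup b₁] [NormedSpace ℂ b₁] [CompleteSpace b₁]
    [NormedAddCommGroup b₂] [NormedSpace ℂ b₂] [CompleteSpace b₂]
    [NormedAddCommGroup b₂₂] [NormedSpace ℂ b₂₂] [CompleteSpace b₂₂]

/-- At a large real point the difference of the resolvents of `A_B` and `A_{B₁}` extends to a compact
operator from `L²_{φ⁻¹}` to `L²_{φ²}`: it factors through the compact embedding `h₂ ↪ b₂`. -/
theorem PerturbationData.exists_compactPerturbation
    (P : PerturbationData (Lp ℂ 2 m) h₁ h₂ b₁ b₂ b₂₂) (hZ : P.Z.Nonempty) (hZ₁ : P.Z₁.Nonempty)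
    (H1 : HypH1 m φ P.AB₁) (H4 : HypH4 m φ P) :
    ∃ W : CompactPerturbation P.AB P.AB₁ (L2w m φ 1) (L2w m φ 2) (L2w m φ (-1)),
      W.e = embW m φ one_le_two ∧ W.i = toL2 m φ zero_le_one ∧ W.j = fromL2 m φ := by
  obtain ⟨-, c₁, -, hspec, hreg⟩ := H1
  obtain ⟨hbd, hι, c₂, -, -, η, hη, hG⟩ := H4
  have hT := (P.AB_spec hZ).1
  have hT₁ := (P.AB₁_spec hZ₁).1
  obtain ⟨c₀, hc₀⟩ := BddAboveOp.exists_mem_resolventSet hT hbd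
  obtain ⟨c, hc⟩ := exists_gt (max c₀ (max c₁ c₂))
  obtain ⟨hc0, hc1, hc2⟩ : c₀ < c ∧ c₁ < c ∧ c₂ < c := by simpa only [max_lt_iff] using hc
  have hmem : (c : ℂ) ∈ resolventSet P.AB := hc₀ c hc0
  have hmem₁ : (c : ℂ) ∈ resolventSet P.AB₁ := by
    by_contra h
    exact absurd (hspec c h) (not_le.2 hc1)
  obtain ⟨S, hS⟩ := hG c hmem₁ hc2
  obtain ⟨R, hR⟩ := hreg c hmem₁ hc1
  obtain ⟨N, Y, hY, hres⟩ := P.res_AB_sub_res_AB₁ hZ hZ₁ hmem hmem₁ hS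
  have h2 : (2 : ℝ) ≤ 2 + η := by linarith
  have h1 : (1 : ℝ) ≤ 2 + η := by linarith
  -- `J` extends `τ₂ (-A_{B₁} + c)⁻¹` to `L²_{φ⁻¹}`, as the adjoint of `S`
  set J : L2w m φ (-1) →L[ℂ] h₂ :=
    ContinuousLinearMap.adjoint (embW m φ h1 ∘L S ∘L rieszInv) ∘L mulW m φ (-1) 1 with hJ
  have hYJ : ∀ f, Y f = P.ι₂ (J (fromL2 m φ f)) := by
    intro f
    refine eq_of_forall_dual' fun ψ => ?_
    rw [← hY]
    have h3 : ψ (P.ι₂ (J (fromL2 m φ f))) = (dualMap P.ι₂ ψ) (J (fromL2 m φ f)) := rfl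
    have h4 : J (fromL2 m φ f) = ContinuousLinearMap.adjoint (embW m φ h1 ∘L S ∘L rieszInv)
      (mulW m φ (-1) 1 (fromL2 m φ f)) := rfl
    rw [h3, ← inner_riesz, h4, ContinuousLinearMap.adjoint_inner_left]
    change _ = ⟪_, embW m φ h1 (S (rieszInv (riesz (dualMap P.ι₂ ψ))))⟫_ℂ
    rw [rieszInv_riesz, inner_mulW_fromL2, toL2_embW]
    rfl
  refine ⟨{ e := embW m φ one_le_two
            i := toL2 m φ zero_le_one
            j := fromL2 m φ
            U := mulW m φ (-1) 1
            i_injective := toL2_injective _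
            j_injective := fromL2_injective
            U_injective := mulW_injective _ _
            inner_U := inner_mulW_fromL2
            selfAdjoint := hT
            selfAdjoint₁ := hT₁
            c := c
            mem := hmem
            mem₁ := hmem₁
            regular := fun x => ⟨R x, hR x⟩
            K := (embW m φ h2 ∘L S ∘L dualMap P.ι₂ ∘L N) ∘L P.ι₂ ∘L J
            compact_K := (hι.comp_clm J).clm_comp (embW m φ h2 ∘L S ∘L dualMap P.ι₂ ∘L N)
            res_sub := ?_ }, rfl, rfl, rfl⟩
  intro f
  rw [hres, hYJ]
  exact (toL2_embW_embW h2 _).symm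

end Application

end KreinLAP

end

theorem theorem3p1 {M : Type*} [MeasurableSpace M] (m : MeasureTheory.Measure M)
    (φ : KreinLAP.Weight M)
    {h₁ h₂ b₁ b₂ b₂₂ : Type*}
    [NormedAddCommGroup h₁] [InnerProductSpace ℂ h₁] [CompleteSpace h₁]
    [NormedAddCommGroup h₂] [InnerProductSpace ℂ h₂] [CompleteSpace h₂]
    [NormedAddCommGroup b₁] [NormedSpace ℂ b₁] [CompleteSpace b₁]
    [NormedAddCommGroup b₂] [NormedSpace ℂ b₂] [CompleteSpace b₂]
    [NormedAddCommGroup b₂₂] [NormedSpace ℂ b₂₂] [CompleteSpace b₂₂]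
    (P : KreinLAP.PerturbationData (MeasureTheory.Lp ℂ 2 m) h₁ h₂ b₁ b₂ b₂₂)
    (hZ : P.Z.Nonempty) (hZ₁ : P.Z₁.Nonempty)
    (e : Set ℝ)
    (Rp Rm : ℝ → (KreinLAP.L2w m φ 1 →L[ℂ] KreinLAP.L2w m φ (-1)))
    (H1 : KreinLAP.HypH1 m φ P.AB₁)
    (H2 : KreinLAP.LAP m φ P.AB₁ e Rp Rm)
    (H3 : KreinLAP.HypH3 m φ e Rp Rm)
    (H4 : KreinLAP.HypH4 m φ P) :
    (IsSelfAdjoint P.AB₁ ∧ ∀ z ∈ P.Z₁, KreinLAP.IsResolventAt P.AB₁ z (P.RB₁ z)) ∧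
    (IsSelfAdjoint P.AB ∧ ∀ z ∈ P.Z, KreinLAP.IsResolventAt P.AB z (P.RB z)) ∧
    (∃ Sp Sm : ℝ → (KreinLAP.L2w m φ 1 →L[ℂ] KreinLAP.L2w m φ (-1)),
      KreinLAP.LAP m φ P.AB (e ∪ KreinLAP.pointSpec P.AB) Sp Sm) ∧
    KreinLAP.DiscreteIn ((e ∪ KreinLAP.pointSpec P.AB) \ e) eᶜ ∧
    KreinLAP.essSpec P.AB = KreinLAP.essSpec P.AB₁ := by
  obtain ⟨W, he, hi, hj⟩ := P.exists_compactPerturbation hZ hZ₁ H1 H4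
  exact ⟨P.AB₁_spec hZ₁, P.AB_spec hZ, ⟨_, _, W.lap_of_lap he hi hj H2 H3⟩,
    KreinLAP.discreteIn_of_locally_finite H2.isClosed fun x hx =>
      W.locally_finite_pointSpec he hi hj H2 H3 hx, W.essSpec_eq⟩
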